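/- **Setting.** There are $n$ pages, a cache size $k$ with $1\le k\le n$, a known time horizon $T\ge 1$, and an oblivious request sequence $r_1,\dots,r_T$ of pages, fixed in advance. In each round $t=1,\dots,T$ the (randomized) online algorithm is shown $r_t$ and then selects a cache $A_t$ consisting of exactly $k$ pages. It incurs the loss $\ell_{r_t}(A_t)$, where $\ell_i(C)=0$ if $i\in C$ and $\ell_i(C)=2$ if $i\notin C$, and moving from the cache $A_{t-1}$ to $A_t$ costs $d(A_t,A_{t-1})=|A_t\setminus A_{t-1}|$. **Computational model.** A paging algorithm is one fixed program for a random access machine with arrays of natural numbers and of real numbers; it receives $n,k,T$ as inputs, is run once in each round after $r_t$ has been written to memory, and keeps its memory between rounds. Arithmetic operations, exponentiation, evaluation of the error function, comparisons, memory accesses and sampling uniformly from $[0,1]$ cost one step each; literals are natural numbers. **Corollary.** There are a paging algorithm, an integer $d\ge 0$ and a constant $K$ such that for all $1\le k\le n$ there is a constant $\beta>0$ such that, for all $T\ge 1$ and all $r_1,\dots,r_T$, the random caches $A_1,\dots,A_T$ selected by the algorithm satisfy the following. * (Runtime.) For every outcome of the random samples the algorithm spends at most $d\,(n+\log T)^d$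 steps in each round (any initialization counts as part of the first round); that is, the per-round runtime is $\mathrm{poly}(n,\log T)$. * (The competitive ratio is $2H_k$, where $H_k=\sum_{j=1}^k \frac1j$.) For all caches $C_1,\dots,C_T$ of size $k$, $$\mathbb E\Big[\sum_{t=1}^T \ell_{r_t}(A_t)+\sum_{t=2}^T d(A_t,A_{t-1})\Big]\le 2H_k\Big(\sum_{t=1}^T \ell_{r_t}(C_t)+\sum_{t=2}^T d(C_t,C_{t-1})\Big)+\beta .$$ * (Regret.) For every interval $I=\{a,\dots,b\}\subseteq\{1,\dots,T\}$ and every cache $C$ of size $k$, $$\mathbb E\Big[\sum_{t=a}^b \ell_{r_t}(A_t)+\sum_{t=a+1}^b d(A_t,A_{t-1})\Big]\le \sum_{t=a}^b \ell_{r_t}(C)+K\,k\sqrt{|I|\log(nT)} .$$ -/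

import Mathlib

namespace Paging

/-! ### The computational model

A randomized real random access machine, programmed in a structured language.  The memory consists
of unboundedly many arrays of natural numbers and of real numbers, all initially zero.  One step
is charged for every arithmetic operation, exponentiation, evaluation of the error function,
comparison, memory access, and sample from the uniform distribution on `[0, 1]`.  The only literals
are natural numbers, and there is no rounding of real numbers. -/

/-- The error function `erf x = (2 / √π) ∫₀ˣ exp (-s²) ds`. -/
noncomputable def erf (x : ℝ) : ℝ :=
  2 / Real.sqrt Real.pi * ∫ s in (0 : ℝ)..x, Real.exp (-s ^ 2)

/-- Memory of the machine: arrays of naturals, arrays of reals, and the number of random samples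
that have been drawn so far. -/
structure State where
  nat : ℕ → ℕ → ℕ
  real : ℕ → ℕ → ℝ
  drawn : ℕ

/-- Natural-number expressions; `get a i` reads cell `i` of the natural-number array `a`. -/
inductive NExp where
  | lit (c : ℕ)
  | get (a : ℕ) (i : NExp)
  | add (e f : NExp)
  | sub (e f : NExp)
  | mul (e f : NExp)

/-- Real expressions; `get a i` reads cell `i` of the real array `a`. -/
inductive RExp where
  | ofNat (e : NExp)
  | get (a : ℕ) (i : NExp)
  | add (x y : RExp)
  | sub (x y : RExp)
  | mul (x y : RExp)
  | div (x y : RExp)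
  | exp (x : RExp)
  | pow (x y : RExp)
  | erf (x : RExp)

/-- Tests. -/
inductive BExp where
  | natLt (e f : NExp)
  | realLt (x y : RExp)
  | not (b : BExp)
  | and (b d : BExp)

/-- Programs. `natSet a i e` and `realSet a i x` write into cell `i` of the array `a`;
`sample a i` writes a fresh uniform sample from `[0, 1]` into cell `i` of the real array `a`. -/
inductive Program where
  | skip
  | natSet (a : ℕ) (i e : NExp)
  | realSet (a : ℕ) (i : NExp) (x : RExp)
  | sample (a : ℕ) (i : NExp)
  | seq (p q : Program)
  | cond (b : BExp) (p q : Program)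
  | loop (b : BExp) (p : Program)

/-- Value of a natural-number expression (subtraction is truncated at `0`). -/
def NExp.eval (s : State) : NExp → ℕ
  | lit c => c
  | get a i => s.nat a (i.eval s)
  | add e f => e.eval s + f.eval s
  | sub e f => e.eval s - f.eval s
  | mul e f => e.eval s * f.eval s

/-- Value of a real expression (`x / 0 = 0`, and `x ^ y` is `0` for a base `x ≤ 0`). -/
noncomputable def RExp.eval (s : State) : RExp → ℝ
  | ofNat e => (e.eval s : ℝ)
  | get a i => s.real a (i.eval s)
  | add x y => x.eval s + y.eval s
  | sub x y => x.eval s - y.eval s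
  | mul x y => x.eval s * y.eval s
  | div x y => x.eval s / y.eval s
  | exp x => Real.exp (x.eval s)
  | pow x y => if 0 < x.eval s then x.eval s ^ y.eval s else 0
  | erf x => Paging.erf (x.eval s)

/-- Truth of a test. -/
def BExp.holds (s : State) : BExp → Prop
  | natLt e f => e.eval s < f.eval s
  | realLt x y => x.eval s < y.eval s
  | not b => ¬ b.holds s
  | and b d => b.holds s ∧ d.holds s

/-- Number of steps charged for evaluating a natural-number expression. -/
def NExp.cost : NExp → ℕ
  | lit _ => 1
  | get _ i => i.cost + 1
  | add e f => e.cost + f.cost + 1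
  | sub e f => e.cost + f.cost + 1
  | mul e f => e.cost + f.cost + 1

/-- Number of steps charged for evaluating a real expression. -/
def RExp.cost : RExp → ℕ
  | ofNat e => e.cost + 1
  | get _ i => i.cost + 1
  | add x y => x.cost + y.cost + 1
  | sub x y => x.cost + y.cost + 1
  | mul x y => x.cost + y.cost + 1
  | div x y => x.cost + y.cost + 1
  | exp x => x.cost + 1
  | pow x y => x.cost + y.cost + 1
  | erf x => x.cost + 1

/-- Number of steps charged for evaluating a test. -/
def BExp.cost : BExp → ℕ
  | natLt e f => e.cost + f.cost + 1
  | realLt x y => x.cost + y.cost + 1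
  | not b => b.cost + 1
  | and b d => b.cost + d.cost + 1

/-- Write the natural number `v` into cell `i` of the natural-number array `a`. -/
def State.setNat (s : State) (a i v : ℕ) : State :=
  { s with nat := Function.update s.nat a (Function.update (s.nat a) i v) }

/-- Write the real number `v` into cell `i` of the real array `a`. -/
noncomputable def State.setReal (s : State) (a i : ℕ) (v : ℝ) : State :=
  { s with real := Function.update s.real a (Function.update (s.real a) i v) }

/-- The random source: an infinite sequence of samples from `[0, 1]`. -/
abbrev Coins : Type := ℕ → unitInterval

/-- The samples are independent and uniformly distributed on `[0, 1]`. -/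
noncomputable def coinMeasure : MeasureTheory.Measure Coins :=
  MeasureTheory.Measure.infinitePi fun _ : ℕ => (MeasureTheory.volume : MeasureTheory.Measure unitInterval)

/-- `Exec ω p s τ s'`: with random source `ω`, the program `p` started in the memory `s` halts
after exactly `τ` steps with memory `s'`. -/
inductive Exec (ω : Coins) : Program → State → ℕ → State → Prop
  | skip (s : State) : Exec ω Program.skip s 1 s
  | natSet (s : State) (a : ℕ) (i e : NExp) :
      Exec ω (Program.natSet a i e) s (i.cost + e.cost + 1) (s.setNat a (i.eval s) (e.eval s))
  | realSet (s : State) (a : ℕ) (i : NExp) (x : RExp) :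
      Exec ω (Program.realSet a i x) s (i.cost + x.cost + 1) (s.setReal a (i.eval s) (x.eval s))
  | sample (s : State) (a : ℕ) (i : NExp) :
      Exec ω (Program.sample a i) s (i.cost + 1)
        { s.setReal a (i.eval s) (ω s.drawn : ℝ) with drawn := s.drawn + 1 }
  | seq {p q : Program} {s s₁ s₂ : State} {τ₁ τ₂ : ℕ} :
      Exec ω p s τ₁ s₁ → Exec ω q s₁ τ₂ s₂ → Exec ω (Program.seq p q) s (τ₁ + τ₂) s₂
  | condTrue {b : BExp} {p q : Program} {s s' : State} {τ : ℕ} :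
      b.holds s → Exec ω p s τ s' → Exec ω (Program.cond b p q) s (b.cost + τ + 1) s'
  | condFalse {b : BExp} {p q : Program} {s s' : State} {τ : ℕ} :
      ¬ b.holds s → Exec ω q s τ s' → Exec ω (Program.cond b p q) s (b.cost + τ + 1) s'
  | loopDone {b : BExp} {p : Program} {s : State} :
      ¬ b.holds s → Exec ω (Program.loop b p) s (b.cost + 1) s
  | loopStep {b : BExp} {p : Program} {s s₁ s₂ : State} {τ₁ τ₂ : ℕ} :
      b.holds s → Exec ω p s τ₁ s₁ → Exec ω (Program.loop b p) s₁ τ₂ s₂ →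
      Exec ω (Program.loop b p) s (b.cost + τ₁ + τ₂ + 1) s₂

/-- Executions are deterministic once the random source is fixed. -/
theorem Exec.deterministic {ω : Coins} {p : Program} {s s₁ s₂ : State} {τ₁ τ₂ : ℕ}
    (h₁ : Exec ω p s τ₁ s₁) (h₂ : Exec ω p s τ₂ s₂) : τ₁ = τ₂ ∧ s₁ = s₂ := by
  induction h₁ generalizing τ₂ s₂ with
  | skip | natSet | realSet | sample => cases h₂; exact ⟨rfl, rfl⟩
  | seq _ _ ih₁ ih₂ =>
    cases h₂ with
    | seq g₁ g₂ =>
      obtain ⟨rfl, rfl⟩ := ih₁ g₁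
      obtain ⟨rfl, rfl⟩ := ih₂ g₂
      exact ⟨rfl, rfl⟩
  | condTrue hb _ ih =>
    cases h₂ with
    | condTrue _ g => obtain ⟨rfl, rfl⟩ := ih g; exact ⟨rfl, rfl⟩
    | condFalse hn _ => exact absurd hb hn
  | condFalse hb _ ih =>
    cases h₂ with
    | condTrue hn _ => exact absurd hn hb
    | condFalse _ g => obtain ⟨rfl, rfl⟩ := ih g; exact ⟨rfl, rfl⟩
  | loopDone hb =>
    cases h₂ with
    | loopDone _ => exact ⟨rfl, rfl⟩
    | loopStep hn _ _ => exact absurd hn hb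
  | loopStep hb _ _ ih₁ ih₂ =>
    cases h₂ with
    | loopDone hn => exact absurd hb hn
    | loopStep _ g₁ g₂ =>
      obtain ⟨rfl, rfl⟩ := ih₁ g₁
      obtain ⟨rfl, rfl⟩ := ih₂ g₂
      exact ⟨rfl, rfl⟩

/-! ### Paging -/

/-- Loss of the cache `C` on a request for page `i`: nothing if `i` is in the cache, and otherwise
two, for fetching `i` and then fetching back the page that was evicted. -/
def missLoss {n : ℕ} (i : Fin n) (C : Finset (Fin n)) : ℝ :=
  if i ∈ C then 0 else 2

/-- Cost of moving between two caches of equal size: the number `|C \ C'|` of fetched pages. -/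
def moveCost {n : ℕ} (C C' : Finset (Fin n)) : ℝ :=
  ((C \ C').card : ℝ)

/-- Cost in the rounds `a, …, b` of using the caches `A a, …, A b` on the requests `r a, …, r b`:
the losses in all these rounds and the movement costs in all but the first of them. -/
def intervalCost {n : ℕ} (r : ℕ → Fin n) (A : ℕ → Finset (Fin n)) (a b : ℕ) : ℝ :=
  ∑ t ∈ Finset.Icc a b, missLoss (r t) (A t) +
    ∑ t ∈ Finset.Icc (a + 1) b, moveCost (A t) (A (t - 1))

/-- The memory before the first round: cells `0, 1, 2` of the natural-number array `0` hold
the number of pages, the cache size and the time horizon; everything else is zero. -/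
def initialState (n k T : ℕ) : State where
  nat a i := if a = 0 then (if i = 0 then n else if i = 1 then k else if i = 2 then T else 0) else 0
  real _ _ := 0
  drawn := 0

/-- At the beginning of a round the index of the requested page (one of `0, …, n - 1`) is put into
cell `3` of the natural-number array `0`. -/
def State.withRequest {n : ℕ} (s : State) (i : Fin n) : State :=
  s.setNat 0 3 (i : ℕ)

/-- The cache that is selected at the end of a round: the page with index `i` is in it if
and only if cell `i` of the natural-number array `1` is nonzero. -/
def State.cache (s : State) (n : ℕ) : Finset (Fin n) :=
  Finset.univ.filter fun i => s.nat 1 (i : ℕ) ≠ 0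

/-- With the random source `ω`, the program `P` run on `n` pages, cache size `k`, time horizon `T`
and the requests `r 1, …, r T` selects the caches `A 1, …, A T`, each of size `k`, spending at
most `B` steps in each round.  The request `r t` is revealed at the beginning of round `t`, the
cache `A t` is read off at the end of round `t`, and the memory is kept between rounds. -/
def Selects (P : Program) (n k T : ℕ) (r : ℕ → Fin n) (ω : Coins) (B : ℝ)
    (A : ℕ → Finset (Fin n)) : Prop :=
  ∃ S : ℕ → State, S 0 = initialState n k T ∧
    ∀ t ∈ Finset.Icc 1 T,
      (∃ τ : ℕ, (τ : ℝ) ≤ B ∧ Exec ω P ((S (t - 1)).withRequest (r t)) τ (S t)) ∧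
      A t = (S t).cache n ∧ (A t).card = k

end Paging

/-! Let `l = Nat.clog 2 (n * T)`. The algorithm simulates `l + 1` elementary strategies, the rows,
and plays the cache of one of them, chosen by random thresholds.

Row `0` is the marking algorithm, with random priorities drawn once. Its expected cost is at most
`H_k * (2 * OPT + k)` (`marking_competitive`): in a phase with `a` pages that were not marked in the
preceding phase it makes at most `a * H_k` expected faults, and every such page is charged at most
twice to the offline cost. Row `m ≥ 1` follows the perturbed leader with noise of size `h = 2 ^ (l -
m)` and restarts every `l * h ^ 2` rounds. On one block its expected regret is `O(k * h + l * h)`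
(`integral_sum_rowCost_le`): seeing one round ahead costs at most the noise of `k` pages, and the
requested page enters the cache with probability at most `1 / h` per round.

Rows are merged one at a time, from coarse to fine. Level `m + 1` follows row `m + 1` with a weight
`x` in `[ε, 1]` and level `m` otherwise. The update is implicit, `x' - x = γ * x' * g` for the gain
`g` of the new row, up to clipping. Since `g` is known before the cache has to be chosen, no
second-order error arises. The potential `x / γ` bounds the loss against level `m` by `x_a / γ` on
an interval with starting weight `x_a` (`sum_combinedCost_le_first`), and the potential `(log x - x)
/ γ` bounds the loss against row `m + 1` by `log (1 / ε) / γ` on every interval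
(`sum_combinedCost_le_second`). Thresholds stay fixed in time, so a weight change of `δ` forces a
switch with probability `|δ|`, which costs at most `k * |δ|`; this is prepaid by a surcharge on the
new row (`moveCost_charge`, `integral_roundCost_levelCache_le`).

Competitiveness: from time `0` all weights start at `ε = 4 ^ (-l)`, so all merges together lose only
`15 * k` against marking (`sum_levelCost_le_marking`). Regret: with `1 / γ` proportional to `k * h`,
the losses to finer levels form a geometric series, and on one block every term is `O(k * l * h)`,
which is `k` times the square root of `l` times the block length (`regret_block`). An interval of
length `L` is handled by the row whose block length lies between `L / 16` and `L / 4`: at most 16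
blocks, preceded by a piece of length at most `L / 4` that is treated recursively
(`regret_interval`).

The merging inequalities hold for every outcome of the samples and expectations are taken row by
row, so all rows and all blocks can share the same `n` noise samples. The last part verifies that a
concrete program computes these caches. -/

namespace Paging

open Finset

/-! ### The `k` pages of highest score -/

section Top

variable {n : ℕ}

/-- Page `j` precedes page `i` under the score `f`; ties are broken by the index. -/
def Precedes (f : Fin n → ℝ) (j i : Fin n) : Prop :=
  f i < f j ∨ (¬ f j < f i ∧ j < i)

open Classical in
/-- The number of pages that precede page `i`. -/
noncomputable def rank (f : Fin n → ℝ) (i : Fin n) : ℕ :=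
  (univ.filter fun j => Precedes f j i).card

/-- The `k` pages of highest score. -/
noncomputable def top (k : ℕ) (f : Fin n → ℝ) : Finset (Fin n) :=
  univ.filter fun i => rank f i < k

theorem mem_top {k : ℕ} {f : Fin n → ℝ} {i : Fin n} : i ∈ top k f ↔ rank f i < k := by
  simp [top]

theorem Precedes.irrefl (f : Fin n → ℝ) (i : Fin n) : ¬ Precedes f i i := by
  simp [Precedes]

theorem Precedes.trans {f : Fin n → ℝ} {a b c : Fin n} (h₁ : Precedes f a b)
    (h₂ : Precedes f b c) : Precedes f a c := by
  unfold Precedes at *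
  rcases h₁ with h₁ | ⟨h₁, h₁'⟩ <;> rcases h₂ with h₂ | ⟨h₂, h₂'⟩
  · left; linarith
  · left; linarith [not_lt.1 h₂]
  · left; linarith [not_lt.1 h₁]
  · right; exact ⟨by linarith [not_lt.1 h₁, not_lt.1 h₂], h₁'.trans h₂'⟩

theorem Precedes.total (f : Fin n → ℝ) {a b : Fin n} (h : a ≠ b) :
    Precedes f a b ∨ Precedes f b a := by
  unfold Precedes
  rcases lt_trichotomy (f a) (f b) with h₁ | h₁ | h₁
  · right; left; exact h₁
  · rcases lt_or_gt_of_ne h with h₂ | h₂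
    · left; right; exact ⟨by simp [h₁], h₂⟩
    · right; right; exact ⟨by simp [h₁], h₂⟩
  · left; left; exact h₁

theorem rank_lt_rank {f : Fin n → ℝ} {i j : Fin n} (h : Precedes f i j) :
    rank f i < rank f j := by
  classical
  unfold rank
  apply card_lt_card
  refine (Finset.ssubset_iff_of_subset ?_).2 ⟨i, by simpa using h, by simpa using Precedes.irrefl f i⟩
  intro a ha
  simp only [mem_filter, mem_univ, true_and] at ha ⊢
  exact ha.trans h

theorem precedes_iff_rank_lt {f : Fin n → ℝ} {i j : Fin n} :
    Precedes f i j ↔ rank f i < rank f j := by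
  refine ⟨rank_lt_rank, fun h => ?_⟩
  by_contra hn
  rcases eq_or_ne i j with rfl | hne
  · exact lt_irrefl _ h
  · exact lt_asymm h (rank_lt_rank ((Precedes.total f hne).resolve_left hn))

theorem rank_injective (f : Fin n → ℝ) : Function.Injective (rank f) := by
  intro i j h
  by_contra hne
  rcases Precedes.total f hne with h' | h'
  · exact absurd h (rank_lt_rank h').ne
  · exact absurd h (rank_lt_rank h').ne'

theorem rank_lt (f : Fin n → ℝ) (i : Fin n) : rank f i < n := by
  classical
  have : rank f i < (univ : Finset (Fin n)).card := by
    unfold rank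
    apply card_lt_card
    refine (Finset.ssubset_iff_of_subset (filter_subset _ _)).2 ⟨i, mem_univ _, ?_⟩
    simpa using Precedes.irrefl f i
  simpa using this

/-- Breaking ties by index makes the ranks a bijection onto `0, …, n - 1`, so exactly `k` of them
are below `k`. -/
theorem card_top {k : ℕ} (hk : k ≤ n) (f : Fin n → ℝ) : (top k f).card = k := by
  classical
  let g : Fin n → Fin n := fun i => ⟨rank f i, rank_lt f i⟩
  have hg : Function.Bijective g := by
    refine Finite.injective_iff_bijective.1 fun i j h => rank_injective f ?_
    simpa [g] using h
  have : (top k f).card = (univ.filter fun i : Fin n => (i : ℕ) < k).card := by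
    refine card_bij (fun i _ => g i) (fun i hi => ?_) (fun i _ j _ h => hg.1 h) (fun j hj => ?_)
    · simpa [g, mem_top] using hi
    · obtain ⟨i, rfl⟩ := hg.2 j
      exact ⟨i, by simpa [g, mem_top] using hj, rfl⟩
  rw [this, Fin.card_filter_val_lt, min_eq_right hk]

theorem rank_mono {f g : Fin n → ℝ} {i : Fin n} (h : ∀ j, Precedes f j i → Precedes g j i) :
    rank f i ≤ rank g i := by
  classical
  unfold rank
  exact card_le_card fun j hj => by simpa using h j (by simpa using hj)

/-- Raising the score of one page lets only this page into the top. -/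
theorem mem_top_of_raise {k : ℕ} {f g : Fin n → ℝ} {r i : Fin n} (hr : f r ≤ g r)
    (hf : ∀ j, j ≠ r → g j = f j) (hi : i ≠ r) (h : i ∈ top k g) : i ∈ top k f := by
  rw [mem_top] at *
  refine lt_of_le_of_lt (rank_mono fun j hj => ?_) h
  unfold Precedes at *
  rw [hf i hi]
  rcases eq_or_ne j r with rfl | hj'
  · rcases hj with hj | ⟨hj, hj'⟩
    · left; linarith
    · rcases lt_or_ge (f i) (g j) with h1 | h1
      · left; exact h1
      · right; exact ⟨by linarith, hj'⟩
  · rw [hf j hj']; exact hj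

/-- Counterpart of `mem_top_of_raise` for the raised page itself: its set of predecessors can only
shrink. -/
theorem mem_top_raised {k : ℕ} {f g : Fin n → ℝ} {r : Fin n} (hr : f r ≤ g r)
    (hf : ∀ j, j ≠ r → g j = f j) (h : r ∈ top k f) : r ∈ top k g := by
  rw [mem_top] at *
  refine lt_of_le_of_lt (rank_mono fun j hj => ?_) h
  unfold Precedes at *
  rcases eq_or_ne j r with rfl | hj'
  · simp at hj
  · rw [hf j hj'] at hj
    rcases hj with hj | ⟨hj, hj'⟩
    · left; linarith
    · rcases lt_or_ge (f r) (f j) with h1 | h1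
      · left; exact h1
      · right; exact ⟨by linarith, hj'⟩

theorem score_le_of_mem_top {k : ℕ} {f : Fin n → ℝ} {i j : Fin n} (hi : i ∈ top k f)
    (hj : j ∉ top k f) : f j ≤ f i := by
  rw [mem_top] at hi hj
  have : Precedes f i j := precedes_iff_rank_lt.2 (by omega)
  rcases this with h | ⟨h, _⟩
  · exact h.le
  · exact not_lt.1 h

/-- Exchange argument: the two set differences have equal size, and no score outside the top exceeds
one inside it. -/
theorem sum_le_sum_top {k : ℕ} (hk : k ≤ n) (f : Fin n → ℝ) {C : Finset (Fin n)}
    (hC : C.card = k) : ∑ i ∈ C, f i ≤ ∑ i ∈ top k f, f i := by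
  have hcard : (C \ top k f).card = (top k f \ C).card := by
    have h1 := card_sdiff_add_card_inter C (top k f)
    have h2 := card_sdiff_add_card_inter (top k f) C
    rw [inter_comm] at h2
    have := card_top hk f
    omega
  rw [← sum_inter_add_sum_sdiff C (top k f), ← sum_inter_add_sum_sdiff (top k f) C,
    inter_comm (top k f) C]
  gcongr _ + ?_
  rcases (C \ top k f).eq_empty_or_nonempty with h0 | ⟨j, hj⟩
  · have : top k f \ C = ∅ := by rw [← card_eq_zero, ← hcard, h0, card_empty]
    rw [h0, this]
  · obtain ⟨a, ha, hmax⟩ := exists_max_image (C \ top k f) f ⟨j, hj⟩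
    calc ∑ i ∈ C \ top k f, f i ≤ (C \ top k f).card • f a := sum_le_card_nsmul _ _ _ hmax
      _ = (top k f \ C).card • f a := by rw [hcard]
      _ ≤ ∑ i ∈ top k f \ C, f i := card_nsmul_le_sum _ _ _ fun i hi =>
          score_le_of_mem_top (mem_sdiff.1 hi).1 (mem_sdiff.1 ha).2

end Top

/-! ### Costs of caches -/

section Costs

variable {n : ℕ}

theorem missLoss_nonneg (i : Fin n) (C : Finset (Fin n)) : 0 ≤ missLoss i C := by
  unfold missLoss; split_ifs <;> norm_num

theorem moveCost_nonneg (C D : Finset (Fin n)) : 0 ≤ moveCost C D := by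
  unfold moveCost; positivity

theorem moveCost_le_card (C D : Finset (Fin n)) : moveCost C D ≤ C.card := by
  unfold moveCost
  exact_mod_cast card_le_card sdiff_subset

/-- Cost of one round in which the cache is changed from `D` to `C`. -/
def roundCost (i : Fin n) (C D : Finset (Fin n)) : ℝ :=
  missLoss i C + moveCost C D

theorem roundCost_nonneg (i : Fin n) (C D : Finset (Fin n)) : 0 ≤ roundCost i C D :=
  add_nonneg (missLoss_nonneg _ _) (moveCost_nonneg _ _)

theorem roundCost_le (i : Fin n) (C D : Finset (Fin n)) : roundCost i C D ≤ C.card + 2 := by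
  have := moveCost_le_card C D
  unfold roundCost missLoss
  split_ifs <;> linarith

theorem intervalCost_le_sum_roundCost (r : ℕ → Fin n) (A : ℕ → Finset (Fin n)) (a b : ℕ) :
    intervalCost r A a b ≤ ∑ t ∈ Icc a b, roundCost (r t) (A t) (A (t - 1)) := by
  unfold intervalCost roundCost
  rw [sum_add_distrib]
  gcongr ?_ + ?_
  · exact le_rfl
  · exact sum_le_sum_of_subset_of_nonneg (Icc_subset_Icc_left (Nat.le_succ a))
      fun _ _ _ => moveCost_nonneg _ _

theorem moveCost_le_one {r : Fin n} {C D : Finset (Fin n)} (h : ∀ i ∈ C, i ≠ r → i ∈ D) :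
    moveCost C D ≤ if r ∈ D then 0 else 1 := by
  unfold moveCost
  have hs : C \ D ⊆ if r ∈ D then ∅ else {r} := by
    intro i hi
    rw [mem_sdiff] at hi
    have hir : i = r := by
      by_contra hne
      exact hi.2 (h i hi.1 hne)
    subst hir
    simp [hi.2]
  have := card_le_card hs
  split_ifs at * with h1
  · simpa using this
  · have h2 : (C \ D).card ≤ 1 := by simpa using this
    exact_mod_cast h2

theorem mem_of_swap {r : Fin n} {C D : Finset (Fin n)} (h : ∀ i ∈ C, i ≠ r → i ∈ D)
    (hc : C.card = D.card) (hr : r ∈ D) : r ∈ C := by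
  have hs : C ⊆ D := fun i hi => by
    rcases eq_or_ne i r with rfl | hne
    · exact hr
    · exact h i hi hne
  rwa [eq_of_subset_of_card_le hs hc.ge]

/-- If `r` enters, one fetch is paid and there is no miss. If `r` stays outside, the cache cannot
have changed and only the miss costs `2`. -/
theorem roundCost_swap {r : Fin n} {C D : Finset (Fin n)} (h : ∀ i ∈ C, i ≠ r → i ∈ D)
    (hc : C.card = D.card) : roundCost r C D ≤ if r ∈ D then 0 else 2 := by
  have h1 := moveCost_le_one h
  unfold roundCost missLoss
  by_cases hr : r ∈ D
  · have := mem_of_swap h hc hr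
    simp only [hr, if_true, this] at *
    linarith
  · by_cases hrC : r ∈ C
    · simp only [hr, hrC, if_true, if_false] at *
      linarith
    · have hs : C ⊆ D := fun i hi => h i hi fun e => hrC (e ▸ hi)
      have : moveCost C D = 0 := by simp [moveCost, sdiff_eq_empty_iff_subset.2 hs]
      simp [hr, hrC, this]

theorem intervalCost_eq_zero_of_univ {r : ℕ → Fin n} {A : ℕ → Finset (Fin n)} {a b : ℕ}
    (h : ∀ t ∈ Icc a b, A t = univ) : intervalCost r A a b = 0 := by
  unfold intervalCost
  rw [sum_eq_zero, sum_eq_zero, add_zero]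
  · intro t ht
    rw [mem_Icc] at ht
    rw [h (t - 1) (mem_Icc.2 (by omega))]
    simp [moveCost]
  · intro t ht
    rw [h t ht]
    simp [missLoss]

end Costs

/-! ### Combining two algorithms -/

section Combine

/-- Gain of the second algorithm over the first, after deduction of a charge `κ G` for moving. -/
def gain (p q G : ℕ → ℝ) (κ : ℝ) (t : ℕ) : ℝ :=
  p t - q t - κ * G t

/-- The update of the probability with which the second algorithm is followed. -/
noncomputable def weightStep (γ ε x g : ℝ) : ℝ :=
  if x / (1 - γ * g) < ε then ε else if 1 < x / (1 - γ * g) then 1 else x / (1 - γ * g)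

/-- The probability with which the second algorithm is followed. -/
noncomputable def weight (p q G : ℕ → ℝ) (γ κ ε : ℝ) : ℕ → ℝ
  | 0 => ε
  -- The gain of round `t + 1` already determines the weight used in round `t + 1`; this is
  -- legitimate because the request is shown before the cache is chosen.
  | t + 1 => weightStep γ ε (weight p q G γ κ ε t) (gain p q G κ (t + 1))

/-- The cost charged to the combined algorithm. -/
noncomputable def combinedCost (p q G : ℕ → ℝ) (γ κ ε : ℝ) (t : ℕ) : ℝ :=
  p t - weight p q G γ κ ε t * gain p q G κ t

variable {p q G : ℕ → ℝ} {γ κ ε : ℝ}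

theorem weightStep_mem {x g : ℝ} (hε : ε ≤ 1) :
    ε ≤ weightStep γ ε x g ∧ weightStep γ ε x g ≤ 1 := by
  unfold weightStep
  split_ifs with h1 h2
  · exact ⟨le_rfl, hε⟩
  · exact ⟨hε, le_rfl⟩
  · exact ⟨not_lt.1 h1, not_lt.1 h2⟩

theorem weight_mem (hε : ε ≤ 1) (t : ℕ) :
    ε ≤ weight p q G γ κ ε t ∧ weight p q G γ κ ε t ≤ 1 := by
  cases t with
  | zero => exact ⟨le_rfl, hε⟩
  | succ t => exact weightStep_mem hε

/-- The clipped update is an unclipped one for a gain that is nearer to zero. -/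
theorem exists_effective_gain {x g H : ℝ} (hγ : 0 < γ) (hε : 0 < ε) (hx : ε ≤ x) (hx1 : x ≤ 1)
    (hg : |g| ≤ H) (hH : γ * H ≤ 1 / 2) :
    ∃ g', weightStep γ ε x g - x = γ * weightStep γ ε x g * g' ∧ γ * g' < 1 ∧ |g'| ≤ H ∧
      (1 - weightStep γ ε x g) * g ≤ (1 - weightStep γ ε x g) * g' ∧
      weightStep γ ε x g * g' - ε * H ≤ weightStep γ ε x g * g := by
  obtain ⟨hg1, hg2⟩ := abs_le.1 hg
  have hx0 : 0 < x := hε.trans_le hx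
  have hgH : γ * g ≤ γ * H := by gcongr
  have hH0 : 0 ≤ H := (abs_nonneg g).trans hg
  have hden : 0 < 1 - γ * g := by linarith
  unfold weightStep
  split_ifs with h1 h2
  -- Clipped from below: the effective gain lies in `[g, 0]`, and replacing `g` by it at weight `ε`
  -- changes the product by at most `ε * H`.
  · rw [div_lt_iff₀ hden] at h1
    have hgn : g ≤ 0 := by
      by_contra hc
      have := mul_pos hγ (not_le.1 hc)
      nlinarith
    refine ⟨(ε - x) / (γ * ε), by field_simp, ?_, ?_, ?_, ?_⟩
    · have : γ * ((ε - x) / (γ * ε)) = (ε - x) / ε := by field_simp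
      rw [this, div_lt_one hε]; linarith
    · have e1 : g ≤ (ε - x) / (γ * ε) := by
        rw [le_div_iff₀ (by positivity)]; nlinarith
      have e2 : (ε - x) / (γ * ε) ≤ 0 := div_nonpos_of_nonpos_of_nonneg (by linarith) (by positivity)
      rw [abs_le]; constructor <;> linarith
    · have e1 : g ≤ (ε - x) / (γ * ε) := by
        rw [le_div_iff₀ (by positivity)]; nlinarith
      exact mul_le_mul_of_nonneg_left e1 (by linarith)
    · have e2 : (ε - x) / (γ * ε) ≤ 0 := div_nonpos_of_nonpos_of_nonneg (by linarith) (by positivity)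
      nlinarith
  -- Clipped from above: the new weight is `1`, so the inequality with factor `1 - x'` is trivial,
  -- and the effective gain lies in `[0, g]`.
  · rw [lt_div_iff₀ hden] at h2
    have e1 : (1 - x) / γ ≤ g := by
      rw [div_le_iff₀ hγ]; nlinarith
    have e2 : 0 ≤ (1 - x) / γ := div_nonneg (by linarith) hγ.le
    refine ⟨(1 - x) / γ, by field_simp, ?_, ?_, by simp, ?_⟩
    · rw [mul_div_cancel₀ _ hγ.ne']; linarith
    · rw [abs_le]; constructor <;> linarith
    · have := mul_nonneg hε.le hH0
      linarith
  · refine ⟨g, by field_simp; ring, by linarith, hg, le_rfl, ?_⟩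
    have := mul_nonneg hε.le hH0
    linarith

/-- The potential for comparison with the second algorithm has derivative `1 / x - 1 ≥ 0` on `(0,
1]`. -/
theorem log_sub_self_mono {a b : ℝ} (ha : 0 < a) (hab : a ≤ b) (hb : b ≤ 1) :
    Real.log a - a ≤ Real.log b - b := by
  have hb0 : 0 < b := ha.trans_le hab
  have h := Real.log_le_sub_one_of_pos (div_pos ha hb0)
  rw [Real.log_div ha.ne' hb0.ne'] at h
  have : a / b - 1 ≤ a - b := by
    rw [div_sub_one hb0.ne', div_le_iff₀ hb0]; nlinarith
  linarith

section Step

variable {t : ℕ}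

/-- The bound is proportional to the new weight, so the moving cost it causes can be charged to the
rounds in which the second algorithm is followed. -/
theorem abs_weight_sub_le
    (hγ : 0 < γ) (hε : 0 < ε) (hε1 : ε ≤ 1)
    (hg : |gain p q G κ (t + 1)| ≤ G (t + 1)) (hG : γ * G (t + 1) ≤ 1 / 2) :
    |weight p q G γ κ ε (t + 1) - weight p q G γ κ ε t| ≤
      γ * weight p q G γ κ ε (t + 1) * G (t + 1) := by
  obtain ⟨h1, h2⟩ := weight_mem (p := p) (q := q) (G := G) (γ := γ) (κ := κ) hε1 t
  obtain ⟨g', e1, -, e3, -⟩ := exists_effective_gain hγ hε h1 h2 hg hG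
  obtain ⟨h3, -⟩ := weight_mem (p := p) (q := q) (G := G) (γ := γ) (κ := κ) hε1 (t + 1)
  have e1' : weight p q G γ κ ε (t + 1) - weight p q G γ κ ε t =
    γ * weight p q G γ κ ε (t + 1) * g' := e1
  rw [e1', abs_mul, abs_of_nonneg (mul_nonneg hγ.le (hε.le.trans h3))]
  exact mul_le_mul_of_nonneg_left e3 (mul_nonneg hγ.le (hε.le.trans h3))

/-- The weight divided by `γ` is the potential: `x' * g' = (x' - x) / γ` exactly, and clipping costs
at most `ε * G`. -/
theorem combinedCost_le_first
    (hγ : 0 < γ) (hε : 0 < ε) (hε1 : ε ≤ 1)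
    (hg : |gain p q G κ (t + 1)| ≤ G (t + 1)) (hG : γ * G (t + 1) ≤ 1 / 2) :
    combinedCost p q G γ κ ε (t + 1) ≤ p (t + 1) -
      (weight p q G γ κ ε (t + 1) - weight p q G γ κ ε t) / γ + ε * G (t + 1) := by
  obtain ⟨h1, h2⟩ := weight_mem (p := p) (q := q) (G := G) (γ := γ) (κ := κ) hε1 t
  obtain ⟨g', e1, -, -, -, e5⟩ := exists_effective_gain hγ hε h1 h2 hg hG
  unfold combinedCost
  change _ - weightStep γ ε _ _ * _ ≤ _ - (weightStep γ ε _ _ - _) / γ + _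
  rw [e1]
  have : γ * weightStep γ ε (weight p q G γ κ ε t) (gain p q G κ (t + 1)) * g' / γ =
    weightStep γ ε (weight p q G γ κ ε t) (gain p q G κ (t + 1)) * g' := by field_simp
  rw [this]
  linarith

/-- The excess over the second algorithm is `(1 - x') * g ≤ g' - x' * g'`. Here `γ * g' = 1 - x / x'
≤ log (x' / x)` and `γ * x' * g' = x' - x`, so the excess is at most the increase of `(log x - x) /
γ`. -/
theorem combinedCost_le_second
    (hγ : 0 < γ) (hε : 0 < ε) (hε1 : ε ≤ 1)
    (hg : |gain p q G κ (t + 1)| ≤ G (t + 1)) (hG : γ * G (t + 1) ≤ 1 / 2) :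
    combinedCost p q G γ κ ε (t + 1) ≤ q (t + 1) + κ * G (t + 1) +
      ((Real.log (weight p q G γ κ ε (t + 1)) - weight p q G γ κ ε (t + 1)) -
        (Real.log (weight p q G γ κ ε t) - weight p q G γ κ ε t)) / γ := by
  obtain ⟨h1, h2⟩ := weight_mem (p := p) (q := q) (G := G) (γ := γ) (κ := κ) hε1 t
  obtain ⟨h3, -⟩ := weight_mem (p := p) (q := q) (G := G) (γ := γ) (κ := κ) hε1 (t + 1)
  obtain ⟨g', e1, e2, -, e4, -⟩ := exists_effective_gain hγ hε h1 h2 hg hG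
  have hx0 : 0 < weight p q G γ κ ε t := hε.trans_le h1
  have hy0 : 0 < weight p q G γ κ ε (t + 1) := hε.trans_le h3
  have e1' : weight p q G γ κ ε (t + 1) - weight p q G γ κ ε t =
    γ * weight p q G γ κ ε (t + 1) * g' := e1
  have e4' : (1 - weight p q G γ κ ε (t + 1)) * gain p q G κ (t + 1) ≤
    (1 - weight p q G γ κ ε (t + 1)) * g' := e4
  have hlog := Real.log_le_sub_one_of_pos (div_pos hx0 hy0)
  rw [Real.log_div hx0.ne' hy0.ne'] at hlog
  have hdiv : weight p q G γ κ ε t / weight p q G γ κ ε (t + 1) = 1 - γ * g' := by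
    rw [div_eq_iff hy0.ne']; linarith
  rw [hdiv] at hlog
  have key : (1 - weight p q G γ κ ε (t + 1)) * g' ≤
      ((Real.log (weight p q G γ κ ε (t + 1)) - weight p q G γ κ ε (t + 1)) -
        (Real.log (weight p q G γ κ ε t) - weight p q G γ κ ε t)) / γ := by
    rw [le_div_iff₀ hγ]; nlinarith
  have hgain : p (t + 1) = gain p q G κ (t + 1) + q (t + 1) + κ * G (t + 1) := by
    unfold gain; ring
  unfold combinedCost
  linarith

end Step

section Sum

variable {a b : ℕ}

/-- Keeping the starting weight in the bound matters: it is `ε` at time `0` and may be as large as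
`1` later. -/
theorem sum_combinedCost_le_first (hγ : 0 < γ) (hε : 0 < ε) (hε1 : ε ≤ 1)
    (hg : ∀ t ∈ Ioc a b, |gain p q G κ t| ≤ G t) (hG : ∀ t ∈ Ioc a b, γ * G t ≤ 1 / 2)
    (hab : a ≤ b) :
    ∑ t ∈ Ioc a b, combinedCost p q G γ κ ε t ≤
      ∑ t ∈ Ioc a b, p t + weight p q G γ κ ε a / γ + ε * ∑ t ∈ Ioc a b, G t := by
  suffices h : ∑ t ∈ Ioc a b, combinedCost p q G γ κ ε t ≤
      ∑ t ∈ Ioc a b, p t - (weight p q G γ κ ε b - weight p q G γ κ ε a) / γ +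
        ε * ∑ t ∈ Ioc a b, G t by
    have h0 := hε.trans_le (weight_mem (p := p) (q := q) (G := G) (γ := γ) (κ := κ) hε1 b).1
    have := div_pos h0 hγ
    rw [sub_div] at h
    linarith
  induction b, hab using Nat.le_induction with
  | base => simp
  | succ b hab ih =>
    have ih := ih (fun t ht => hg t (Ioc_subset_Ioc_right (Nat.le_succ b) ht))
      (fun t ht => hG t (Ioc_subset_Ioc_right (Nat.le_succ b) ht))
    have hb : b + 1 ∈ Ioc a (b + 1) := mem_Ioc.2 ⟨by omega, le_rfl⟩
    have hs := combinedCost_le_first hγ hε hε1 (hg _ hb) (hG _ hb)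
    rw [sum_Ioc_succ_top hab, sum_Ioc_succ_top hab, sum_Ioc_succ_top hab]
    rw [sub_div] at *
    linarith

/-- On `[ε, 1]` the potential `log x - x` varies by at most `log (1 / ε)`, so the bound does not
depend on where the interval starts. -/
theorem sum_combinedCost_le_second (hγ : 0 < γ) (hε : 0 < ε) (hε1 : ε ≤ 1)
    (hg : ∀ t ∈ Ioc a b, |gain p q G κ t| ≤ G t) (hG : ∀ t ∈ Ioc a b, γ * G t ≤ 1 / 2)
    (hab : a ≤ b) :
    ∑ t ∈ Ioc a b, combinedCost p q G γ κ ε t ≤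
      ∑ t ∈ Ioc a b, q t + κ * ∑ t ∈ Ioc a b, G t + Real.log (1 / ε) / γ := by
  suffices h : ∑ t ∈ Ioc a b, combinedCost p q G γ κ ε t ≤
      ∑ t ∈ Ioc a b, q t + κ * ∑ t ∈ Ioc a b, G t +
        ((Real.log (weight p q G γ κ ε b) - weight p q G γ κ ε b) -
          (Real.log (weight p q G γ κ ε a) - weight p q G γ κ ε a)) / γ by
    obtain ⟨h1, h2⟩ := weight_mem (p := p) (q := q) (G := G) (γ := γ) (κ := κ) hε1 a
    obtain ⟨h3, h4⟩ := weight_mem (p := p) (q := q) (G := G) (γ := γ) (κ := κ) hε1 b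
    have e1 := log_sub_self_mono hε h1 h2
    have e2 := log_sub_self_mono (hε.trans_le h3) h4 le_rfl
    rw [Real.log_one] at e2
    have : ((Real.log (weight p q G γ κ ε b) - weight p q G γ κ ε b) -
          (Real.log (weight p q G γ κ ε a) - weight p q G γ κ ε a)) / γ ≤ Real.log (1 / ε) / γ := by
      rw [one_div, Real.log_inv]
      gcongr
      linarith
    linarith
  induction b, hab using Nat.le_induction with
  | base => simp
  | succ b hab ih =>
    have ih := ih (fun t ht => hg t (Ioc_subset_Ioc_right (Nat.le_succ b) ht))
      (fun t ht => hG t (Ioc_subset_Ioc_right (Nat.le_succ b) ht))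
    have hb : b + 1 ∈ Ioc a (b + 1) := mem_Ioc.2 ⟨by omega, le_rfl⟩
    have hs := combinedCost_le_second hγ hε hε1 (hg _ hb) (hG _ hb)
    rw [sum_Ioc_succ_top hab, sum_Ioc_succ_top hab, sum_Ioc_succ_top hab]
    rw [sub_div] at *
    linarith

end Sum

end Combine

end Paging

namespace Paging

open Finset

/-! ### The algorithm as a mathematical object

Row `0` is the marking algorithm with fixed random priorities.  Row `m`, for `1 ≤ m ≤ l`, follows
the perturbed leader with noise of size `2 ^ (l - m)`, restarted every `l * 4 ^ (l - m)` rounds. -/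

section Model

variable {n : ℕ}

/-- Scores from integer counts and from noise of size `h`. -/
def score (c : Fin n → ℕ) (h : ℕ) (u : Fin n → ℝ) (i : Fin n) : ℝ :=
  c i + h * u i

/-- Page classes of the marking algorithm: `4` for marked pages, `2` for unmarked pages that were
marked in the previous phase. -/
def markStep (k : ℕ) (i : Fin n) (c : Fin n → ℕ) : Fin n → ℕ :=
  if c i = 4 then c
  else if (univ.filter fun j => c j = 4).card < k then Function.update c i 4
  -- A new phase: truncated subtraction turns `4` into `2` and sends `2` and `0` to `0`, so only the
  -- marks of the phase just ended are remembered.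
  else Function.update (fun j => c j - 2) i 4

/-- Page classes after `t` rounds. -/
def markClass (k : ℕ) (r : ℕ → Fin n) : ℕ → Fin n → ℕ
  | 0 => fun _ => 0
  | t + 1 => markStep k (r (t + 1)) (markClass k r t)

/-- Numbers of requests since the start of the block of length `len`. -/
def counts (len : ℕ) (r : ℕ → Fin n) : ℕ → Fin n → ℕ
  | 0 => fun _ => 0
  -- Round `t + 1` opens a block; its own request is not counted.
  | t + 1 => if t % len = 0 then fun _ => 0
      else Function.update (counts len r t) (r (t + 1)) (counts len r t (r (t + 1)) + 1)

/-- Length of the blocks of row `m`. -/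
def blockLength (l m : ℕ) : ℕ := l * 4 ^ (l - m)

/-- Noise size of row `m`. -/
def rowScale (l m : ℕ) : ℕ := if m = 0 then 1 else 2 ^ (l - m)

/-- Counts of row `m`. -/
def rowCounts (k l : ℕ) (r : ℕ → Fin n) (m : ℕ) : ℕ → Fin n → ℕ :=
  if m = 0 then markClass k r else counts (blockLength l m) r

/-- The cache of row `m` after round `t`. -/
noncomputable def rowCache (k l : ℕ) (r : ℕ → Fin n) (u : Fin n → ℝ) (m t : ℕ) :
    Finset (Fin n) :=
  top k (score (rowCounts k l r m t) (rowScale l m) u)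

open Classical in
/-- The cost charged to row `m` in round `t`. -/
noncomputable def rowCost (k l : ℕ) (r : ℕ → Fin n) (u : Fin n → ℝ) (m t : ℕ) : ℝ :=
  if m ≠ 0 ∧ (t - 1) % blockLength l m = 0 then k + 2
  -- The cost depends on the cache before the round only. Row `0` pays `1` for a fault because the
  -- requested page always enters its cache; the other rows may leave it out and pay `2`.
  else if r t ∈ rowCache k l r u m (t - 1) then 0 else if m = 0 then 1 else 2

/-- A bound for the costs in round `t` of the rows up to `m`. -/
def costBound (k l m t : ℕ) : ℝ :=
  if m ≠ 0 ∧ (t - 1) % blockLength l m = 0 then 5 * k else 3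

/-- The learning rate of row `m`. -/
noncomputable def rate (k l m : ℕ) : ℝ := 1 / (10 * k * rowScale l m)

/-- The moving charge of row `m`. -/
noncomputable def moveRate (l m : ℕ) : ℝ := 1 / (10 * rowScale l m)

/-- The least weight of a row. -/
noncomputable def minWeight (l : ℕ) : ℝ := 1 / (2 ^ l * 2 ^ l)

/-- The cost charged to the combination of the rows `0, …, m`. -/
noncomputable def levelCost (k l : ℕ) (r : ℕ → Fin n) (u : Fin n → ℝ) : ℕ → ℕ → ℝ
  | 0 => rowCost k l r u 0
  | m + 1 => combinedCost (levelCost k l r u m) (rowCost k l r u (m + 1))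
      (costBound k l (m + 1)) (rate k l (m + 1)) (moveRate l (m + 1)) (minWeight l)

/-- The probability with which row `m` is preferred to the rows below it. -/
noncomputable def rowWeight (k l : ℕ) (r : ℕ → Fin n) (u : Fin n → ℝ) (m : ℕ) : ℕ → ℝ :=
  weight (levelCost k l r u (m - 1)) (rowCost k l r u m)
      (costBound k l m) (rate k l m) (moveRate l m) (minWeight l)

/-- The noise given by the first samples. -/
def noise (n : ℕ) (ω : Coins) (i : Fin n) : ℝ := ω i

open Classical in
/-- The row that is selected among the rows `0, …, m`. -/
noncomputable def selected (k l : ℕ) (r : ℕ → Fin n) (ω : Coins) : ℕ → ℕ → ℕ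
  | 0, _ => 0
  | m + 1, t => if (ω (n + (m + 1)) : ℝ) < rowWeight k l r (noise n ω) (m + 1) t then m + 1
      else selected k l r ω m t

/-- The cache of the combination of the rows `0, …, m`. -/
noncomputable def levelCache (k l : ℕ) (r : ℕ → Fin n) (ω : Coins) (m t : ℕ) : Finset (Fin n) :=
  rowCache k l r (noise n ω) (selected k l r ω m t) t

variable {k l : ℕ} {r : ℕ → Fin n} {u : Fin n → ℝ}

theorem rowScale_pos (l m : ℕ) : 0 < rowScale l m := by
  unfold rowScale; split_ifs <;> positivity

theorem one_le_rowScale (l m : ℕ) : (1 : ℝ) ≤ rowScale l m := by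
  exact_mod_cast rowScale_pos l m

theorem minWeight_pos (l : ℕ) : 0 < minWeight l := by unfold minWeight; positivity

theorem minWeight_le_one (l : ℕ) : minWeight l ≤ 1 := by
  unfold minWeight
  rw [div_le_one (by positivity)]
  have : (1 : ℝ) ≤ 2 ^ l := one_le_pow₀ (by norm_num)
  nlinarith

theorem rate_pos (hk : 1 ≤ k) (m : ℕ) : 0 < rate k l m := by
  have := one_le_rowScale l m
  have : (1 : ℝ) ≤ k := by exact_mod_cast hk
  unfold rate; positivity

theorem moveRate_eq (hk : 1 ≤ k) (m : ℕ) : moveRate l m = k * rate k l m := by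
  have := one_le_rowScale l m
  have : (1 : ℝ) ≤ k := by exact_mod_cast hk
  unfold rate moveRate; field_simp

theorem moveRate_nonneg (m : ℕ) : 0 ≤ moveRate l m := by unfold moveRate; positivity

theorem moveRate_le (m : ℕ) : moveRate l m ≤ 1 / 10 := by
  have := one_le_rowScale l m
  unfold moveRate
  gcongr
  linarith

theorem rate_le (hk : 1 ≤ k) (m : ℕ) : k * rate k l m ≤ 1 / 10 := by
  rw [← moveRate_eq hk]; exact moveRate_le m

theorem costBound_nonneg (m t : ℕ) : 0 ≤ costBound k l m t := by
  unfold costBound; split_ifs <;> positivity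

theorem costBound_le (hk : 1 ≤ k) (m t : ℕ) : costBound k l m t ≤ 5 * k := by
  have : (1 : ℝ) ≤ k := by exact_mod_cast hk
  unfold costBound; split_ifs <;> linarith

theorem three_le_costBound (hk : 1 ≤ k) (m t : ℕ) : 3 ≤ costBound k l m t := by
  have : (1 : ℝ) ≤ k := by exact_mod_cast hk
  unfold costBound; split_ifs <;> linarith

theorem rate_mul_costBound_le (hk : 1 ≤ k) (m t : ℕ) : rate k l m * costBound k l m t ≤ 1 / 2 := by
  have := mul_le_mul_of_nonneg_left (costBound_le (l := l) hk m t) (rate_pos (l := l) hk m).le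
  have := rate_le (l := l) hk m
  linarith

/-- Each block length divides the coarser ones, so a restart of row `m` is also a restart of row `m
+ 1`. -/
theorem costBound_mono (hk : 1 ≤ k) (m t : ℕ) :
    costBound k l m t ≤ costBound k l (m + 1) t := by
  by_cases h : m ≠ 0 ∧ (t - 1) % blockLength l m = 0
  · have h' : m + 1 ≠ 0 ∧ (t - 1) % blockLength l (m + 1) = 0 := by
      refine ⟨by omega, Nat.mod_eq_zero_of_dvd (dvd_trans ?_ (Nat.dvd_of_mod_eq_zero h.2))⟩
      exact mul_dvd_mul_left _ (pow_dvd_pow _ (by omega))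
    rw [costBound, costBound, if_pos h, if_pos h']
  · rw [costBound, if_neg h]
    exact three_le_costBound hk _ _

theorem rowCost_nonneg (m t : ℕ) : 0 ≤ rowCost k l r u m t := by
  unfold rowCost; split_ifs <;> positivity

theorem rowCost_zero_le (t : ℕ) : rowCost k l r u 0 t ≤ 1 := by
  unfold rowCost; split_ifs <;> simp_all

/-- Row costs use at most `9 / 10` of the bound (`k + 2 ≤ 3 * k` at restarts, `2` against `3`
otherwise), which leaves `1 / 10` for the moving charge. -/
theorem rowCost_add_le (hk : 1 ≤ k) (m t : ℕ) :
    rowCost k l r u m t + moveRate l m * costBound k l m t ≤ costBound k l m t := by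
  have hk' : (1 : ℝ) ≤ k := by exact_mod_cast hk
  have h1 := mul_le_mul_of_nonneg_right (moveRate_le (l := l) m) (costBound_nonneg (k := k) (l := l) m t)
  have h2 : rowCost k l r u m t ≤ 9 / 10 * costBound k l m t := by
    unfold rowCost costBound; split_ifs <;> linarith
  linarith

theorem levelCost_succ (m t : ℕ) :
    levelCost k l r u (m + 1) t = (1 - rowWeight k l r u (m + 1) t) * levelCost k l r u m t +
      rowWeight k l r u (m + 1) t *
        (rowCost k l r u (m + 1) t + moveRate l (m + 1) * costBound k l (m + 1) t) := by
  change _ - rowWeight k l r u (m + 1) t * (_ - _ - _) = _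
  ring

theorem rowWeight_mem (m t : ℕ) :
    minWeight l ≤ rowWeight k l r u m t ∧ rowWeight k l r u m t ≤ 1 :=
  weight_mem (minWeight_le_one l) t

theorem rowWeight_nonneg (m t : ℕ) : 0 ≤ rowWeight k l r u m t :=
  (minWeight_pos l).le.trans (rowWeight_mem m t).1

theorem levelCost_mem (hk : 1 ≤ k) (m t : ℕ) :
    0 ≤ levelCost k l r u m t ∧ levelCost k l r u m t ≤ costBound k l m t := by
  induction m with
  | zero =>
    refine ⟨rowCost_nonneg _ _, (rowCost_zero_le t).trans ?_⟩
    linarith [three_le_costBound (l := l) hk 0 t]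
  | succ m ih =>
    rw [levelCost_succ]
    have h0 := rowWeight_nonneg (k := k) (l := l) (r := r) (u := u) (m + 1) t
    obtain ⟨-, h1⟩ := rowWeight_mem (k := k) (l := l) (r := r) (u := u) (m + 1) t
    have h2 := rowCost_add_le (l := l) (r := r) (u := u) hk (m + 1) t
    have h3 := rowCost_nonneg (k := k) (l := l) (r := r) (u := u) (m + 1) t
    have h4 := mul_nonneg (moveRate_nonneg (l := l) (m + 1))
      (costBound_nonneg (k := k) (l := l) (m + 1) t)
    have h5 := costBound_mono (l := l) hk m t
    constructor
    · have := mul_nonneg (sub_nonneg.2 h1) ih.1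
      have := mul_nonneg h0 (add_nonneg h3 h4)
      linarith
    · have := mul_le_mul_of_nonneg_left (ih.2.trans h5) (sub_nonneg.2 h1)
      have := mul_le_mul_of_nonneg_left h2 h0
      linarith

theorem abs_gain_le (hk : 1 ≤ k) (m t : ℕ) :
    |gain (levelCost k l r u m) (rowCost k l r u (m + 1)) (costBound k l (m + 1))
      (moveRate l (m + 1)) t| ≤ costBound k l (m + 1) t := by
  obtain ⟨h0, h1⟩ := levelCost_mem (l := l) (r := r) (u := u) hk m t
  have h2 := rowCost_add_le (l := l) (r := r) (u := u) hk (m + 1) t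
  have h3 := rowCost_nonneg (k := k) (l := l) (r := r) (u := u) (m + 1) t
  have h4 := mul_nonneg (moveRate_nonneg (l := l) (m + 1))
    (costBound_nonneg (k := k) (l := l) (m + 1) t)
  have h5 := costBound_mono (l := l) hk m t
  unfold gain
  rw [abs_le]; constructor <;> linarith

/-- Switching costs at most `k` per unit of weight moved; `moveRate` is `k` times the learning rate
precisely so that the surcharge covers this. -/
theorem moveCost_charge (hk : 1 ≤ k) (m t : ℕ) :
    k * |rowWeight k l r u (m + 1) (t + 1) - rowWeight k l r u (m + 1) t| ≤
      rowWeight k l r u (m + 1) (t + 1) *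
        (moveRate l (m + 1) * costBound k l (m + 1) (t + 1)) := by
  have := abs_weight_sub_le (rate_pos (l := l) hk (m + 1)) (minWeight_pos l) (minWeight_le_one l)
    (abs_gain_le (l := l) (r := r) (u := u) hk m (t + 1)) (rate_mul_costBound_le hk (m + 1) (t + 1))
  rw [moveRate_eq hk]
  have hk' : (0 : ℝ) ≤ k := by positivity
  calc _ ≤ (k : ℝ) * _ := mul_le_mul_of_nonneg_left this hk'
    _ = _ := by change _ = weight _ _ _ _ _ _ _ * _; simp only [Nat.add_sub_cancel]; ring

theorem card_rowCache (hkn : k ≤ n) (m t : ℕ) : (rowCache k l r u m t).card = k :=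
  card_top hkn _

/-! ### One round of a row -/

theorem markStep_self (k : ℕ) (i : Fin n) (c : Fin n → ℕ) : markStep k i c i = 4 := by
  unfold markStep
  split_ifs with h
  · exact h
  · simp
  · simp

theorem markStep_cases (k : ℕ) (i : Fin n) (c : Fin n → ℕ) (hc : ∀ j, c j = 0 ∨ c j = 2 ∨ c j = 4)
    (j : Fin n) : markStep k i c j = 0 ∨ markStep k i c j = 2 ∨ markStep k i c j = 4 := by
  unfold markStep
  have := hc j
  split_ifs
  · exact this
  · rcases eq_or_ne j i with rfl | hj <;> simp [*]
  · rcases eq_or_ne j i with rfl | hj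
    · simp
    · simp only [Function.update_of_ne hj]; omega

theorem markClass_cases (k : ℕ) (r : ℕ → Fin n) (t : ℕ) (j : Fin n) :
    markClass k r t j = 0 ∨ markClass k r t j = 2 ∨ markClass k r t j = 4 := by
  induction t generalizing j with
  | zero => simp [markClass]
  | succ t ih => exact markStep_cases k _ _ ih j

theorem card_marked_le (hk : 1 ≤ k) (r : ℕ → Fin n) (t : ℕ) :
    (univ.filter fun j => markClass k r t j = 4).card ≤ k := by
  induction t with
  | zero => simp [markClass]
  | succ t ih =>
    change (univ.filter fun j => markStep k (r (t + 1)) (markClass k r t) j = 4).card ≤ k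
    unfold markStep
    split_ifs with h1 h2
    · exact ih
    · refine le_trans (card_le_card (t := insert (r (t + 1))
        (univ.filter fun j => markClass k r t j = 4)) fun j hj => ?_)
          ((card_insert_le _ _).trans h2)
      rcases eq_or_ne j (r (t + 1)) with rfl | hj'
      · simp
      · simpa [hj', Function.update_of_ne hj'] using hj
    · refine le_trans (card_le_card (t := {r (t + 1)}) fun j hj => ?_) (by simpa using hk)
      rcases eq_or_ne j (r (t + 1)) with rfl | hj'
      · simp
      · have := markClass_cases k r t j
        simp only [mem_filter, mem_univ, true_and, Function.update_of_ne hj'] at hj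
        omega

/-- Classes are two apart while the noise varies by at most one: the class decides and the noise
only orders pages within a class. -/
theorem score_lt_of_class {c : Fin n → ℕ} (hu : ∀ i, u i ∈ Set.Icc (0 : ℝ) 1) {i j : Fin n}
    (h : c i + 2 ≤ c j) : score c 1 u i < score c 1 u j := by
  have h1 := (hu i).2
  have h2 := (hu j).1
  have : (c i : ℝ) + 2 ≤ c j := by exact_mod_cast h
  unfold score
  push_cast
  linarith

/-- Pages of the highest classes are in the cache. -/
theorem mem_top_of_class {c : Fin n → ℕ} (hu : ∀ i, u i ∈ Set.Icc (0 : ℝ) 1)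
    (hc : ∀ j, c j = 0 ∨ c j = 2 ∨ c j = 4) {i : Fin n}
    (h : (univ.filter fun j => c i ≤ c j).card ≤ k) : i ∈ top k (score c 1 u) := by
  classical
  rw [mem_top]
  refine lt_of_lt_of_le (card_lt_card ?_) h
  refine (Finset.ssubset_iff_of_subset fun j hj => ?_).2 ⟨i, by simp, by
    simpa using Precedes.irrefl _ i⟩
  simp only [mem_filter, mem_univ, true_and] at hj ⊢
  by_contra hlt
  have hlt' : c j + 2 ≤ c i := by have := hc i; have := hc j; omega
  have := score_lt_of_class (u := u) hu hlt'
  unfold Precedes at hj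
  rcases hj with hj | ⟨hj, -⟩
  · exact lt_asymm this hj
  · exact hj this

theorem mem_rowCache_zero_of_marked (hk : 1 ≤ k) (hu : ∀ i, u i ∈ Set.Icc (0 : ℝ) 1) {t : ℕ}
    {i : Fin n} (h : markClass k r t i = 4) : i ∈ rowCache k l r u 0 t := by
  refine mem_top_of_class hu (markClass_cases k r t) ?_
  refine le_trans (card_le_card fun j hj => ?_) (card_marked_le hk r t)
  simp only [mem_filter, mem_univ, true_and] at hj ⊢
  have := markClass_cases k r t j
  omega

/-- Within a phase only the score of the requested page rises. When a phase ends, the new cache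
consists of the request and of pages marked until then, all of which were already cached. -/
theorem mem_rowCache_zero_succ (hk : 1 ≤ k) (hu : ∀ i, u i ∈ Set.Icc (0 : ℝ) 1)
    (t : ℕ) : ∀ i ∈ rowCache k l r u 0 (t + 1), i ≠ r (t + 1) → i ∈ rowCache k l r u 0 t := by
  intro i hi hir
  have hc := markClass_cases k r t
  have hcard := card_marked_le hk r t
  unfold rowCache at *
  simp only [rowCounts, if_true, rowScale] at hi ⊢
  change i ∈ top k (score (markStep k (r (t + 1)) (markClass k r t)) 1 u) at hi
  unfold markStep at hi
  split_ifs at hi with h1 h2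
  · exact hi
  · refine mem_top_of_raise (r := r (t + 1)) ?_ ?_ hir hi
    · have : (markClass k r t (r (t + 1)) : ℝ) ≤ 4 := by
        have := hc (r (t + 1))
        exact_mod_cast (by omega : markClass k r t (r (t + 1)) ≤ 4)
      simp only [score, Function.update_self]
      push_cast
      linarith
    · intro j hj
      simp [score, Function.update_of_ne hj]
  -- After the shift of classes, at least `k` formerly marked pages come before any page that was
  -- unmarked, so an unmarked page other than the request cannot enter.
  · have hm : markClass k r t i = 4 := by
      by_contra hne
      rw [mem_top] at hi
      refine absurd hi (not_lt.2 ?_)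
      classical
      refine (not_lt.1 h2).trans (card_le_card fun j hj => ?_)
      simp only [mem_filter, mem_univ, true_and] at hj ⊢
      left
      apply score_lt_of_class hu
      have hjr : j ≠ r (t + 1) := fun e => h1 (e ▸ hj)
      have := hc i
      rw [Function.update_of_ne hjr, Function.update_of_ne hir, hj]
      omega
    refine mem_top_of_class hu hc ?_
    refine le_trans (card_le_card fun j hj => ?_) hcard
    simp only [mem_filter, mem_univ, true_and] at hj ⊢
    have := hc j
    omega

theorem counts_succ_of_mod {len t : ℕ} (h : ¬ t % len = 0) :
    counts len r (t + 1) = Function.update (counts len r t) (r (t + 1))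
      (counts len r t (r (t + 1)) + 1) := by
  simp [counts, h]

theorem counts_succ_of_restart {len t : ℕ} (h : t % len = 0) :
    counts len r (t + 1) = fun _ => 0 := by
  simp [counts, h]

theorem score_counts_succ_self {len t h : ℕ} (ht : ¬ t % len = 0) :
    score (counts len r (t + 1)) h u (r (t + 1)) = score (counts len r t) h u (r (t + 1)) + 1 := by
  rw [counts_succ_of_mod ht]
  simp [score]; ring

theorem score_counts_succ_of_ne {len t h : ℕ} (ht : ¬ t % len = 0) {j : Fin n}
    (hj : j ≠ r (t + 1)) :
    score (counts len r (t + 1)) h u j = score (counts len r t) h u j := by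
  rw [counts_succ_of_mod ht]
  simp [score, Function.update_of_ne hj]

theorem mem_rowCache_succ {m t : ℕ} (hm : m ≠ 0) (ht : ¬ t % blockLength l m = 0) :
    ∀ i ∈ rowCache k l r u m (t + 1), i ≠ r (t + 1) → i ∈ rowCache k l r u m t := by
  intro i hi hir
  unfold rowCache at *
  simp only [rowCounts, hm, if_false] at hi ⊢
  exact mem_top_of_raise (by rw [score_counts_succ_self ht]; linarith)
    (fun j hj => score_counts_succ_of_ne ht hj) hir hi

theorem roundCost_rowCache_le (hk : 1 ≤ k) (hkn : k ≤ n) (hu : ∀ i, u i ∈ Set.Icc (0 : ℝ) 1)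
    (m t : ℕ) :
    roundCost (r (t + 1)) (rowCache k l r u m (t + 1)) (rowCache k l r u m t) ≤
      rowCost k l r u m (t + 1) := by
  unfold rowCost
  rw [Nat.add_sub_cancel]
  have hcard : (rowCache k l r u m (t + 1)).card = (rowCache k l r u m t).card := by
    rw [card_rowCache hkn, card_rowCache hkn]
  rcases eq_or_ne m 0 with rfl | hm
  · have h1 := moveCost_le_one (mem_rowCache_zero_succ (l := l) (r := r) hk hu t)
    have h2 : r (t + 1) ∈ rowCache k l r u 0 (t + 1) :=
      mem_rowCache_zero_of_marked hk hu (markStep_self _ _ _)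
    simpa [roundCost, missLoss, h2] using h1
  · by_cases h : t % blockLength l m = 0
    · have := roundCost_le (r (t + 1)) (rowCache k l r u m (t + 1)) (rowCache k l r u m t)
      rw [card_rowCache hkn] at this
      simpa [hm, h] using this
    · have := roundCost_swap (mem_rowCache_succ (k := k) (u := u) hm h) hcard
      simpa [hm, h] using this

end Model

end Paging

namespace Paging

open Finset MeasureTheory

/-! ### Integration over the samples -/

instance : IsProbabilityMeasure coinMeasure := by
  unfold coinMeasure; infer_instance

/-- Bounded measurable functions of the samples. -/
def Tame (f : Coins → ℝ) : Prop := Measurable f ∧ ∃ c, ∀ ω, |f ω| ≤ c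

theorem Tame.integrable {f : Coins → ℝ} (hf : Tame f) : Integrable f coinMeasure := by
  obtain ⟨c, hc⟩ := hf.2
  exact Integrable.of_bound hf.1.aestronglyMeasurable c (ae_of_all _ hc)

theorem Tame.const (c : ℝ) : Tame fun _ => c := ⟨measurable_const, |c|, fun _ => le_rfl⟩

theorem Tame.add {f g : Coins → ℝ} (hf : Tame f) (hg : Tame g) : Tame fun ω => f ω + g ω := by
  obtain ⟨c, hc⟩ := hf.2
  obtain ⟨d, hd⟩ := hg.2
  exact ⟨hf.1.add hg.1, c + d, fun ω => (abs_add_le _ _).trans (add_le_add (hc ω) (hd ω))⟩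

theorem Tame.mul {f g : Coins → ℝ} (hf : Tame f) (hg : Tame g) : Tame fun ω => f ω * g ω := by
  obtain ⟨c, hc⟩ := hf.2
  obtain ⟨d, hd⟩ := hg.2
  refine ⟨hf.1.mul hg.1, c * d, fun ω => ?_⟩
  rw [abs_mul]
  exact mul_le_mul (hc ω) (hd ω) (abs_nonneg _) ((abs_nonneg _).trans (hc ω))

theorem Tame.sum {ι : Type*} {s : Finset ι} {f : ι → Coins → ℝ} (hf : ∀ i ∈ s, Tame (f i)) :
    Tame fun ω => ∑ i ∈ s, f i ω := by
  classical
  induction s using Finset.induction_on with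
  | empty => simpa using Tame.const 0
  | insert a s ha ih =>
    simp only [sum_insert ha]
    exact (hf a (mem_insert_self _ _)).add (ih fun i hi => hf i (mem_insert_of_mem hi))

theorem Tame.of_mem_Icc {f : Coins → ℝ} {c : ℝ} (hf : Measurable f)
    (h : ∀ ω, 0 ≤ f ω ∧ f ω ≤ c) : Tame f :=
  ⟨hf, c, fun ω => by rw [abs_of_nonneg (h ω).1]; exact (h ω).2⟩

/-- Resampling one coordinate leaves the law unchanged. This allows integrating over one sample with
the others fixed without splitting the product space. -/
theorem measurePreserving_update (i : ℕ) :
    MeasurePreserving (fun p : Coins × unitInterval => Function.update p.1 i p.2)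
      (coinMeasure.prod volume) coinMeasure := by
  have hm : Measurable fun p : Coins × unitInterval => Function.update p.1 i p.2 := by
    rw [measurable_pi_iff]
    intro j
    rcases eq_or_ne j i with rfl | hj
    · simpa using measurable_snd
    · simp only [Function.update_of_ne hj]
      exact (measurable_pi_apply j).comp measurable_fst
  refine ⟨hm, ?_⟩
  unfold coinMeasure
  refine Measure.eq_infinitePi _ fun s t ht => ?_
  rw [Measure.map_apply hm (MeasurableSet.pi s.countable_toSet fun j _ => ht j)]
  have hpre : (fun p : Coins × unitInterval => Function.update p.1 i p.2) ⁻¹' Set.pi s t =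
      (Set.pi (s.erase i : Finset ℕ) t) ×ˢ (if i ∈ s then t i else Set.univ) := by
    ext ⟨ω, v⟩
    simp only [Set.mem_preimage, Set.mem_pi, Finset.mem_coe, Set.mem_prod, Finset.mem_erase]
    constructor
    · intro h
      refine ⟨fun j hj => by simpa [Function.update_of_ne hj.1] using h j hj.2, ?_⟩
      split_ifs with hi
      · simpa using h i hi
      · trivial
    · rintro ⟨h1, h2⟩ j hj
      rcases eq_or_ne j i with rfl | hji
      · simpa [hj] using h2
      · simpa [Function.update_of_ne hji] using h1 j ⟨hji, hj⟩
  rw [hpre, Measure.prod_prod, Measure.infinitePi_pi _ (fun j _ => ht j)]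
  split_ifs with hi
  · exact Finset.prod_erase_mul s _ hi
  · rw [Finset.erase_eq_of_notMem hi]; simp

theorem integral_update {f : Coins → ℝ} (hf : Tame f) (i : ℕ) :
    ∫ ω, f ω ∂coinMeasure =
      ∫ ω, (∫ v : unitInterval, f (Function.update ω i v)) ∂coinMeasure := by
  have h := measurePreserving_update i
  conv_lhs => rw [← h.map_eq]
  rw [integral_map h.measurable.aemeasurable hf.1.aestronglyMeasurable]
  exact integral_prod _ (h.integrable_comp_of_integrable hf.integrable)

theorem integral_le_of_update {f g : Coins → ℝ} (hf : Tame f) (hg : Tame g) (i : ℕ)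
    (h : ∀ ω, ∫ v : unitInterval, f (Function.update ω i v) ≤ g ω) :
    ∫ ω, f ω ∂coinMeasure ≤ ∫ ω, g ω ∂coinMeasure := by
  rw [integral_update hf i]
  have hp := measurePreserving_update i
  exact integral_mono (hp.integrable_comp_of_integrable hf.integrable).integral_prod_left
    hg.integrable h

/-- The factors of the product are equal. Used for the exchangeability of the priorities in the
marking algorithm. -/
theorem measurePreserving_comp_perm (σ : Equiv.Perm ℕ) :
    MeasurePreserving (fun ω : Coins => fun i => ω (σ i)) coinMeasure coinMeasure := by
  have hm : Measurable fun ω : Coins => fun i => ω (σ i) :=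
    measurable_pi_iff.2 fun i => measurable_pi_apply _
  refine ⟨hm, ?_⟩
  unfold coinMeasure
  refine Measure.eq_infinitePi _ fun s t ht => ?_
  rw [Measure.map_apply hm (MeasurableSet.pi s.countable_toSet fun j _ => ht j)]
  have hpre : (fun ω : Coins => fun i => ω (σ i)) ⁻¹' Set.pi s t =
      Set.pi (s.map σ.toEmbedding : Finset ℕ) fun i => t (σ.symm i) := by
    ext ω
    simp only [Set.mem_preimage, Set.mem_pi, coe_map, Set.mem_image, mem_coe]
    constructor
    · rintro h _ ⟨j, hj, rfl⟩
      simpa using h j hj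
    · intro h j hj
      simpa using h (σ j) ⟨j, hj, rfl⟩
  rw [hpre, Measure.infinitePi_pi _ (fun j _ => ht _)]
  simp

theorem integral_comp_perm {f : Coins → ℝ} (hf : Tame f) (σ : Equiv.Perm ℕ) :
    ∫ ω, f (fun i => ω (σ i)) ∂coinMeasure = ∫ ω, f ω ∂coinMeasure := by
  have h := measurePreserving_comp_perm σ
  conv_rhs => rw [← h.map_eq]
  rw [integral_map h.measurable.aemeasurable hf.1.aestronglyMeasurable]

theorem integral_indicator_lt {x : ℝ} (h0 : 0 ≤ x) (h1 : x ≤ 1) :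
    ∫ v : unitInterval, (if (v : ℝ) < x then (1 : ℝ) else 0) = x := by
  have : (fun v : unitInterval => if (v : ℝ) < x then (1 : ℝ) else 0) =
      (Set.Iio (⟨x, h0, h1⟩ : unitInterval)).indicator 1 := by
    ext v
    simp only [Set.indicator, Set.mem_Iio, Pi.one_apply]
    congr 1
  rw [this, integral_indicator_one measurableSet_Iio, Measure.real, unitInterval.volume_Iio,
    ENNReal.toReal_ofReal h0]

/-- With all other samples fixed, the exceptional values of sample `i` form a single point. -/
theorem ae_ne {i j : ℕ} (hij : i ≠ j) : ∀ᵐ ω ∂coinMeasure, ω i ≠ ω j := by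
  classical
  have hms : MeasurableSet {ω : Coins | ω i = ω j} :=
    measurableSet_eq_fun (measurable_pi_apply i) (measurable_pi_apply j)
  have ht : Tame fun ω : Coins => if ω i = ω j then (1 : ℝ) else 0 :=
    Tame.of_mem_Icc (c := 1) (Measurable.ite hms measurable_const measurable_const)
      fun ω => by split_ifs <;> norm_num
  have h0 : ∫ ω, (if ω i = ω j then (1 : ℝ) else 0) ∂coinMeasure = 0 := by
    rw [integral_update ht i]
    refine integral_eq_zero_of_ae (ae_of_all _ fun ω => ?_)
    simp only [Function.update_self, Function.update_of_ne hij.symm]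
    refine integral_eq_zero_of_ae ?_
    have : ∀ᵐ v : unitInterval, v ≠ ω j := by
      simp [ae_iff]
    filter_upwards [this] with v hv
    simp [hv]
  rw [integral_eq_zero_iff_of_nonneg (fun ω => by simp only [Pi.zero_apply]; split_ifs <;> norm_num)
    ht.integrable] at h0
  filter_upwards [h0] with ω hω he
  simp [he] at hω

/-! ### Measurability of the algorithm -/

section Measurability

variable {n k l : ℕ} {r : ℕ → Fin n}

theorem measurable_noise (i : Fin n) : Measurable fun ω : Coins => noise n ω i :=
  measurable_subtype_coe.comp (measurable_pi_apply (i : ℕ))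

theorem measurable_rank {f : Coins → Fin n → ℝ} (hf : ∀ i, Measurable fun ω => f ω i) (i : Fin n) :
    Measurable fun ω => rank (f ω) i := by
  classical
  unfold rank
  simp only [card_filter]
  refine Finset.measurable_sum _ fun j _ => Measurable.ite ?_ measurable_const measurable_const
  unfold Precedes
  exact (measurableSet_lt (hf i) (hf j)).union
    ((measurableSet_lt (hf j) (hf i)).compl.inter (MeasurableSet.const _))

theorem measurableSet_mem_rowCache (i : Fin n) (m t : ℕ) :
    MeasurableSet {ω : Coins | i ∈ rowCache k l r (noise n ω) m t} := by
  unfold rowCache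
  simp only [mem_top]
  refine measurableSet_lt (measurable_rank (fun j => ?_) i) measurable_const
  unfold score
  exact measurable_const.add (measurable_const.mul (measurable_noise j))

theorem measurable_rowCost (m t : ℕ) :
    Measurable fun ω : Coins => rowCost k l r (noise n ω) m t := by
  unfold rowCost
  refine Measurable.ite (MeasurableSet.const _) measurable_const ?_
  exact Measurable.ite (measurableSet_mem_rowCache _ _ _) measurable_const measurable_const

theorem measurable_weight {p q : Coins → ℕ → ℝ} {G : ℕ → ℝ} {γ κ ε : ℝ}
    (hp : ∀ t, Measurable fun ω => p ω t) (hq : ∀ t, Measurable fun ω => q ω t) (t : ℕ) :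
    Measurable fun ω => weight (p ω) (q ω) G γ κ ε t := by
  induction t with
  | zero => exact measurable_const
  | succ t ih =>
    have hd : Measurable fun ω => weight (p ω) (q ω) G γ κ ε t /
        (1 - γ * gain (p ω) (q ω) G κ (t + 1)) := by
      unfold gain
      exact ih.div (measurable_const.sub (measurable_const.mul
        (((hp _).sub (hq _)).sub measurable_const)))
    change Measurable fun ω => weightStep γ ε (weight (p ω) (q ω) G γ κ ε t) _
    unfold weightStep
    exact Measurable.ite (measurableSet_lt hd measurable_const) measurable_const
      (Measurable.ite (measurableSet_lt measurable_const hd) measurable_const hd)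

theorem measurable_levelCost (m t : ℕ) :
    Measurable fun ω : Coins => levelCost k l r (noise n ω) m t := by
  induction m generalizing t with
  | zero => exact measurable_rowCost 0 t
  | succ m ih =>
    change Measurable fun ω : Coins => combinedCost _ _ _ _ _ _ t
    unfold combinedCost gain
    exact (ih t).sub ((measurable_weight ih (measurable_rowCost _) t).mul
      (((ih t).sub (measurable_rowCost _ _)).sub measurable_const))

theorem measurable_rowWeight (m t : ℕ) :
    Measurable fun ω : Coins => rowWeight k l r (noise n ω) m t :=
  measurable_weight (measurable_levelCost _) (measurable_rowCost _) t

theorem levelCache_zero (ω : Coins) (t : ℕ) :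
    levelCache k l r ω 0 t = rowCache k l r (noise n ω) 0 t := rfl

open Classical in
theorem levelCache_succ (ω : Coins) (m t : ℕ) :
    levelCache k l r ω (m + 1) t =
      if (ω (n + (m + 1)) : ℝ) < rowWeight k l r (noise n ω) (m + 1) t then
        rowCache k l r (noise n ω) (m + 1) t else levelCache k l r ω m t := by
  unfold levelCache
  rw [selected]
  split_ifs <;> rfl

theorem measurableSet_mem_levelCache (i : Fin n) (m t : ℕ) :
    MeasurableSet {ω : Coins | i ∈ levelCache k l r ω m t} := by
  induction m with
  | zero => exact measurableSet_mem_rowCache i 0 t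
  | succ m ih =>
    have h : {ω : Coins | i ∈ levelCache k l r ω (m + 1) t} =
        {ω : Coins | (ω (n + (m + 1)) : ℝ) < rowWeight k l r (noise n ω) (m + 1) t}.ite
          {ω : Coins | i ∈ rowCache k l r (noise n ω) (m + 1) t}
          {ω : Coins | i ∈ levelCache k l r ω m t} := by
      ext ω
      simp only [levelCache_succ, Set.ite, Set.mem_ofPred_eq, Set.mem_union, Set.mem_inter_iff,
        Set.mem_sdiff]
      split_ifs with h <;> simp [h]
    rw [h]
    exact MeasurableSet.ite (measurableSet_lt
      (measurable_subtype_coe.comp (measurable_pi_apply _)) (measurable_rowWeight _ _))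
      (measurableSet_mem_rowCache i _ t) ih

theorem card_levelCache (hkn : k ≤ n) (ω : Coins) (m t : ℕ) : (levelCache k l r ω m t).card = k :=
  card_rowCache hkn _ _

theorem measurableSet_levelCache_eq (m t : ℕ) (C : Finset (Fin n)) :
    MeasurableSet {ω : Coins | levelCache k l r ω m t = C} := by
  have : {ω : Coins | levelCache k l r ω m t = C} =
      ⋂ i : Fin n, {ω | i ∈ levelCache k l r ω m t ↔ i ∈ C} := by
    ext ω
    simp [Finset.ext_iff]
  rw [this]
  refine MeasurableSet.iInter fun i => ?_
  by_cases hi : i ∈ C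
  · simpa [hi] using measurableSet_mem_levelCache i m t
  · have : {ω : Coins | i ∈ levelCache k l r ω m t ↔ i ∈ C} =
        {ω : Coins | i ∈ levelCache k l r ω m t}ᶜ := by
      ext ω
      simp [hi]
    rw [this]
    exact (measurableSet_mem_levelCache i m t).compl

theorem tame_roundCost {C D : Coins → Finset (Fin n)} (hC : ∀ i, MeasurableSet {ω | i ∈ C ω})
    (hD : ∀ i, MeasurableSet {ω | i ∈ D ω}) (i : Fin n) :
    Tame fun ω => roundCost i (C ω) (D ω) := by
  classical
  refine Tame.of_mem_Icc (c := n + 2) ?_ fun ω => ⟨roundCost_nonneg _ _ _, ?_⟩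
  · unfold roundCost missLoss moveCost
    refine (Measurable.ite (hC i) measurable_const measurable_const).add ?_
    have : ∀ ω, (((C ω) \ (D ω)).card : ℝ) = ∑ j, if j ∈ C ω ∧ j ∉ D ω then (1 : ℝ) else 0 := by
      intro ω
      rw [sum_boole]
      congr 2
      ext j
      simp
    simp only [this]
    exact Finset.measurable_sum _ fun j _ =>
      Measurable.ite ((hC j).inter (hD j).compl) measurable_const measurable_const
  · refine (roundCost_le _ _ _).trans ?_
    have : (C ω).card ≤ n := by simpa using card_le_univ (C ω)
    have : ((C ω).card : ℝ) ≤ n := by exact_mod_cast this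
    linarith

theorem tame_rowCost (m t : ℕ) : Tame fun ω : Coins => rowCost k l r (noise n ω) m t :=
  Tame.of_mem_Icc (c := k + 2) (measurable_rowCost m t) fun ω => ⟨rowCost_nonneg _ _, by
    have : (0 : ℝ) ≤ k := by positivity
    unfold rowCost; split_ifs <;> linarith⟩

theorem tame_levelCost (hk : 1 ≤ k) (m t : ℕ) :
    Tame fun ω : Coins => levelCost k l r (noise n ω) m t :=
  Tame.of_mem_Icc (measurable_levelCost m t) fun _ => levelCost_mem hk m t

theorem tame_rowWeight (m t : ℕ) : Tame fun ω : Coins => rowWeight k l r (noise n ω) m t :=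
  Tame.of_mem_Icc (measurable_rowWeight m t) fun _ => ⟨rowWeight_nonneg m t, (rowWeight_mem m t).2⟩

end Measurability

/-! ### The selected cache has at most the charged cost -/

section Selection

variable {n k l : ℕ} {r : ℕ → Fin n}

theorem noise_mem (ω : Coins) (i : Fin n) : noise n ω i ∈ Set.Icc (0 : ℝ) 1 := (ω i).2

theorem noise_update_of_le (ω : Coins) {i : ℕ} (hi : n ≤ i) (v : unitInterval) :
    noise n (Function.update ω i v) = noise n ω := by
  ext j
  unfold noise
  rw [Function.update_of_ne (by omega)]

/-- Level `m` reads only the noise and the thresholds up to `m`, hence is independent of the later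
thresholds. -/
theorem levelCache_update_of_lt (ω : Coins) {m j : ℕ} (hj : m < j) (v : unitInterval) (t : ℕ) :
    levelCache k l r (Function.update ω (n + j) v) m t = levelCache k l r ω m t := by
  induction m with
  | zero => rw [levelCache_zero, levelCache_zero, noise_update_of_le _ (by omega)]
  | succ m ih =>
    rw [levelCache_succ, levelCache_succ, ih (by omega), noise_update_of_le _ (by omega),
      Function.update_of_ne (by omega)]

-- The same threshold `v` decides in both rounds. A switch occurs only if `v` lies between `x` and
-- `y`, and then costs at most `k` more than staying with the strategy followed in the new round.
open Classical in
theorem integral_threshold_le {i : Fin n} {B B' D D' : Finset (Fin n)} {x y : ℝ}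
    (hB : B.card = k) (hD : D.card = k)
    (hx0 : 0 ≤ x) (hx1 : x ≤ 1) (hy0 : 0 ≤ y) (hy1 : y ≤ 1) :
    ∫ v : unitInterval, roundCost i (if (v : ℝ) < x then B else D) (if (v : ℝ) < y then B' else D') ≤
      (1 - x) * roundCost i D D' + x * roundCost i B B' + k * |x - y| := by
  have hint : ∀ z : ℝ, Integrable fun v : unitInterval => if (v : ℝ) < z then (1 : ℝ) else 0 := by
    intro z
    refine Integrable.of_bound (Measurable.ite (measurableSet_lt measurable_subtype_coe
      measurable_const) measurable_const measurable_const).aestronglyMeasurable 1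
      (ae_of_all _ fun v => ?_)
    split_ifs <;> norm_num
  have hpt : ∀ v : unitInterval, roundCost i (if (v : ℝ) < x then B else D)
      (if (v : ℝ) < y then B' else D') ≤ roundCost i D D' +
        (if (v : ℝ) < x then (1 : ℝ) else 0) * (roundCost i B B' - roundCost i D D') +
        k * ((if (v : ℝ) < max x y then (1 : ℝ) else 0) -
          (if (v : ℝ) < min x y then (1 : ℝ) else 0)) := by
    intro v
    have hcross : ∀ S S' E : Finset (Fin n), S.card = k →
        roundCost i S S' ≤ roundCost i S E + k := by
      intro S S' E hS
      have h1 := moveCost_le_card S S'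
      have h2 := moveCost_nonneg S E
      rw [hS] at h1
      unfold roundCost
      linarith
    have h1 := hcross B D' B' hB
    have h2 := hcross D B' D' hD
    by_cases hvx : (v : ℝ) < x <;> by_cases hvy : (v : ℝ) < y <;>
      simp [hvx, hvy] <;> linarith
  calc _ ≤ ∫ v : unitInterval, (roundCost i D D' +
        (if (v : ℝ) < x then (1 : ℝ) else 0) * (roundCost i B B' - roundCost i D D') +
        k * ((if (v : ℝ) < max x y then (1 : ℝ) else 0) -
          (if (v : ℝ) < min x y then (1 : ℝ) else 0))) := by
        refine integral_mono_of_nonneg (ae_of_all _ fun v => roundCost_nonneg _ _ _) ?_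
          (ae_of_all _ hpt)
        exact ((integrable_const _).add ((hint x).mul_const _)).add
          (((hint _).sub (hint _)).const_mul _)
    _ = _ := by
        have i1 : Integrable fun _ : unitInterval => roundCost i D D' := integrable_const _
        have i2 := (hint x).mul_const (roundCost i B B' - roundCost i D D')
        have i3 := (hint (max x y)).sub (hint (min x y))
        have e1 := integral_add (i1.add i2) (i3.const_mul (k : ℝ))
        have e2 := integral_add i1 i2
        have e3 := integral_sub (hint (max x y)) (hint (min x y))
        simp only [Pi.add_apply, Pi.sub_apply] at e1 e2 e3
        rw [e1, e2, integral_const_mul, e3, integral_mul_const,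
          integral_indicator_lt hx0 hx1,
          integral_indicator_lt (hx0.trans (le_max_left _ _)) (max_le hx1 hy1),
          integral_indicator_lt (le_min hx0 hy0) ((min_le_left _ _).trans hx1),
          max_sub_min_eq_abs']
        simp
        ring

/-- The factor `w` carries the product of the `1 - x` of the levels above, which depend on the noise
and cannot leave the integral; being independent of all thresholds, it survives the resampling of
each of them. -/
theorem integral_roundCost_levelCache_le (hk : 1 ≤ k) (hkn : k ≤ n) (m t : ℕ) {w : Coins → ℝ}
    (hw : Tame w) (hw0 : ∀ ω, 0 ≤ w ω)
    (hwu : ∀ ω j v, w (Function.update ω (n + j) v) = w ω) :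
    ∫ ω, w ω * roundCost (r (t + 1)) (levelCache k l r ω m (t + 1)) (levelCache k l r ω m t)
        ∂coinMeasure ≤
      ∫ ω, w ω * levelCost k l r (noise n ω) m (t + 1) ∂coinMeasure := by
  have hrow : ∀ m, Tame fun ω : Coins => roundCost (r (t + 1))
      (rowCache k l r (noise n ω) m (t + 1)) (rowCache k l r (noise n ω) m t) := fun m =>
    tame_roundCost (fun i => measurableSet_mem_rowCache i m _)
      (fun i => measurableSet_mem_rowCache i m _) _
  have hlev : ∀ m, Tame fun ω : Coins => roundCost (r (t + 1))
      (levelCache k l r ω m (t + 1)) (levelCache k l r ω m t) := fun m =>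
    tame_roundCost (fun i => measurableSet_mem_levelCache i m _)
      (fun i => measurableSet_mem_levelCache i m _) _
  induction m generalizing w with
  | zero =>
    refine integral_mono (hw.mul (hrow 0)).integrable (hw.mul (tame_levelCost hk 0 _)).integrable
      fun ω => mul_le_mul_of_nonneg_left ?_ (hw0 ω)
    exact roundCost_rowCache_le hk hkn (noise_mem ω) 0 t
  | succ m ih =>
    set x : Coins → ℝ := fun ω => rowWeight k l r (noise n ω) (m + 1) (t + 1) with hx
    set G : ℝ := costBound k l (m + 1) (t + 1) with hG
    have hx0 : ∀ ω, 0 ≤ x ω := fun ω => rowWeight_nonneg _ _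
    have hx1 : ∀ ω, x ω ≤ 1 := fun ω => (rowWeight_mem _ _).2
    have hxt : Tame x := tame_rowWeight _ _
    have hyt : Tame fun ω => 1 - x ω := by
      simpa [sub_eq_add_neg] using (Tame.const 1).add ((Tame.const (-1)).mul hxt)
    have hxu : ∀ ω j v, x (Function.update ω (n + j) v) = x ω := fun ω j v => by
      simp only [hx, noise_update_of_le ω (Nat.le_add_right n j)]
    have hsecond : Tame fun ω => w ω * x ω *
        (rowCost k l r (noise n ω) (m + 1) (t + 1) + moveRate l (m + 1) * G) :=
      (hw.mul hxt).mul ((tame_rowCost _ _).add (Tame.const _))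
    calc _ ≤ ∫ ω, (w ω * (1 - x ω) * roundCost (r (t + 1)) (levelCache k l r ω m (t + 1))
            (levelCache k l r ω m t) + w ω * x ω *
              (rowCost k l r (noise n ω) (m + 1) (t + 1) + moveRate l (m + 1) * G))
              ∂coinMeasure := by
          -- Integrate over the threshold of row `m + 1` first: the weights and the caches of level
          -- `m` do not depend on it.
          refine integral_le_of_update (hw.mul (hlev (m + 1)))
            (((hw.mul hyt).mul (hlev m)).add hsecond) (n + (m + 1)) fun ω => ?_
          simp only [hwu, levelCache_succ, levelCache_update_of_lt ω (Nat.lt_succ_self m),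
            noise_update_of_le ω (Nat.le_add_right n (m + 1)), Function.update_self]
          rw [integral_const_mul]
          have h1 := integral_threshold_le (i := r (t + 1))
            (B' := rowCache k l r (noise n ω) (m + 1) t) (D' := levelCache k l r ω m t)
            (card_rowCache (l := l) (r := r) (u := noise n ω) hkn (m + 1) (t + 1))
            (card_levelCache (l := l) (r := r) hkn ω m (t + 1)) (hx0 ω) (hx1 ω)
            (rowWeight_nonneg (k := k) (l := l) (r := r) (u := noise n ω) (m + 1) t)
            (rowWeight_mem (k := k) (l := l) (r := r) (u := noise n ω) (m + 1) t).2
          have h2 := moveCost_charge (l := l) (r := r) (u := noise n ω) hk m t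
          have h3 := mul_le_mul_of_nonneg_left (roundCost_rowCache_le (l := l) (r := r) hk hkn
            (noise_mem ω) (m + 1) t) (hx0 ω)
          calc _ ≤ w ω * ((1 - x ω) * roundCost (r (t + 1)) (levelCache k l r ω m (t + 1))
              (levelCache k l r ω m t) + x ω * (rowCost k l r (noise n ω) (m + 1) (t + 1) +
                moveRate l (m + 1) * G)) :=
                mul_le_mul_of_nonneg_left (by simp only [hx, hG] at *; linarith) (hw0 ω)
            _ = _ := by ring
      _ = ∫ ω, w ω * (1 - x ω) * roundCost (r (t + 1)) (levelCache k l r ω m (t + 1))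
            (levelCache k l r ω m t) ∂coinMeasure + ∫ ω, w ω * x ω *
              (rowCost k l r (noise n ω) (m + 1) (t + 1) + moveRate l (m + 1) * G)
              ∂coinMeasure :=
          integral_add ((hw.mul hyt).mul (hlev m)).integrable hsecond.integrable
      _ ≤ ∫ ω, w ω * (1 - x ω) * levelCost k l r (noise n ω) m (t + 1) ∂coinMeasure +
            ∫ ω, w ω * x ω *
              (rowCost k l r (noise n ω) (m + 1) (t + 1) + moveRate l (m + 1) * G)
              ∂coinMeasure := by
          refine add_le_add ?_ le_rfl
          exact ih (hw.mul hyt) (fun ω => mul_nonneg (hw0 ω) (sub_nonneg.2 (hx1 ω)))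
            (fun ω j v => by simp only [hwu, hxu])
      _ = _ := by
          rw [← integral_add ((hw.mul hyt).mul (tame_levelCost hk m _)).integrable
            hsecond.integrable]
          refine integral_congr_ae (ae_of_all _ fun ω => ?_)
          simp only [levelCost_succ, hx, hG]
          ring

theorem integral_intervalCost_le (hk : 1 ≤ k) (hkn : k ≤ n) {a b : ℕ} (ha : 1 ≤ a) :
    ∫ ω, intervalCost r (levelCache k l r ω l) a b ∂coinMeasure ≤
      ∫ ω, ∑ t ∈ Icc a b, levelCost k l r (noise n ω) l t ∂coinMeasure := by
  have hlev : ∀ t, Tame fun ω : Coins => roundCost (r t)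
      (levelCache k l r ω l t) (levelCache k l r ω l (t - 1)) := fun t =>
    tame_roundCost (fun i => measurableSet_mem_levelCache i l _)
      (fun i => measurableSet_mem_levelCache i l _) _
  calc _ ≤ ∫ ω, ∑ t ∈ Icc a b, roundCost (r t) (levelCache k l r ω l t)
        (levelCache k l r ω l (t - 1)) ∂coinMeasure :=
        integral_mono_of_nonneg (ae_of_all _ fun ω => add_nonneg
          (sum_nonneg fun _ _ => missLoss_nonneg _ _) (sum_nonneg fun _ _ => moveCost_nonneg _ _))
          (Tame.sum fun t _ => hlev t).integrable
          (ae_of_all _ fun ω => intervalCost_le_sum_roundCost _ _ _ _)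
    _ ≤ _ := by
        rw [integral_finsetSum _ fun t _ => (hlev t).integrable,
          integral_finsetSum _ fun t _ => (tame_levelCost hk l t).integrable]
        refine sum_le_sum fun t ht => ?_
        obtain ⟨s, rfl⟩ : ∃ s, t = s + 1 := ⟨t - 1, by have := (mem_Icc.1 ht).1; omega⟩
        have := integral_roundCost_levelCache_le (l := l) (r := r) hk hkn l s (Tame.const 1)
          (fun _ => zero_le_one) (fun _ _ _ => rfl)
        simpa using this

end Selection

end Paging

namespace Paging

open Finset MeasureTheory

/-! ### Following the perturbed leader -/

section Leader

variable {n k l : ℕ} {r : ℕ → Fin n}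

theorem mod_ne_zero_of_block {len s t : ℕ} (hs : s % len = 0) (h1 : s < t) (h2 : t < s + len) :
    ¬ t % len = 0 := by
  intro ht
  obtain ⟨a, rfl⟩ := Nat.dvd_of_mod_eq_zero hs
  obtain ⟨b, rfl⟩ := Nat.dvd_of_mod_eq_zero ht
  have h3 : a < b := lt_of_mul_lt_mul_left h1 (Nat.zero_le _)
  have h4 : b < a + 1 := by
    refine lt_of_mul_lt_mul_left (a := len) ?_ (Nat.zero_le _)
    rw [mul_add, mul_one]; exact h2
  omega

open Classical in
/-- The leader, with hindsight of one round, does as well as any fixed cache. -/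
theorem sum_mem_le_sum_mem_leader (hkn : k ≤ n) {len h s : ℕ} {u : Fin n → ℝ}
    (hu : ∀ i, u i ∈ Set.Icc (0 : ℝ) 1) (hs : s % len = 0) {C : Finset (Fin n)} (hC : C.card = k)
    {e : ℕ} (hse : s + 1 ≤ e) (hes : e ≤ s + len) :
    ∑ t ∈ Ioc (s + 1) e, (if r t ∈ C then (1 : ℝ) else 0) ≤
      k * h + ∑ t ∈ Ioc (s + 1) e,
        if r t ∈ top k (score (counts len r t) h u) then (1 : ℝ) else 0 := by
  -- Be the leader: passing to the next leader can only decrease the old total score, and the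
  -- request then adds one exactly if it is in the new leader. Initially only noise is present,
  -- worth at most `k * h`.
  have key : (∑ i ∈ top k (score (counts len r e) h u), score (counts len r e) h u i ≤
      k * h + ∑ t ∈ Ioc (s + 1) e,
        if r t ∈ top k (score (counts len r t) h u) then (1 : ℝ) else 0) ∧
      ∑ i ∈ C, (counts len r e i : ℝ) =
        ∑ t ∈ Ioc (s + 1) e, (if r t ∈ C then (1 : ℝ) else 0) := by
    induction e, hse using Nat.le_induction with
    | base =>
      rw [counts_succ_of_restart hs]
      refine ⟨?_, by simp⟩
      simp only [Ioc_self, sum_empty, add_zero]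
      refine (sum_le_card_nsmul _ _ (h : ℝ) fun i _ => ?_).trans
        (by rw [card_top hkn, nsmul_eq_mul])
      have := mul_le_mul_of_nonneg_left (hu i).2 (Nat.cast_nonneg (α := ℝ) h)
      simpa [score] using this
    | succ e hse ih =>
      obtain ⟨ih1, ih2⟩ := ih (by omega)
      have hmod : ¬ e % len = 0 := mod_ne_zero_of_block hs (by omega) (by omega)
      have hupd : ∀ S : Finset (Fin n), ∑ i ∈ S, (counts len r (e + 1) i : ℝ) =
          ∑ i ∈ S, (counts len r e i : ℝ) + if r (e + 1) ∈ S then (1 : ℝ) else 0 := by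
        intro S
        rw [counts_succ_of_mod hmod, ← sum_ite_eq' S (r (e + 1)) (fun _ => (1 : ℝ)),
          ← sum_add_distrib]
        refine sum_congr rfl fun i _ => ?_
        rcases eq_or_ne i (r (e + 1)) with rfl | hi
        · simp
        · simp [hi]
      rw [sum_Ioc_succ_top hse, sum_Ioc_succ_top hse]
      refine ⟨?_, by rw [hupd, ih2]⟩
      have h1 := sum_le_sum_top hkn (score (counts len r e) h u)
        (card_top hkn (score (counts len r (e + 1)) h u))
      have h2 := hupd (top k (score (counts len r (e + 1)) h u))
      have h3 : ∑ i ∈ top k (score (counts len r (e + 1)) h u), score (counts len r (e + 1)) h u i =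
          ∑ i ∈ top k (score (counts len r (e + 1)) h u), score (counts len r e) h u i +
            if r (e + 1) ∈ top k (score (counts len r (e + 1)) h u) then (1 : ℝ) else 0 := by
        simp only [score, sum_add_distrib] at h2 ⊢
        linarith
      linarith
  have h1 := sum_le_sum_top hkn (score (counts len r e) h u) hC
  have h2 : ∑ i ∈ C, (counts len r e i : ℝ) ≤ ∑ i ∈ C, score (counts len r e) h u i := by
    refine sum_le_sum fun i _ => ?_
    have := mul_nonneg (Nat.cast_nonneg (α := ℝ) h) (hu i).1
    simp only [score]
    linarith
  linarith [key.1, key.2]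

theorem noise_update (ω : Coins) (i : Fin n) (v : unitInterval) :
    noise n (Function.update ω i v) = Function.update (noise n ω) i v := by
  ext j
  unfold noise
  rcases eq_or_ne j i with rfl | hj
  · simp
  · rw [Function.update_of_ne hj, Function.update_of_ne (by simpa [Fin.ext_iff] using hj)]

/-- The length of a set of reals is at most its diameter. -/
theorem volume_le_of_dist_le {S : Set unitInterval} {δ : ℝ}
    (h : ∀ v ∈ S, ∀ w ∈ S, (w : ℝ) ≤ v + δ) : volume S ≤ ENNReal.ofReal δ := by
  rw [unitInterval.volume_apply]
  refine (Real.volume_le_diam _).trans (Metric.ediam_le ?_)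
  rintro _ ⟨v, hv, rfl⟩ _ ⟨w, hw, rfl⟩
  rw [edist_dist, Real.dist_eq]
  refine ENNReal.ofReal_le_ofReal (abs_le.2 ⟨?_, ?_⟩)
  · linarith [h v hv w hw]
  · linarith [h w hw v hv]

-- Fix the noise of the other pages. A request adds `1` to the score, as does raising the noise by
-- `1 / h`; hence if noise `v` lets the page in after the request, then any noise above `v + 1 / h`
-- has it in already before. The noises for which the page enters therefore have diameter at most `1
-- / h`.
open Classical in
theorem integral_enter_le {m t : ℕ} (hm : m ≠ 0) (ht : ¬ t % blockLength l m = 0) :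
    ∫ ω, (if r (t + 1) ∈ rowCache k l r (noise n ω) m (t + 1) ∧
        r (t + 1) ∉ rowCache k l r (noise n ω) m t then (1 : ℝ) else 0) ∂coinMeasure ≤
      1 / rowScale l m := by
  have hh := one_le_rowScale l m
  have hms : MeasurableSet {ω : Coins | r (t + 1) ∈ rowCache k l r (noise n ω) m (t + 1) ∧
      r (t + 1) ∉ rowCache k l r (noise n ω) m t} :=
    (measurableSet_mem_rowCache _ _ _).inter (measurableSet_mem_rowCache _ _ _).compl
  have htame : Tame fun ω : Coins => if r (t + 1) ∈ rowCache k l r (noise n ω) m (t + 1) ∧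
      r (t + 1) ∉ rowCache k l r (noise n ω) m t then (1 : ℝ) else 0 :=
    Tame.of_mem_Icc (c := 1) (Measurable.ite hms measurable_const measurable_const)
      fun ω => by split_ifs <;> norm_num
  refine (integral_le_of_update htame (Tame.const (1 / rowScale l m)) (r (t + 1))
    fun ω => ?_).trans (by simp)
  set S : Set unitInterval := {v | r (t + 1) ∈ rowCache k l r
    (noise n (Function.update ω (r (t + 1)) v)) m (t + 1) ∧
      r (t + 1) ∉ rowCache k l r (noise n (Function.update ω (r (t + 1)) v)) m t} with hS
  have hSm : MeasurableSet S := measurable_update ω hms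
  have hvol : volume S ≤ ENNReal.ofReal (1 / rowScale l m) := by
    refine volume_le_of_dist_le fun v hv w hw => ?_
    by_contra hlt
    rw [not_le] at hlt
    refine hw.2 ?_
    have h1 := hv.1
    unfold rowCache at h1 ⊢
    simp only [rowCounts, hm, if_false] at h1 ⊢
    refine mem_top_raised ?_ (fun j hj => ?_) h1
    · rw [score_counts_succ_self ht]
      simp only [score, noise_update, Function.update_self]
      have : (rowScale l m : ℝ) * (v + 1 / rowScale l m) ≤ rowScale l m * w := by
        gcongr
      rw [mul_add, mul_one_div_cancel (by positivity)] at this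
      linarith
    · rw [score_counts_succ_of_ne ht hj]
      simp only [score, noise_update, Function.update_of_ne hj]
  have hint : ∫ v : unitInterval, (if v ∈ S then (1 : ℝ) else 0) = (volume S).toReal := by
    have : (fun v : unitInterval => if v ∈ S then (1 : ℝ) else 0) = S.indicator 1 := by
      ext v
      simp [Set.indicator]
    rw [this, integral_indicator_one hSm]
    rfl
  calc _ = (volume S).toReal := hint
    _ ≤ _ := ENNReal.toReal_le_of_le_ofReal (by positivity) hvol

/-- Expected cost of one block of a row, against a fixed cache. -/
theorem integral_sum_rowCost_le (hkn : k ≤ n) {m s e : ℕ} (hm : m ≠ 0)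
    (hs : s % blockLength l m = 0) (hse : s + 1 ≤ e) (hes : e ≤ s + blockLength l m)
    {C : Finset (Fin n)} (hC : C.card = k) :
    ∫ ω, ∑ t ∈ Ioc s e, rowCost k l r (noise n ω) m t ∂coinMeasure ≤
      ∑ t ∈ Ioc s e, missLoss (r t) C + (k + 2 + 2 * (k * rowScale l m) +
        2 * ((e - s) / rowScale l m)) := by
  classical
  set J := Ioc (s + 1) e with hJ
  set enter : ℕ → Coins → ℝ := fun t ω => if r t ∈ rowCache k l r (noise n ω) m t ∧
        r t ∉ rowCache k l r (noise n ω) m (t - 1) then (1 : ℝ) else 0 with hE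
  have hEt : ∀ t, Tame (enter t) := fun t =>
    Tame.of_mem_Icc (c := 1) (Measurable.ite ((measurableSet_mem_rowCache _ _ _).inter
      (measurableSet_mem_rowCache _ _ _).compl) measurable_const measurable_const)
      fun ω => by simp only [hE]; split_ifs <;> norm_num
  have hEi : ∀ t ∈ J, ∫ ω, enter t ω ∂coinMeasure ≤ 1 / rowScale l m := by
    intro t ht
    rw [hJ, mem_Ioc] at ht
    obtain ⟨t, rfl⟩ : ∃ t', t = t' + 1 := ⟨t - 1, by omega⟩
    exact integral_enter_le hm (mod_ne_zero_of_block hs (by omega) (by omega))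
  have hsplit : Ioc s e = insert (s + 1) J := by
    ext t; simp only [hJ, mem_insert, mem_Ioc]; omega
  have hnot : s + 1 ∉ J := by simp [hJ]
  have hpt : ∀ ω, ∑ t ∈ Ioc s e, rowCost k l r (noise n ω) m t ≤
      ∑ t ∈ Ioc s e, missLoss (r t) C + (k + 2 + 2 * (k * rowScale l m)) +
        2 * ∑ t ∈ J, enter t ω := by
    intro ω
    have h1 := sum_mem_le_sum_mem_leader (r := r) hkn (h := rowScale l m)
      (noise_mem ω) hs hC hse hes
    have h2 : rowCost k l r (noise n ω) m (s + 1) = k + 2 := by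
      simp [rowCost, hm, hs]
    -- A page in the old cache stays in the new one when requested, so a fault before the round is
    -- either a fault of the leader with hindsight or an entrance.
    have h3 : ∀ t ∈ J, rowCost k l r (noise n ω) m t = missLoss (r t) C +
        2 * (if r t ∈ C then (1 : ℝ) else 0) -
        2 * (if r t ∈ top k (score (counts (blockLength l m) r t) (rowScale l m) (noise n ω))
          then (1 : ℝ) else 0) + 2 * enter t ω := by
      intro t ht
      rw [hJ, mem_Ioc] at ht
      obtain ⟨t, rfl⟩ : ∃ t', t = t' + 1 := ⟨t - 1, by omega⟩
      have hmod := mod_ne_zero_of_block hs (t := t) (by omega) (by omega)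
      have hB : top k (score (counts (blockLength l m) r (t + 1)) (rowScale l m) (noise n ω)) =
          rowCache k l r (noise n ω) m (t + 1) := by simp [rowCache, rowCounts, hm]
      rw [hB]
      have hmono : r (t + 1) ∈ rowCache k l r (noise n ω) m t →
          r (t + 1) ∈ rowCache k l r (noise n ω) m (t + 1) :=
        mem_of_swap (mem_rowCache_succ hm hmod) (by rw [card_rowCache hkn, card_rowCache hkn])
      simp only [rowCost, missLoss, hE, Nat.add_sub_cancel, hm, hmod, and_false, if_false]
      by_cases g1 : r (t + 1) ∈ rowCache k l r (noise n ω) m t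
      · have g2 := hmono g1
        by_cases g3 : r (t + 1) ∈ C <;> simp [g1, g2, g3]
      · by_cases g2 : r (t + 1) ∈ rowCache k l r (noise n ω) m (t + 1) <;>
          by_cases g3 : r (t + 1) ∈ C <;> simp [g1, g2, g3]
    rw [hsplit, sum_insert hnot, sum_insert hnot, h2, sum_congr rfl h3, sum_add_distrib,
      sum_sub_distrib, sum_add_distrib, ← mul_sum, ← mul_sum, ← mul_sum]
    have := missLoss_nonneg (r (s + 1)) C
    linarith
  have hr : Tame fun ω : Coins => ∑ t ∈ J, enter t ω := Tame.sum fun t _ => hEt t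
  calc _ ≤ ∫ ω, (∑ t ∈ Ioc s e, missLoss (r t) C + (k + 2 + 2 * (k * rowScale l m)) +
        2 * ∑ t ∈ J, enter t ω) ∂coinMeasure :=
        integral_mono (Tame.sum fun t _ => tame_rowCost m t).integrable
          ((Tame.const _).add ((Tame.const 2).mul hr)).integrable hpt
    _ = ∑ t ∈ Ioc s e, missLoss (r t) C + (k + 2 + 2 * (k * rowScale l m)) +
        2 * ∑ t ∈ J, ∫ ω, enter t ω ∂coinMeasure := by
        rw [integral_add (integrable_const _) ((Tame.const 2).mul hr).integrable,
          integral_const_mul, integral_finsetSum _ fun t _ => (hEt t).integrable]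
        simp
    _ ≤ _ := by
        have h1 : ∑ t ∈ J, ∫ ω, enter t ω ∂coinMeasure ≤ (e - s) / rowScale l m := by
          refine (sum_le_card_nsmul _ _ _ hEi).trans ?_
          rw [hJ, Nat.card_Ioc, nsmul_eq_mul, Nat.cast_sub hse, mul_one_div]
          push_cast
          gcongr
          linarith
        linarith

end Leader

/-! ### Regret of the combination on intervals -/

section Regret

variable {n k l : ℕ} {r : ℕ → Fin n} {u : Fin n → ℝ}

/-- Each finer level treats the one below as its first algorithm, so the losses of
`sum_combinedCost_le_first` add up. -/
theorem sum_levelCost_le_of_le (hk : 1 ≤ k) {m a b : ℕ} (hab : a ≤ b) {j : ℕ} (hmj : m ≤ j) :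
    ∑ t ∈ Ioc a b, levelCost k l r u j t ≤ ∑ t ∈ Ioc a b, levelCost k l r u m t +
      ∑ i ∈ Ioc m j, (rowWeight k l r u i a / rate k l i + minWeight l * (5 * k * (b - a))) := by
  induction j, hmj using Nat.le_induction with
  | base => simp
  | succ j hmj ih =>
    have h1 := sum_combinedCost_le_first (p := levelCost k l r u j)
      (q := rowCost k l r u (j + 1)) (G := costBound k l (j + 1)) (κ := moveRate l (j + 1))
      (rate_pos (l := l) hk (j + 1)) (minWeight_pos l) (minWeight_le_one l)
      (fun t _ => abs_gain_le hk j t) (fun t _ => rate_mul_costBound_le hk (j + 1) t) hab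
    have h2 : ∑ t ∈ Ioc a b, costBound k l (j + 1) t ≤ 5 * k * (b - a) := by
      refine (sum_le_card_nsmul _ _ _ fun t _ => costBound_le hk (j + 1) t).trans_eq ?_
      rw [Nat.card_Ioc, nsmul_eq_mul, Nat.cast_sub hab]; ring
    have h3 := mul_le_mul_of_nonneg_left h2 (minWeight_pos l).le
    rw [sum_Ioc_succ_top hmj]
    change ∑ t ∈ Ioc a b, levelCost k l r u (j + 1) t ≤ _ + rowWeight k l r u (j + 1) a / _ + _
      at h1
    linarith

theorem one_div_rate {i : ℕ} (hi : i ≠ 0) : 1 / rate k l i = 10 * k * 2 ^ (l - i) := by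
  simp [rate, rowScale, hi]

/-- A geometric series: the rates double from row to row, so all finer rows together cost no more
than row `m` itself would. -/
theorem sum_one_div_rate_le {m : ℕ} (hm : m ≤ l) :
    ∑ i ∈ Ioc m l, 1 / rate k l i ≤ 10 * k * 2 ^ (l - m) := by
  have key : ∀ j, m ≤ j → j ≤ l →
      ∑ i ∈ Ioc m j, 1 / rate k l i + 10 * k * 2 ^ (l - j) = 10 * k * 2 ^ (l - m) := by
    intro j hj
    induction j, hj using Nat.le_induction with
    | base => simp
    | succ j hmj ih =>
      intro hj
      have ih := ih (by omega)
      rw [sum_Ioc_succ_top hmj, one_div_rate (by omega)]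
      have : l - j = l - (j + 1) + 1 := by omega
      rw [this, pow_succ] at ih
      linarith
  have := key l hm le_rfl
  have : (0 : ℝ) ≤ 10 * k * 2 ^ (l - l) := by positivity
  linarith

/-- The least weight `4 ^ (-l)` is chosen for this: it absorbs both the number of levels `l ≤ 2 ^ l`
and the number of rounds `b ≤ 2 ^ l`. -/
theorem minWeight_mul_le {b : ℕ} (hb : b ≤ 2 ^ l) {x : ℝ} (hx : x ≤ b) :
    l * (minWeight l * (5 * k * x)) ≤ 5 * k := by
  have hb' : (b : ℝ) ≤ 2 ^ l := by exact_mod_cast hb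
  have hl : (l : ℝ) ≤ 2 ^ l := by exact_mod_cast (Nat.lt_two_pow_self).le
  have h0 : (0 : ℝ) < 2 ^ l := by positivity
  have h1 : (l : ℝ) * x ≤ 2 ^ l * 2 ^ l :=
    (mul_le_mul_of_nonneg_left (hx.trans hb') (Nat.cast_nonneg l)).trans
      (mul_le_mul_of_nonneg_right hl h0.le)
  have h2 : l * (minWeight l * (5 * k * x)) = 5 * k * (l * x / (2 ^ l * 2 ^ l)) := by
    unfold minWeight; ring
  rw [h2]
  refine mul_le_of_le_one_right (by positivity) ?_
  rw [div_le_one (by positivity)]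
  exact h1

theorem sum_levelCost_le_level (hk : 1 ≤ k) {m a b : ℕ} (hab : a ≤ b) (hm : m ≤ l)
    (hb : b ≤ 2 ^ l) :
    ∑ t ∈ Ioc a b, levelCost k l r u l t ≤ ∑ t ∈ Ioc a b, levelCost k l r u m t +
      (10 * k * 2 ^ (l - m) + 5 * k) := by
  have h1 := sum_levelCost_le_of_le (l := l) (r := r) (u := u) hk hab hm
  rw [sum_add_distrib, sum_const, Nat.card_Ioc, nsmul_eq_mul] at h1
  have h2 : ∑ i ∈ Ioc m l, rowWeight k l r u i a / rate k l i ≤ ∑ i ∈ Ioc m l, 1 / rate k l i :=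
    sum_le_sum fun i _ => by
      have := rate_pos (l := l) hk i
      have := (rowWeight_mem (k := k) (l := l) (r := r) (u := u) i a).2
      gcongr
  have h3 := sum_one_div_rate_le (k := k) hm
  have h4 := minWeight_mul_le (k := k) hb (x := b - a) (by linarith [Nat.cast_nonneg (α := ℝ) a])
  have h5 : ((l - m : ℕ) : ℝ) * (minWeight l * (5 * k * (b - a))) ≤
      l * (minWeight l * (5 * k * (b - a))) := by
    have hab' : (a : ℝ) ≤ b := by exact_mod_cast hab
    have := (minWeight_pos l).le
    have hba : (0 : ℝ) ≤ b - a := by linarith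
    gcongr
    exact Nat.sub_le l m
  linarith

/-- All weights equal `minWeight l` at time `0`, which reduces the sum of the `1 / rate` to at most
`10 * k`; the other `5 * k` is the price of keeping weights above the minimum. -/
theorem sum_levelCost_le_marking (hk : 1 ≤ k) {b : ℕ} (hb : b ≤ 2 ^ l) :
    ∑ t ∈ Ioc 0 b, levelCost k l r u l t ≤ ∑ t ∈ Ioc 0 b, rowCost k l r u 0 t + 15 * k := by
  have h1 := sum_levelCost_le_of_le (l := l) (r := r) (u := u) hk (Nat.zero_le b) (Nat.zero_le l)
  rw [sum_add_distrib, sum_const, Nat.card_Ioc, nsmul_eq_mul] at h1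
  have h2 : ∑ i ∈ Ioc 0 l, rowWeight k l r u i 0 / rate k l i =
      minWeight l * ∑ i ∈ Ioc 0 l, 1 / rate k l i := by
    rw [mul_sum]
    exact sum_congr rfl fun i _ => by rw [mul_one_div]; rfl
  have h3 := mul_le_mul_of_nonneg_left (sum_one_div_rate_le (k := k) (Nat.zero_le l))
    (minWeight_pos l).le
  have h4 := minWeight_mul_le (k := k) hb (x := b - (0 : ℕ)) (by simp)
  have h5 : minWeight l * (10 * k * 2 ^ (l - 0)) ≤ 10 * k := by
    have : (1 : ℝ) ≤ 2 ^ l := one_le_pow₀ (by norm_num)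
    have h6 : minWeight l * (10 * k * 2 ^ (l - 0)) = 10 * k / 2 ^ l := by
      rw [Nat.sub_zero]; unfold minWeight; field_simp
    rw [h6]
    exact div_le_self (by positivity) this
  rw [Nat.sub_zero] at h1
  change ∑ t ∈ Ioc 0 b, levelCost k l r u l t ≤ ∑ t ∈ Ioc 0 b, rowCost k l r u 0 t + _ at h1
  rw [h2] at h1
  have h6 := h3.trans h5
  simp only [Nat.cast_zero, sub_zero] at h1 h4
  linarith

theorem log_one_div_minWeight_le (l : ℕ) : Real.log (1 / minWeight l) ≤ 1.4 * l := by
  have : (1 : ℝ) / minWeight l = 2 ^ l * 2 ^ l := by unfold minWeight; rw [one_div_one_div]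
  rw [this, Real.log_mul (by positivity) (by positivity), Real.log_pow]
  have := Real.log_two_lt_d9
  have := Nat.cast_nonneg (α := ℝ) l
  nlinarith

/-- Regret on a part of a block that starts with the block. -/
theorem regret_block (hk : 1 ≤ k) (hkn : k ≤ n) {m s e : ℕ} (hm : 1 ≤ m) (hml : m ≤ l)
    (hs : s % blockLength l m = 0) (hse : s + 1 ≤ e) (hes : e ≤ s + blockLength l m)
    (he : e ≤ 2 ^ l) {C : Finset (Fin n)} (hC : C.card = k) :
    ∫ ω, ∑ t ∈ Ioc s e, levelCost k l r (noise n ω) l t ∂coinMeasure ≤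
      ∑ t ∈ Ioc s e, missLoss (r t) C + 40 * (k * l * 2 ^ (l - m)) := by
  obtain ⟨m, rfl⟩ : ∃ m', m = m' + 1 := ⟨m - 1, by omega⟩
  set j := l - (m + 1) with hj
  have hscale : (rowScale l (m + 1) : ℝ) = 2 ^ j := by simp [rowScale, hj]
  have hlen : (blockLength l (m + 1) : ℝ) = l * (2 ^ j * 2 ^ j) := by
    unfold blockLength
    push_cast
    rw [← hj, ← mul_pow]; norm_num
  have hes' : (e : ℝ) - s ≤ l * (2 ^ j * 2 ^ j) := by
    rw [← hlen, sub_le_iff_le_add']; exact_mod_cast hes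
  have hk1 : (1 : ℝ) ≤ k := by exact_mod_cast hk
  have hl1 : (1 : ℝ) ≤ l := by exact_mod_cast (by omega : 1 ≤ l)
  have hh : (1 : ℝ) ≤ 2 ^ j := one_le_pow₀ (by norm_num)
  set h : ℝ := 2 ^ j with hh'
  have hkl : (k : ℝ) * 1 ≤ k * l := by gcongr
  have hX1 : (k : ℝ) * h ≤ k * l * h := by
    rw [mul_one] at hkl; gcongr
  have hX2 : (l : ℝ) * h ≤ k * l * h := by
    have : 1 * (l : ℝ) ≤ k * l := by gcongr
    rw [one_mul] at this; gcongr
  have hX3 : (k : ℝ) ≤ k * h := by nlinarith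
  have hX4 : (l : ℝ) ≤ l * h := by nlinarith
  have hGsum : ∑ t ∈ Ioc s e, costBound k l (m + 1) t ≤ 5 * k + 3 * (e - s) := by
    have hsplit : Ioc s e = insert (s + 1) (Ioc (s + 1) e) := by
      ext t; simp only [mem_insert, mem_Ioc]; omega
    rw [hsplit, sum_insert (by simp)]
    have h1 : ∑ t ∈ Ioc (s + 1) e, costBound k l (m + 1) t ≤ 3 * (e - s) := by
      refine (sum_le_card_nsmul _ _ 3 fun t ht => ?_).trans ?_
      · rw [mem_Ioc] at ht
        have := mod_ne_zero_of_block hs (t := t - 1) (by omega) (by omega)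
        simp [costBound, this]
      · rw [Nat.card_Ioc, nsmul_eq_mul, Nat.cast_sub hse]
        push_cast
        linarith
    linarith [costBound_le (l := l) hk (m + 1) (s + 1)]
  have hmove : moveRate l (m + 1) * ∑ t ∈ Ioc s e, costBound k l (m + 1) t ≤ k + l * h := by
    have h1 : moveRate l (m + 1) = 1 / (10 * h) := by rw [moveRate, hscale]
    have h2 : (5 * k + 3 * ((e : ℝ) - s)) ≤ (k + l * h) * (10 * h) := by nlinarith
    calc _ ≤ moveRate l (m + 1) * (5 * k + 3 * (e - s)) :=
          mul_le_mul_of_nonneg_left hGsum (moveRate_nonneg _)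
      _ ≤ _ := by
          rw [h1, one_div, inv_mul_le_iff₀ (by positivity), mul_comm (10 * h)]
          exact h2
  have hlog : Real.log (1 / minWeight l) / rate k l (m + 1) ≤ 14 * (k * l * h) := by
    rw [div_eq_mul_one_div, one_div_rate (by omega), ← hj]
    calc _ ≤ (1.4 * (l : ℝ)) * (10 * k * 2 ^ j) :=
          mul_le_mul_of_nonneg_right (log_one_div_minWeight_le l) (by positivity)
      _ = _ := by rw [hh']; ring
  have hq : ((e : ℝ) - s) / rowScale l (m + 1) ≤ l * h := by
    rw [hscale, div_le_iff₀ (by positivity)]; linarith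
  -- In units of `k * l * h`: `10` and `5` for the finer levels, `14` for `log (1 / ε) / γ`, and `1
  -- + 1` for the moving charge.
  have hpt : ∀ ω : Coins, ∑ t ∈ Ioc s e, levelCost k l r (noise n ω) l t ≤
      ∑ t ∈ Ioc s e, rowCost k l r (noise n ω) (m + 1) t + 31 * (k * l * h) := by
    intro ω
    have h1 := sum_levelCost_le_level (l := l) (r := r) (u := noise n ω) hk
      (by omega : s ≤ e) hml he
    have h2 := sum_combinedCost_le_second (p := levelCost k l r (noise n ω) m)
      (q := rowCost k l r (noise n ω) (m + 1)) (G := costBound k l (m + 1))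
      (κ := moveRate l (m + 1))
      (rate_pos (l := l) hk (m + 1)) (minWeight_pos l) (minWeight_le_one l)
      (fun t _ => abs_gain_le hk m t) (fun t _ => rate_mul_costBound_le hk (m + 1) t)
      (by omega : s ≤ e)
    change ∑ t ∈ Ioc s e, levelCost k l r (noise n ω) (m + 1) t ≤ _ at h2
    linarith
  have hrow : Tame fun ω : Coins => ∑ t ∈ Ioc s e, rowCost k l r (noise n ω) (m + 1) t :=
    Tame.sum fun t _ => tame_rowCost _ t
  -- The row itself adds at most `3 + 2 + 2` units, from `k + 2`, `2 * k * h` and `2 * l * h`;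
  -- together with the `31` this stays below `40`.
  have hfin := integral_sum_rowCost_le (r := r) hkn (by omega : m + 1 ≠ 0) hs hse hes hC
  calc _ ≤ ∫ ω, (∑ t ∈ Ioc s e, rowCost k l r (noise n ω) (m + 1) t + 31 * (k * l * h))
        ∂coinMeasure := integral_mono (Tame.sum fun t _ => tame_levelCost hk l t).integrable
          (hrow.add (Tame.const _)).integrable hpt
    _ = ∫ ω, ∑ t ∈ Ioc s e, rowCost k l r (noise n ω) (m + 1) t ∂coinMeasure +
        31 * (k * l * h) := by
        rw [integral_add hrow.integrable (integrable_const _)]; simp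
    _ ≤ _ := by
        rw [hscale] at hfin hq
        linarith

theorem integral_sum_Ioc_split (hk : 1 ≤ k) {a c b : ℕ} (hac : a ≤ c) (hcb : c ≤ b) :
    ∫ ω, ∑ t ∈ Ioc a b, levelCost k l r (noise n ω) l t ∂coinMeasure =
      ∫ ω, ∑ t ∈ Ioc a c, levelCost k l r (noise n ω) l t ∂coinMeasure +
        ∫ ω, ∑ t ∈ Ioc c b, levelCost k l r (noise n ω) l t ∂coinMeasure := by
  rw [← integral_add (Tame.sum fun t _ => tame_levelCost hk l t).integrable
    (Tame.sum fun t _ => tame_levelCost hk l t).integrable]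
  refine integral_congr_ae (ae_of_all _ fun ω => ?_)
  exact (sum_Ioc_consecutive _ hac hcb).symm

theorem regret_blocks (hk : 1 ≤ k) (hkn : k ≤ n) {m e : ℕ} (hm : 1 ≤ m) (hml : m ≤ l)
    (he : e ≤ 2 ^ l) {C : Finset (Fin n)} (hC : C.card = k) (q : ℕ) {s : ℕ}
    (hs : s % blockLength l m = 0) (hse : s ≤ e) (hes : e ≤ s + q * blockLength l m) :
    ∫ ω, ∑ t ∈ Ioc s e, levelCost k l r (noise n ω) l t ∂coinMeasure ≤
      ∑ t ∈ Ioc s e, missLoss (r t) C + q * (40 * (k * l * 2 ^ (l - m))) := by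
  induction q generalizing s with
  | zero =>
    obtain rfl : s = e := by omega
    simp
  | succ q ih =>
    have hX : (0 : ℝ) ≤ 40 * (k * l * 2 ^ (l - m)) := by positivity
    rcases hse.eq_or_lt with rfl | hlt
    · simp only [Ioc_self, sum_empty, integral_zero, zero_add]; positivity
    rcases le_or_gt e (s + blockLength l m) with h | h
    · refine (regret_block hk hkn hm hml hs hlt h he hC).trans ?_
      push_cast
      have : 0 ≤ (q : ℝ) * (40 * (k * l * 2 ^ (l - m))) := by positivity
      linarith
    · have hlen : 0 < blockLength l m := by
        have : 0 < l := by omega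
        unfold blockLength; positivity
      have h1 := regret_block (r := r) hk hkn hm hml hs (by omega) le_rfl (by omega) hC
      have h2 := ih (s := s + blockLength l m) (by simpa using hs) h.le
        (by rw [add_mul, one_mul] at hes; omega)
      rw [integral_sum_Ioc_split hk (by omega : s ≤ s + blockLength l m) h.le,
        ← sum_Ioc_consecutive _ (by omega : s ≤ s + blockLength l m) h.le]
      push_cast
      linarith

/-- No learning is needed here: the costs are bounded by `3` per round plus `5 * k` per restart of
the finest row, whose blocks have length `l`, so `l` consecutive rounds contain at most one restart.
-/
theorem sum_levelCost_le_short (hk : 1 ≤ k) (hl : 1 ≤ l) (q : ℕ) {a b : ℕ} (hab : a ≤ b)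
    (hb : b ≤ a + q * l) :
    ∑ t ∈ Ioc a b, levelCost k l r u l t ≤ 3 * (b - a) + 5 * k * q := by
  induction q generalizing a with
  | zero =>
    obtain rfl : a = b := by omega
    simp
  | succ q ih =>
    have hshort : ∀ c, a ≤ c → c ≤ a + l →
        ∑ t ∈ Ioc a c, levelCost k l r u l t ≤ 3 * (c - a) + 5 * k := by
      intro c hac hc
      have h1 : ∀ t ∈ Ioc a c, levelCost k l r u l t ≤
          3 + 5 * k * (if (t - 1) % l = 0 then (1 : ℝ) else 0) := by
        intro t _
        refine (levelCost_mem hk l t).2.trans ?_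
        have hl0 : l ≠ 0 := by omega
        have hlen : blockLength l l = l := by simp [blockLength]
        unfold costBound
        rw [hlen]
        split_ifs with h1 h2 h2
        · linarith
        · exact absurd h1.2 h2
        · have : (0 : ℝ) ≤ k := by positivity
          linarith
        · linarith
      refine (sum_le_sum h1).trans ?_
      rw [sum_add_distrib, sum_const, Nat.card_Ioc, nsmul_eq_mul, Nat.cast_sub hac, ← mul_sum,
        sum_boole]
      have hcard : ((Ioc a c).filter fun t => (t - 1) % l = 0).card ≤ 1 := by
        rw [card_le_one]
        intro x hx y hy
        rw [mem_filter, mem_Ioc] at hx hy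
        rcases lt_trichotomy x y with h | h | h
        · exact absurd hy.2 (mod_ne_zero_of_block hx.2 (by omega) (by omega))
        · exact h
        · exact absurd hx.2 (mod_ne_zero_of_block hy.2 (by omega) (by omega))
      have hcard' : ((((Ioc a c).filter fun t => (t - 1) % l = 0).card : ℕ) : ℝ) ≤ 1 := by
        exact_mod_cast hcard
      have hk0 : (0 : ℝ) ≤ 5 * k := by positivity
      nlinarith
    rcases le_or_gt b (a + l) with h | h
    · refine (hshort b hab h).trans ?_
      push_cast
      have : (0 : ℝ) ≤ 5 * k * q := by positivity
      linarith
    · have h2 := ih (a := a + l) h.le (by rw [add_mul, one_mul] at hb; omega)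
      have h3 := hshort (a + l) (by omega) le_rfl
      rw [← sum_Ioc_consecutive _ (by omega : a ≤ a + l) h.le]
      push_cast at *
      linarith

theorem exists_scale {x l : ℕ} (hl : 1 ≤ l) (hx : 4 * l ≤ x) :
    ∃ j, l * 4 ^ (j + 1) ≤ x ∧ x < l * 4 ^ (j + 2) := by
  have hq : 4 ≤ x / l := by rwa [Nat.le_div_iff_mul_le (by omega)]
  have hlog : 1 ≤ Nat.log 4 (x / l) := by
    exact Nat.log_pos (by norm_num) hq
  refine ⟨Nat.log 4 (x / l) - 1, ?_, ?_⟩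
  · rw [Nat.sub_add_cancel hlog, mul_comm]
    exact (Nat.le_div_iff_mul_le (by omega)).1 (Nat.pow_log_le_self 4 (by omega))
  · rw [show Nat.log 4 (x / l) - 1 + 2 = Nat.log 4 (x / l) + 1 by omega, mul_comm,
      ← Nat.div_lt_iff_lt_mul (by omega)]
    exact Nat.lt_pow_succ_log_self (by norm_num) _

/-- The constant `C₀ = 640` solves `C₀ = C₀ / 2 + 16 * 20`: a first piece of at most a quarter of
the length, with half the square root, and `16` blocks costing `40 * k * l * 2 ^ j ≤ 20 * k * S`
each. -/
theorem regret_interval (hk : 1 ≤ k) (hkn : k ≤ n) (hl : 1 ≤ l) {C : Finset (Fin n)}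
    (hC : C.card = k) (N : ℕ) {a b : ℕ} (hab : a ≤ b) (hN : b - a ≤ N) (hb : b ≤ 2 ^ l) :
    ∫ ω, ∑ t ∈ Ioc a b, levelCost k l r (noise n ω) l t ∂coinMeasure ≤
      ∑ t ∈ Ioc a b, missLoss (r t) C + 640 * (k * √(l * (b - a))) := by
  have hk1 : (1 : ℝ) ≤ k := by exact_mod_cast hk
  have hl1 : (1 : ℝ) ≤ l := by exact_mod_cast hl
  induction N using Nat.strong_induction_on generalizing a b with
  | _ N ih =>
  rcases hab.eq_or_lt with rfl | hlt
  · simp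
  have hba : (1 : ℝ) ≤ b - a := by
    have : ((a + 1 : ℕ) : ℝ) ≤ b := by exact_mod_cast hlt
    push_cast at this
    linarith
  set S := √((l : ℝ) * (b - a)) with hS
  have hSS : S * S = l * (b - a) := Real.mul_self_sqrt (by positivity)
  have hS1 : 1 ≤ S := by
    rw [hS, Real.one_le_sqrt]; nlinarith
  have hmiss : 0 ≤ ∑ t ∈ Ioc a b, missLoss (r t) C := sum_nonneg fun _ _ => missLoss_nonneg _ _
  rcases le_or_gt (b - a) (4 * l) with h | h
  · have h1 : ∫ ω, ∑ t ∈ Ioc a b, levelCost k l r (noise n ω) l t ∂coinMeasure ≤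
        3 * (b - a) + 5 * k * (4 : ℕ) := by
      refine (integral_mono (Tame.sum fun t _ => tame_levelCost hk l t).integrable
        (integrable_const _) fun ω => sum_levelCost_le_short hk hl 4 hab (by omega)).trans_eq ?_
      simp
    have h2 : (b : ℝ) - a ≤ 4 * l := by
      have : (b : ℝ) ≤ a + 4 * l := by exact_mod_cast (by omega : b ≤ a + 4 * l)
      linarith
    have h3 : (b : ℝ) - a ≤ 2 * S := by nlinarith
    have h4 : S ≤ k * S := by nlinarith
    have h5 : (k : ℝ) ≤ k * S := by nlinarith
    push_cast at h1
    linarith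
  · obtain ⟨j, hj1, hj2⟩ := exists_scale hl h.le
    -- The scale exists among the rows because `4 ^ (j + 1) ≤ b - a ≤ 2 ^ l`.
    have hjl : j + 1 ≤ l := by
      have h1 : 4 ^ (j + 1) ≤ 2 ^ l := by
        have : 1 * 4 ^ (j + 1) ≤ l * 4 ^ (j + 1) := Nat.mul_le_mul_right _ hl
        omega
      have h2 : 2 ^ (j + 1) ≤ 2 ^ l := (Nat.pow_le_pow_left (by norm_num) _).trans h1
      exact (Nat.pow_le_pow_iff_right (by norm_num)).1 h2
    set m := l - j with hm
    have hlm : l - m = j := by omega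
    have hlen : blockLength l m = l * 4 ^ j := by rw [blockLength, hlm]
    have hlen0 : 0 < blockLength l m := by rw [hlen]; positivity
    have h4len : 4 * blockLength l m ≤ b - a := by
      rw [hlen]; rw [pow_succ] at hj1; linarith
    -- The first block boundary at or after `a`; it lies within one block length, hence within a
    -- quarter of the interval.
    set s := (a + blockLength l m - 1) / blockLength l m * blockLength l m with hs
    have hs0 : s % blockLength l m = 0 := by rw [hs]; simp
    have hs1 : a ≤ s := by
      have := Nat.lt_div_mul_add (a := a + blockLength l m - 1) hlen0
      omega
    have hs2 : s < a + blockLength l m := by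
      have := Nat.div_mul_le_self (a + blockLength l m - 1) (blockLength l m)
      omega
    have h1 := ih (s - a) (by omega) hs1 le_rfl (by omega)
    have h2 := regret_blocks (r := r) hk hkn (m := m) (by omega) (by omega) hb hC 16 hs0
      (by omega) (by
        rw [hlen]
        have : l * 4 ^ (j + 2) = 16 * (l * 4 ^ j) := by ring
        omega)
    rw [hlm] at h2
    have hsa : ((s : ℝ) - a) ≤ (b - a) / 4 := by
      have : 4 * (s : ℝ) + a ≤ b + 4 * a := by
        have : 4 * s + a ≤ b + 4 * a := by omega
        exact_mod_cast this
      linarith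
    have h3 : √((l : ℝ) * (s - a)) ≤ S / 2 := by
      rw [Real.sqrt_le_left (by positivity)]
      nlinarith
    have h4 : (l : ℝ) * 2 ^ j ≤ S / 2 := by
      have h5 : ((l * 4 ^ (j + 1) : ℕ) : ℝ) ≤ b - a := by
        rw [le_sub_iff_add_le]; exact_mod_cast (by omega : l * 4 ^ (j + 1) + a ≤ b)
      have h6 : ((l * 4 ^ (j + 1) : ℕ) : ℝ) = 4 * (l * (2 ^ j * 2 ^ j)) := by
        push_cast
        rw [← mul_pow, pow_succ]; norm_num; ring
      refine (mul_self_le_mul_self_iff (by positivity) (by positivity)).2 ?_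
      nlinarith
    have h5 : (k : ℝ) * √((l : ℝ) * (s - a)) ≤ k * (S / 2) := by gcongr
    have h6 : (k : ℝ) * (l * 2 ^ j) ≤ k * (S / 2) := by gcongr
    rw [integral_sum_Ioc_split hk hs1 (by omega : s ≤ b),
      ← sum_Ioc_consecutive _ hs1 (by omega : s ≤ b)]
    push_cast at h2
    linarith

end Regret

end Paging

namespace Paging

open Finset MeasureTheory

/-! ### The marking algorithm -/

section Marking

variable {n k : ℕ} {r : ℕ → Fin n}

/-- The marked pages. -/
def marked (k : ℕ) (r : ℕ → Fin n) (t : ℕ) : Finset (Fin n) :=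
  univ.filter fun j => markClass k r t j = 4

/-- The pages that were marked in the previous phase. -/
def formerlyMarked (k : ℕ) (r : ℕ → Fin n) : ℕ → Finset (Fin n)
  | 0 => ∅
  | t + 1 => if r (t + 1) ∈ marked k r t ∨ (marked k r t).card < k then formerlyMarked k r t
      else marked k r t

theorem mem_marked {t : ℕ} {j : Fin n} : j ∈ marked k r t ↔ markClass k r t j = 4 := by
  simp [marked]

theorem marked_zero : marked k r 0 = ∅ := by
  ext j; simp [mem_marked, markClass]

theorem marked_succ_of_mem {t : ℕ} (h : r (t + 1) ∈ marked k r t) :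
    marked k r (t + 1) = marked k r t := by
  ext j
  rw [mem_marked] at *
  simp [mem_marked, markClass, markStep, h]

theorem marked_succ_of_lt {t : ℕ} (h : r (t + 1) ∉ marked k r t)
    (hc : (marked k r t).card < k) :
    marked k r (t + 1) = insert (r (t + 1)) (marked k r t) := by
  ext j
  rw [mem_marked] at h
  rw [mem_insert, mem_marked, mem_marked]
  have hc' : (univ.filter fun j => markClass k r t j = 4).card < k := hc
  simp only [markClass, markStep, h, if_false, hc', if_true]
  rcases eq_or_ne j (r (t + 1)) with rfl | hj
  · simp
  · simp [hj]

theorem marked_succ_of_full {t : ℕ} (h : r (t + 1) ∉ marked k r t)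
    (hc : ¬ (marked k r t).card < k) :
    marked k r (t + 1) = {r (t + 1)} := by
  ext j
  rw [mem_marked] at h
  rw [mem_singleton, mem_marked]
  have hc' : ¬ (univ.filter fun j => markClass k r t j = 4).card < k := hc
  simp only [markClass, markStep, h, if_false, hc']
  rcases eq_or_ne j (r (t + 1)) with rfl | hj
  · simp
  · have := markClass_cases k r t j
    simp only [Function.update_of_ne hj, hj, iff_false]
    omega

theorem markClass_eq_two_iff {t : ℕ} {j : Fin n} :
    markClass k r t j = 2 ↔ j ∈ formerlyMarked k r t ∧ j ∉ marked k r t := by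
  induction t with
  | zero => simp [markClass, formerlyMarked]
  | succ t ih =>
    by_cases h : r (t + 1) ∈ marked k r t
    · rw [marked_succ_of_mem h, formerlyMarked, if_pos (Or.inl h), ← ih]
      rw [mem_marked] at h
      simp [markClass, markStep, h]
    by_cases hc : (marked k r t).card < k
    · rw [marked_succ_of_lt h hc, formerlyMarked, if_pos (Or.inr hc), mem_insert, not_or]
      rw [mem_marked] at h
      have hc' : (univ.filter fun j => markClass k r t j = 4).card < k := hc
      simp only [markClass, markStep, h, if_false, hc', if_true]
      rcases eq_or_ne j (r (t + 1)) with rfl | hj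
      · simp
      · simpa [Function.update_of_ne hj, hj] using ih
    · rw [marked_succ_of_full h hc, formerlyMarked, if_neg (by tauto), mem_singleton, mem_marked]
      rw [mem_marked] at h
      have hc' : ¬ (univ.filter fun j => markClass k r t j = 4).card < k := hc
      simp only [markClass, markStep, h, if_false, hc']
      have := markClass_cases k r t j
      rcases eq_or_ne j (r (t + 1)) with rfl | hj
      · simp
      · simp only [Function.update_of_ne hj, hj, not_false_eq_true, and_true]
        omega

/-- Injectivity is needed because breaking ties by index is not invariant under permutations. -/
theorem rank_comp_perm {f : Fin n → ℝ} (hf : Function.Injective f) (σ : Equiv.Perm (Fin n))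
    (i : Fin n) : rank (f ∘ σ) i = rank f (σ i) := by
  classical
  have hprec : ∀ {g : Fin n → ℝ}, Function.Injective g → ∀ a b, Precedes g a b ↔ g b < g a := by
    intro g hg a b
    refine ⟨fun h => ?_, Or.inl⟩
    rcases h with h | ⟨h, h'⟩
    · exact h
    · exact lt_of_le_of_ne (not_lt.1 h) fun e => h'.ne (hg e).symm
  unfold rank
  refine card_bij (fun j _ => σ j) (fun j hj => ?_) (fun _ _ _ _ h => σ.injective h) fun j hj => ?_
  · simp only [mem_filter, mem_univ, true_and, hprec hf, hprec (hf.comp σ.injective)] at hj ⊢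
    exact hj
  · refine ⟨σ.symm j, ?_, by simp⟩
    simp only [mem_filter, mem_univ, true_and, hprec hf, hprec (hf.comp σ.injective)] at hj ⊢
    simpa using hj

theorem score_injective {c : Fin n → ℕ} {u : Fin n → ℝ} (hu : ∀ i, u i ∈ Set.Icc (0 : ℝ) 1)
    (hc : ∀ j, c j = 0 ∨ c j = 2 ∨ c j = 4) (hinj : Function.Injective u) :
    Function.Injective (score c 1 u) := by
  intro i j h
  have hi := hc i
  have hj := hc j
  rcases lt_trichotomy (c i) (c j) with h1 | h1 | h1
  · exact absurd h (score_lt_of_class hu (by omega)).ne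
  · apply hinj
    simpa [score, h1] using h
  · exact absurd h (score_lt_of_class hu (by omega)).ne'

/-- The number of pages of the middle class that are left out of the cache. -/
theorem card_middle_sdiff_top (hkn : k ≤ n) {c : Fin n → ℕ} {u : Fin n → ℝ}
    (hu : ∀ i, u i ∈ Set.Icc (0 : ℝ) 1) (hc : ∀ j, c j = 0 ∨ c j = 2 ∨ c j = 4)
    (h4 : (univ.filter fun j => c j = 4).card ≤ k)
    (h24 : k ≤ (univ.filter fun j => c j = 4).card + (univ.filter fun j => c j = 2).card) :
    ((univ.filter fun j => c j = 2) \ top k (score c 1 u)).card + k =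
      (univ.filter fun j => c j = 4).card + (univ.filter fun j => c j = 2).card := by
  classical
  set M := univ.filter fun j => c j = 4 with hM
  set Q := univ.filter fun j => c j = 2 with hQ
  set S := top k (score c 1 u) with hS
  have hdisj : Disjoint M Q := by
    rw [disjoint_left]
    intro j h1 h2
    simp only [hM, hQ, mem_filter, mem_univ, true_and] at h1 h2
    omega
  have hSM : S ⊆ M ∪ Q := by
    intro i hi
    by_contra hne
    have hi0 : c i = 0 := by
      have := hc i
      simp only [hM, hQ, mem_union, mem_filter, mem_univ, true_and] at hne
      omega
    rw [hS, mem_top] at hi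
    refine absurd hi (not_lt.2 (h24.trans ?_))
    rw [← card_union_of_disjoint hdisj]
    refine card_le_card fun j hj => ?_
    simp only [hM, hQ, mem_union, mem_filter, mem_univ, true_and] at hj ⊢
    left
    exact score_lt_of_class hu (by omega)
  have hMS : M ⊆ S := by
    intro i hi
    refine mem_top_of_class hu hc (le_trans (card_le_card fun j hj => ?_) h4)
    have := hc j
    simp only [hM, mem_filter, mem_univ, true_and] at hi hj ⊢
    omega
  have h1 : S = M ∪ (Q ∩ S) := by
    ext i
    have := @hSM i
    have := @hMS i
    simp only [mem_union, mem_inter] at *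
    tauto
  have h2 : S.card = M.card + (Q ∩ S).card := by
    conv_lhs => rw [h1]
    exact card_union_of_disjoint (hdisj.mono_right inter_subset_left)
  have h3 := card_sdiff_add_card_inter Q S
  have h5 : S.card = k := card_top hkn _
  omega

theorem noise_comp_swap (ω : Coins) (i j a : Fin n) :
    noise n (fun b => ω (Equiv.swap (i : ℕ) j b)) a = noise n ω (Equiv.swap i j a) := by
  unfold noise
  congr 2
  rcases eq_or_ne a i with rfl | hi
  · simp
  rcases eq_or_ne a j with rfl | hj
  · simp
  change ω (Equiv.swap (i : ℕ) j a) = _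
  rw [Equiv.swap_apply_of_ne_of_ne hi hj, Equiv.swap_apply_of_ne_of_ne
    (by simpa [Fin.ext_iff] using hi) (by simpa [Fin.ext_iff] using hj)]

theorem ae_injective_noise (n : ℕ) : ∀ᵐ ω ∂coinMeasure, Function.Injective (noise n ω) := by
  have : ∀ᵐ ω ∂coinMeasure, ∀ i j : Fin n, i ≠ j → ω i ≠ ω j := by
    rw [ae_all_iff]
    intro i
    rw [ae_all_iff]
    intro j
    by_cases hij : i = j
    · simp [hij]
    · filter_upwards [ae_ne (i := i) (j := j) (by simpa [Fin.ext_iff] using hij)] with ω hω _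
      exact hω
  filter_upwards [this] with ω hω i j h
  by_contra hij
  exact hω i j hij (Subtype.ext h)

open Classical in
/-- Probability that a formerly marked page is missing. -/
theorem integral_fault_le (hk : 1 ≤ k) (hkn : k ≤ n) (l : ℕ) {t : ℕ}
    (hcard : (formerlyMarked k r t).card = k)
    (h1 : r (t + 1) ∈ formerlyMarked k r t) (h2 : r (t + 1) ∉ marked k r t) :
    ∫ ω, rowCost k l r (noise n ω) 0 (t + 1) ∂coinMeasure ≤
      (marked k r t \ formerlyMarked k r t).card /
        ((k : ℝ) - (marked k r t ∩ formerlyMarked k r t).card) := by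
  set c := markClass k r t with hc
  set Q := univ.filter fun j => c j = 2 with hQ
  have hcases := markClass_cases k r t
  have hQeq : Q = formerlyMarked k r t \ marked k r t := by
    ext j
    simp [hQ, hc, markClass_eq_two_iff]
  set out : Fin n → Coins → ℝ := fun i ω =>
    if i ∈ top k (score c 1 (noise n ω)) then 0 else 1 with hout
  have hcache : ∀ ω : Coins, rowCache k l r (noise n ω) 0 t = top k (score c 1 (noise n ω)) :=
    fun ω => by simp [rowCache, rowCounts, rowScale, hc]
  have houtt : ∀ i, Tame (out i) := fun i =>
    Tame.of_mem_Icc (c := 1) (Measurable.ite (by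
      have := measurableSet_mem_rowCache (k := k) (l := l) (r := r) i 0 t
      simpa only [hcache] using this) measurable_const measurable_const)
      fun ω => by simp only [hout]; split_ifs <;> norm_num
  have hleft : ∫ ω, rowCost k l r (noise n ω) 0 (t + 1) ∂coinMeasure =
      ∫ ω, out (r (t + 1)) ω ∂coinMeasure := by
    refine integral_congr_ae (ae_of_all _ fun ω => ?_)
    simp [rowCost, hcache, hout]
  have hrQ : r (t + 1) ∈ Q := by rw [hQeq, mem_sdiff]; exact ⟨h1, h2⟩
  -- Exchanging the priorities of two pages of the middle class preserves the law and exchanges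
  -- their ranks, so all of `Q` is missing with equal probability.
  have hsym : ∀ i ∈ Q, ∫ ω, out i ω ∂coinMeasure = ∫ ω, out (r (t + 1)) ω ∂coinMeasure := by
    intro i hi
    rw [← integral_comp_perm (houtt (r (t + 1))) (Equiv.swap (i : ℕ) (r (t + 1) : ℕ))]
    refine integral_congr_ae ?_
    filter_upwards [ae_injective_noise n] with ω hω
    have hs : score c 1 (noise n fun b => ω (Equiv.swap (i : ℕ) (r (t + 1) : ℕ) b)) =
        score c 1 (noise n ω) ∘ Equiv.swap i (r (t + 1)) := by
      ext a
      have hca : c (Equiv.swap i (r (t + 1)) a) = c a := by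
        simp only [hQ, mem_filter, mem_univ, true_and] at hi hrQ
        rcases eq_or_ne a i with rfl | hai
        · rw [Equiv.swap_apply_left, hi, hrQ]
        rcases eq_or_ne a (r (t + 1)) with rfl | haj
        · rw [Equiv.swap_apply_right, hi, hrQ]
        rw [Equiv.swap_apply_of_ne_of_ne hai haj]
      simp only [Function.comp, score, noise_comp_swap, hca]
    simp only [hout, hs, mem_top]
    rw [rank_comp_perm (score_injective (noise_mem ω) hcases hω), Equiv.swap_apply_right]
  have hMcard : (univ.filter fun j => c j = 4).card ≤ k := card_marked_le hk r t
  have hM1 := card_sdiff_add_card_inter (marked k r t) (formerlyMarked k r t)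
  have hM2 := card_sdiff_add_card_inter (formerlyMarked k r t) (marked k r t)
  rw [inter_comm, ← hQeq, hcard] at hM2
  have hMdef : (univ.filter fun j => c j = 4) = marked k r t := rfl
  -- The number of missing pages of `Q` is not random: every newly marked page has displaced one of
  -- them.
  have hsum : ∀ ω, ∑ i ∈ Q, out i ω = (marked k r t \ formerlyMarked k r t).card := by
    intro ω
    have h3 := card_middle_sdiff_top (c := c) hkn (noise_mem ω) hcases hMcard
      (by rw [hMdef, ← hQ]; omega)
    rw [hMdef, ← hQ] at h3
    have h4 : (Q \ top k (score c 1 (noise n ω))).card =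
        (marked k r t \ formerlyMarked k r t).card := by omega
    rw [← h4]
    simp only [hout]
    rw [sum_ite, sum_const_zero, zero_add, sum_const, nsmul_eq_mul, mul_one]
    congr 2
    ext j
    simp
  have hQpos : 0 < Q.card := card_pos.2 ⟨_, hrQ⟩
  have hQr : ((k : ℝ) - (marked k r t ∩ formerlyMarked k r t).card) = Q.card := by
    rw [sub_eq_iff_eq_add]; exact_mod_cast hM2.symm
  rw [hleft, hQr, le_div_iff₀ (by exact_mod_cast hQpos)]
  have h5 : ∫ ω, ∑ i ∈ Q, out i ω ∂coinMeasure =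
      (marked k r t \ formerlyMarked k r t).card := by
    simp [hsum]
  rw [integral_finsetSum _ fun i _ => (houtt i).integrable, sum_congr rfl hsym, sum_const,
    nsmul_eq_mul] at h5
  linarith

/-- A page that is new to the union was either just fetched or is the request, missed by the offline
cache. Thus the growth of `P ∪ C` bounds the offline cost from below. -/
theorem card_insert_union_le (i : Fin n) (P C D : Finset (Fin n)) :
    ((insert i P ∪ C).card : ℝ) ≤ (P ∪ D).card + roundCost i C D := by
  classical
  have hsub : insert i P ∪ C ⊆ (P ∪ D) ∪ ((C \ D) ∪ (({i} : Finset (Fin n)) \ C)) := by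
    intro j hj
    simp only [mem_union, mem_insert, mem_sdiff, mem_singleton] at *
    tauto
  have h1 := (card_le_card hsub).trans ((card_union_le _ _).trans
    (Nat.add_le_add_left (card_union_le _ _) _))
  have h2 : ((({i} : Finset (Fin n)) \ C).card : ℝ) ≤ missLoss i C := by
    unfold missLoss
    split_ifs with h
    · simp [h]
    · have : (({i} : Finset (Fin n)) \ C).card ≤ 1 := by
        simpa using card_le_card (sdiff_subset (s := ({i} : Finset (Fin n))) (t := C))
      have : ((({i} : Finset (Fin n)) \ C).card : ℝ) ≤ 1 := by exact_mod_cast this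
      linarith
  have h3 : ((insert i P ∪ C).card : ℝ) ≤
      (P ∪ D).card + ((C \ D).card + (({i} : Finset (Fin n)) \ C).card) := by exact_mod_cast h1
  unfold roundCost moveCost
  linarith

/-- Potential for the expected number of faults in a phase with `a` new and `s` old marked pages. -/
noncomputable def phasePotential (k a s : ℕ) : ℝ :=
  a * (1 + harmonic k - harmonic (k - s))

theorem harmonic_mono {a b : ℕ} (h : a ≤ b) : harmonic a ≤ harmonic b := by
  unfold harmonic
  exact sum_le_sum_of_subset_of_nonneg (range_subset_range.2 h) fun _ _ _ => by positivity

theorem harmonic_mono_real {a b : ℕ} (h : a ≤ b) : (harmonic a : ℝ) ≤ harmonic b := by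
  exact_mod_cast harmonic_mono h

theorem one_le_harmonic {a : ℕ} (h : 1 ≤ a) : (1 : ℝ) ≤ harmonic a := by
  have := harmonic_mono_real h
  simpa [harmonic] using this

/-- As long as some page of the phase is new, `k - s ≥ 1` and the harmonic number subtracted is at
least `1`. -/
theorem phasePotential_le {a s : ℕ} (h : a + s ≤ k) :
    phasePotential k a s ≤ a * harmonic k := by
  unfold phasePotential
  rcases Nat.eq_zero_or_pos a with rfl | ha
  · simp
  · have := one_le_harmonic (a := k - s) (by omega)
    gcongr
    linarith

/-- A new page may cost a full fault, and `a` is multiplied by at least `1`. -/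
theorem phasePotential_new (a s : ℕ) :
    phasePotential k a s + 1 ≤ phasePotential k (a + 1) s := by
  have := harmonic_mono_real (Nat.sub_le k s)
  unfold phasePotential
  push_cast
  nlinarith

/-- Since `H_{k-s} - H_{k-s-1} = 1 / (k - s)`, the potential grows by exactly the fault bound of
`integral_fault_le`. -/
theorem phasePotential_old {a s : ℕ} (hs : s < k) :
    phasePotential k a s + a / ((k : ℝ) - s) = phasePotential k a (s + 1) := by
  obtain ⟨d, rfl⟩ : ∃ d, k = s + 1 + d := ⟨k - (s + 1), by omega⟩
  have h1 : s + 1 + d - s = d + 1 := by omega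
  have h2 : s + 1 + d - (s + 1) = d := by omega
  unfold phasePotential
  rw [h1, h2, harmonic_succ]
  push_cast
  have : (s : ℝ) + 1 + d - s = d + 1 := by ring
  rw [this]
  ring

theorem integral_rowCost_zero_le_one (k l : ℕ) (r : ℕ → Fin n) (t : ℕ) :
    ∫ ω, rowCost k l r (noise n ω) 0 t ∂coinMeasure ≤ 1 := by
  refine (integral_mono (tame_rowCost 0 t).integrable (integrable_const 1)
    fun ω => rowCost_zero_le t).trans_eq ?_
  simp

/-- The marking algorithm against caches that may change. -/
theorem marking_competitive (hk : 1 ≤ k) (hkn : k ≤ n) (l : ℕ) {C : ℕ → Finset (Fin n)} {T : ℕ}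
    (hC : ∀ t ≤ T, (C t).card = k) :
    ∑ t ∈ Ioc 0 T, ∫ ω, rowCost k l r (noise n ω) 0 t ∂coinMeasure ≤
      harmonic k * (2 * ∑ t ∈ Ioc 0 T, roundCost (r t) (C t) (C (t - 1)) + k) := by
  classical
  -- `N` counts the new pages of the completed phases after the first one, and the first phase with
  -- all its `k` pages; the latter is the summand `k` on the right. The excesses over `k` of `M ∪ O
  -- ∪ C` and of `M ∪ C` each grow by at most the offline cost of a round, whence the factor two.
  -- The first alternative describes the first phase.
  have key : ∃ N : ℝ, ∑ t ∈ Ioc 0 T, ∫ ω, rowCost k l r (noise n ω) 0 t ∂coinMeasure ≤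
        harmonic k * N + phasePotential k (marked k r T \ formerlyMarked k r T).card
          (marked k r T ∩ formerlyMarked k r T).card ∧
      ((formerlyMarked k r T = ∅ ∧ N = 0 ∧ ((marked k r T ∪ C T).card : ℝ) - k ≤
          ∑ t ∈ Ioc 0 T, roundCost (r t) (C t) (C (t - 1))) ∨
        ((formerlyMarked k r T).card = k ∧
          N + (((marked k r T ∪ formerlyMarked k r T) ∪ C T).card - k) +
            ((marked k r T ∪ C T).card - k) ≤
          2 * ∑ t ∈ Ioc 0 T, roundCost (r t) (C t) (C (t - 1)) + k)) := by
    induction T with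
    | zero =>
      refine ⟨0, by simp [marked_zero, phasePotential], Or.inl ⟨rfl, rfl, ?_⟩⟩
      simp [marked_zero, hC 0 le_rfl]
    | succ t ih =>
      obtain ⟨N, h1, h2⟩ := ih fun s hs => hC s (by omega)
      rw [sum_Ioc_succ_top (Nat.zero_le t), sum_Ioc_succ_top (Nat.zero_le t), Nat.add_sub_cancel]
      set i := r (t + 1) with hi
      set M := marked k r t with hM
      set O := formerlyMarked k r t with hO
      have hMk : M.card ≤ k := card_marked_le hk r t
      have hgrow : ∀ P : Finset (Fin n), ((insert i P ∪ C (t + 1)).card : ℝ) ≤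
          (P ∪ C t).card + roundCost i (C (t + 1)) (C t) := fun P =>
        card_insert_union_le _ _ _ _
      by_cases hfull : i ∈ M ∨ M.card < k
      · have hO' : formerlyMarked k r (t + 1) = O := by rw [formerlyMarked, if_pos hfull]
        have hM' : marked k r (t + 1) = insert i M := by
          by_cases hmem : i ∈ M
          · rw [marked_succ_of_mem hmem, insert_eq_of_mem hmem]
          · exact marked_succ_of_lt hmem (hfull.resolve_left hmem)
        rw [hO', hM']
        refine ⟨N, ?_, ?_⟩
        · suffices h : ∫ ω, rowCost k l r (noise n ω) 0 (t + 1) ∂coinMeasure +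
              phasePotential k (M \ O).card (M ∩ O).card ≤
              phasePotential k (insert i M \ O).card (insert i M ∩ O).card by linarith
          by_cases hmem : i ∈ M
          · have h0 : ∫ ω, rowCost k l r (noise n ω) 0 (t + 1) ∂coinMeasure = 0 := by
              refine integral_eq_zero_of_ae (ae_of_all _ fun ω => ?_)
              have := mem_rowCache_zero_of_marked (l := l) hk (noise_mem ω) (mem_marked.1 hmem)
              simp [rowCost, this, ← hi]
            rw [insert_eq_of_mem hmem, h0, zero_add]
          · by_cases hiO : i ∈ O
            · have hcard : O.card = k := by
                rcases h2 with h2 | h2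
                · rw [h2.1] at hiO; exact absurd hiO (notMem_empty _)
                · exact h2.1
              have hf := integral_fault_le hk hkn l hcard hiO hmem
              rw [insert_sdiff_of_mem _ hiO, insert_inter_of_mem hiO,
                card_insert_of_notMem (by simp [hmem])]
              have hlt : (M ∩ O).card < k :=
                (card_le_card inter_subset_left).trans_lt (hfull.resolve_left hmem)
              rw [← phasePotential_old hlt]
              linarith
            · rw [insert_sdiff_of_notMem _ hiO, insert_inter_of_notMem hiO,
                card_insert_of_notMem (by simp [hmem])]
              have := phasePotential_new (k := k) (M \ O).card (M ∩ O).card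
              have := integral_rowCost_zero_le_one k l r (t + 1)
              linarith
        · rcases h2 with ⟨e1, e2, e3⟩ | ⟨e1, e2⟩
          · exact Or.inl ⟨e1, e2, by linarith [hgrow M]⟩
          · refine Or.inr ⟨e1, ?_⟩
            have := hgrow (M ∪ O)
            rw [insert_union]
            linarith [hgrow M]
      -- Phase change: the excess of `M ∪ O ∪ C` pays for the new pages of the phase just ended, the
      -- excess of `M ∪ C` becomes the next one of the former kind, and that of `{i} ∪ C` starts
      -- from zero plus the current offline cost.
      · rw [not_or] at hfull
        obtain ⟨hmem, hcard⟩ := hfull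
        have hMc : M.card = k := by omega
        have hO' : formerlyMarked k r (t + 1) = M := by
          rw [formerlyMarked, if_neg (by tauto)]
        have hM' : marked k r (t + 1) = {i} := marked_succ_of_full hmem hcard
        rw [hO', hM']
        have hsplit := card_sdiff_add_card_inter M O
        have hpot : phasePotential k ({i} \ M : Finset (Fin n)).card
            ({i} ∩ M : Finset (Fin n)).card = 1 := by
          rw [singleton_inter_of_notMem hmem, sdiff_eq_self_of_disjoint (by simpa using hmem)]
          simp [phasePotential]
        refine ⟨N + (M \ O).card, ?_, Or.inr ⟨hMc, ?_⟩⟩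
        · rw [hpot]
          have := phasePotential_le (k := k) (a := (M \ O).card) (s := (M ∩ O).card) (by omega)
          have := integral_rowCost_zero_le_one k l r (t + 1)
          linarith
        · have g1 := hgrow M
          have g2 := hgrow ∅
          rw [insert_empty_eq, empty_union, hC t (by omega)] at g2
          rw [singleton_union]
          rcases h2 with ⟨e1, e2, e3⟩ | ⟨e1, e2⟩
          · have : ((M \ O).card : ℝ) = k := by rw [e1, sdiff_empty, hMc]
            have := sum_nonneg fun s (_ : s ∈ Ioc 0 t) => roundCost_nonneg (r s) (C s) (C (s - 1))
            linarith
          · have : (M \ O).card + O.card ≤ ((M ∪ O) ∪ C t).card := by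
              rw [card_sdiff_add_card]
              exact card_le_card subset_union_left
            have : ((M \ O).card : ℝ) + k ≤ ((M ∪ O) ∪ C t).card := by
              rw [← e1]; exact_mod_cast this
            linarith
  obtain ⟨N, h1, h2⟩ := key
  set M := marked k r T with hM
  set O := formerlyMarked k r T with hO
  have hMk : M.card ≤ k := card_marked_le hk r T
  have hsplit := card_sdiff_add_card_inter M O
  have hpot := phasePotential_le (k := k) (a := (M \ O).card) (s := (M ∩ O).card) (by omega)
  have hH : (0 : ℝ) ≤ harmonic k := zero_le_one.trans (one_le_harmonic hk)
  have hbound : N + (M \ O).card ≤ 2 * ∑ t ∈ Ioc 0 T, roundCost (r t) (C t) (C (t - 1)) + k := by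
    have hnn := sum_nonneg fun s (_ : s ∈ Ioc 0 T) => roundCost_nonneg (r s) (C s) (C (s - 1))
    rcases h2 with ⟨e1, e2, e3⟩ | ⟨e1, e2⟩
    · have : ((M \ O).card : ℝ) ≤ k := by exact_mod_cast (by omega : (M \ O).card ≤ k)
      linarith
    · have g1 : (M \ O).card + O.card ≤ ((M ∪ O) ∪ C T).card := by
        rw [card_sdiff_add_card]
        exact card_le_card subset_union_left
      have g2 : ((M \ O).card : ℝ) + k ≤ ((M ∪ O) ∪ C T).card := by
        rw [← e1]; exact_mod_cast g1
      have g3 : (k : ℝ) ≤ (M ∪ C T).card := by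
        rw [← hC T le_rfl]; exact_mod_cast card_le_card subset_union_right
      linarith
  have := mul_le_mul_of_nonneg_left hbound hH
  linarith

end Marking

end Paging

namespace Paging

open Finset

/-! ### Reasoning about programs -/

section Runs

variable {ω : Coins} {p q : Program} {s s' : State} {B B' : ℕ} {Q R : State → Prop}

/-- The program halts within `B` steps in a memory that satisfies `Q`. -/
def Runs (ω : Coins) (p : Program) (s : State) (B : ℕ) (Q : State → Prop) : Prop :=
  ∃ τ s', Exec ω p s τ s' ∧ τ ≤ B ∧ Q s'

theorem Runs.mono (h : Runs ω p s B R) (hB : B ≤ B') (hQ : ∀ s', R s' → Q s') :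
    Runs ω p s B' Q := by
  obtain ⟨τ, s', h1, h2, h3⟩ := h
  exact ⟨τ, s', h1, h2.trans hB, hQ s' h3⟩

theorem Runs.le (h : Runs ω p s B Q) (hB : B ≤ B') : Runs ω p s B' Q :=
  h.mono hB fun _ h => h

theorem Runs.skip (h : Q s) : Runs ω .skip s 1 Q := ⟨1, s, .skip s, le_rfl, h⟩

theorem Runs.natSet {a : ℕ} {i e : NExp} (h : Q (s.setNat a (i.eval s) (e.eval s))) :
    Runs ω (.natSet a i e) s (i.cost + e.cost + 1) Q :=
  ⟨_, _, .natSet s a i e, le_rfl, h⟩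

theorem Runs.realSet {a : ℕ} {i : NExp} {x : RExp} (h : Q (s.setReal a (i.eval s) (x.eval s))) :
    Runs ω (.realSet a i x) s (i.cost + x.cost + 1) Q :=
  ⟨_, _, .realSet s a i x, le_rfl, h⟩

theorem Runs.sample {a : ℕ} {i : NExp}
    (h : Q { s.setReal a (i.eval s) (ω s.drawn : ℝ) with drawn := s.drawn + 1 }) :
    Runs ω (.sample a i) s (i.cost + 1) Q :=
  ⟨_, _, .sample s a i, le_rfl, h⟩

theorem Runs.seq (h₁ : Runs ω p s B R) (h₂ : ∀ s', R s' → Runs ω q s' B' Q) :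
    Runs ω (.seq p q) s (B + B') Q := by
  obtain ⟨τ, s₁, e1, l1, r1⟩ := h₁
  obtain ⟨τ', s₂, e2, l2, r2⟩ := h₂ s₁ r1
  exact ⟨_, s₂, .seq e1 e2, add_le_add l1 l2, r2⟩

theorem Runs.natSet_seq {a : ℕ} {i e : NExp}
    (h : Runs ω q (s.setNat a (i.eval s) (e.eval s)) B Q) :
    Runs ω (.seq (.natSet a i e) q) s (i.cost + e.cost + 1 + B) Q :=
  (Runs.natSet (Q := fun s' => s' = _) rfl).seq fun _ hs => hs ▸ h

theorem Runs.realSet_seq {a : ℕ} {i : NExp} {x : RExp}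
    (h : Runs ω q (s.setReal a (i.eval s) (x.eval s)) B Q) :
    Runs ω (.seq (.realSet a i x) q) s (i.cost + x.cost + 1 + B) Q :=
  (Runs.realSet (Q := fun s' => s' = _) rfl).seq fun _ hs => hs ▸ h

theorem Runs.sample_seq {a : ℕ} {i : NExp}
    (h : Runs ω q { s.setReal a (i.eval s) (ω s.drawn : ℝ) with drawn := s.drawn + 1 } B Q) :
    Runs ω (.seq (.sample a i) q) s (i.cost + 1 + B) Q :=
  (Runs.sample (Q := fun s' => s' = _) rfl).seq fun _ hs => hs ▸ h

theorem Runs.cond {b : BExp} (h₁ : b.holds s → Runs ω p s B Q)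
    (h₂ : ¬ b.holds s → Runs ω q s B' Q) :
    Runs ω (.cond b p q) s (b.cost + max B B' + 1) Q := by
  by_cases h : b.holds s
  · obtain ⟨τ, s', e, l, r⟩ := h₁ h
    exact ⟨_, s', .condTrue h e, by have := le_max_left B B'; omega, r⟩
  · obtain ⟨τ, s', e, l, r⟩ := h₂ h
    exact ⟨_, s', .condFalse h e, by have := le_max_right B B'; omega, r⟩

/-- A loop whose test stays true for exactly `N` iterations. -/
theorem Runs.loop {b : BExp} {N : ℕ} (I : ℕ → State → Prop) (h₀ : I 0 s)
    (hb : ∀ i ≤ N, ∀ s, I i s → (b.holds s ↔ i < N))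
    (hstep : ∀ i < N, ∀ s, I i s → Runs ω p s B (I (i + 1))) (hQ : ∀ s, I N s → Q s) :
    Runs ω (.loop b p) s (N * (b.cost + B + 1) + (b.cost + 1)) Q := by
  suffices h : ∀ d i s, i + d = N → I i s →
      Runs ω (.loop b p) s (d * (b.cost + B + 1) + (b.cost + 1)) Q from h N 0 s (by omega) h₀
  intro d
  induction d with
  | zero =>
    intro i s hi hI
    obtain rfl : i = N := by omega
    exact ⟨_, s, .loopDone fun h => lt_irrefl _ ((hb i le_rfl s hI).1 h), by omega, hQ s hI⟩
  | succ d ih =>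
    intro i s hi hI
    obtain ⟨τ, s₁, e1, l1, r1⟩ := hstep i (by omega) s hI
    obtain ⟨τ', s₂, e2, l2, r2⟩ := ih (i + 1) s₁ (by omega) r1
    refine ⟨_, s₂, .loopStep ((hb i (by omega) s hI).2 (by omega)) e1 e2, ?_, r2⟩
    rw [add_mul, one_mul]
    omega

end Runs

/-! ### Reading memory after a write. -/

section Memory

variable (s : State)

@[simp] theorem State.nat_setNat (a i v b j : ℕ) :
    (s.setNat a i v).nat b j = if b = a ∧ j = i then v else s.nat b j := by
  unfold State.setNat
  by_cases h : b = a
  · subst h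
    by_cases h' : j = i <;> simp [h']
  · simp [h]

@[simp] theorem State.real_setNat (a i v : ℕ) : (s.setNat a i v).real = s.real := rfl

@[simp] theorem State.drawn_setNat (a i v : ℕ) : (s.setNat a i v).drawn = s.drawn := rfl

@[simp] theorem State.real_setReal (a i : ℕ) (v : ℝ) (b j : ℕ) :
    (s.setReal a i v).real b j = if b = a ∧ j = i then v else s.real b j := by
  unfold State.setReal
  by_cases h : b = a
  · subst h
    by_cases h' : j = i <;> simp [h']
  · simp [h]

@[simp] theorem State.nat_setReal (a i : ℕ) (v : ℝ) : (s.setReal a i v).nat = s.nat := rfl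

@[simp] theorem State.drawn_setReal (a i : ℕ) (v : ℝ) : (s.setReal a i v).drawn = s.drawn := rfl

theorem State.eq_of {s s' : State} (h₁ : ∀ a i, s.nat a i = s'.nat a i)
    (h₂ : ∀ a i, s.real a i = s'.real a i) (h₃ : s.drawn = s'.drawn) : s = s' := by
  cases s; cases s'
  simp only [State.mk.injEq]
  exact ⟨funext fun a => funext (h₁ a), funext fun a => funext (h₂ a), h₃⟩

end Memory

/-! ### The program -/

/-- A scalar variable: cell `0` of the array `a`. -/
def nvar (a : ℕ) : NExp := .get a (.lit 0)

/-- Assignment to a scalar variable. -/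
def nset (a : ℕ) (e : NExp) : Program := .natSet a (.lit 0) e

/-- A real scalar variable: cell `0` of the array `a`. -/
def rvar (a : ℕ) : RExp := .get a (.lit 0)

/-- Assignment to a real scalar variable. -/
def rset (a : ℕ) (x : RExp) : Program := .realSet a (.lit 0) x

/-- The number of pages, the cache size, the time horizon, the requested page. -/
def pagesE : NExp := .get 0 (.lit 0)
def sizeE : NExp := .get 0 (.lit 1)
def horizonE : NExp := .get 0 (.lit 2)
def requestE : NExp := .get 0 (.lit 3)

/-- Cell of a page in the table of counts of a row. -/
def cellE (row page : NExp) : NExp := .add (.mul row pagesE) page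

/-- Score of a page in the row held by variable `13`. -/
def scoreE (page : NExp) : RExp :=
  .add (.ofNat (.get 2 (cellE (nvar 13) page))) (.mul (.ofNat (.get 3 (nvar 13))) (.get 0 page))

/-- Does the page in variable `12` precede the page in variable `14`? -/
def precedesE : BExp :=
  -- A disjunction written with `not` and `and`, the only connectives of tests.
  .not (.and (.not (.realLt (scoreE (nvar 14)) (scoreE (nvar 12))))
    (.not (.and (.not (.realLt (scoreE (nvar 12)) (scoreE (nvar 14)))) (.natLt (nvar 12) (nvar 14)))))

/-- Put the rank of the page in variable `14` in the row in variable `13` into variable `9`. -/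
def rankP : Program :=
  .seq (nset 9 (.lit 0)) <| .seq (nset 12 (.lit 0)) <|
    .loop (.natLt (nvar 12) pagesE) <|
      .seq (.cond precedesE (nset 9 (.add (nvar 9) (.lit 1))) .skip)
        (nset 12 (.add (nvar 12) (.lit 1)))

/-- The round of the marking algorithm: its cost and its new page classes. -/
def markP : Program :=
  -- The rank is taken before the classes change, since the cost refers to the cache of the
  -- preceding round.
  .seq (nset 13 (.lit 0)) <| .seq (nset 14 requestE) <| .seq rankP <|
  .seq (.cond (.natLt (nvar 9) sizeE) (rset 3 (.ofNat (.lit 0))) (rset 3 (.ofNat (.lit 1)))) <|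
  .cond (.natLt (.get 2 requestE) (.lit 4))
    (.cond (.natLt (nvar 7) sizeE)
      (.seq (.natSet 2 requestE (.lit 4)) (nset 7 (.add (nvar 7) (.lit 1))))
      (.seq (nset 8 (.lit 0)) <|
        .seq (.loop (.natLt (nvar 8) pagesE) <|
          .seq (.natSet 2 (nvar 8) (.sub (.get 2 (nvar 8)) (.lit 2)))
            (nset 8 (.add (nvar 8) (.lit 1)))) <|
        .seq (.natSet 2 requestE (.lit 4)) (nset 7 (.lit 1))))
    .skip

/-- The new counts and the cost of the row in variable `10`. -/
def countP : Program :=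
  -- Array `5` holds the age of each row within its block; age zero means that this round restarts
  -- the row.
  .cond (.natLt (.get 5 (nvar 10)) (.lit 1))
    (.seq (rset 6 (.ofNat (.add sizeE (.lit 2)))) <|
      .seq (rset 7 (.ofNat (.mul (.lit 5) sizeE))) <|
      .seq (nset 8 (.lit 0)) <|
      .loop (.natLt (nvar 8) pagesE) <|
        .seq (.natSet 2 (cellE (nvar 10) (nvar 8)) (.lit 0)) (nset 8 (.add (nvar 8) (.lit 1))))
    (.seq (.cond (.natLt (nvar 9) sizeE) (rset 6 (.ofNat (.lit 0))) (rset 6 (.ofNat (.lit 2)))) <|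
      .seq (rset 7 (.ofNat (.lit 3))) <|
      .natSet 2 (cellE (nvar 10) requestE)
        (.add (.get 2 (cellE (nvar 10) requestE)) (.lit 1)))

/-- One as a real number. -/
def oneE : RExp := .ofNat (.lit 1)

/-- The new weight of the row in variable `10`. -/
def weightP : Program :=
  .seq (rset 8 (.sub (.sub (rvar 3) (rvar 6))
    (.mul (.div oneE (.ofNat (.mul (.lit 10) (.get 3 (nvar 10))))) (rvar 7)))) <|
  .seq (rset 9 (.div (.get 2 (nvar 10)) (.sub oneE (.mul
    (.div oneE (.ofNat (.mul (.mul (.lit 10) sizeE) (.get 3 (nvar 10))))) (rvar 8))))) <|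
  .seq (.cond (.realLt (rvar 9) (rvar 5)) (.realSet 2 (nvar 10) (rvar 5))
    (.cond (.realLt oneE (rvar 9)) (.realSet 2 (nvar 10) oneE) (.realSet 2 (nvar 10) (rvar 9)))) <|
  -- Real variable `3` carries the cost of the current level from one row to the next.
  rset 3 (.sub (rvar 3) (.mul (.get 2 (nvar 10)) (rvar 8)))

/-- Select the row in variable `10` if its threshold tells so; advance its age. -/
def selectP : Program :=
  .seq (.cond (.realLt (.get 1 (nvar 10)) (.get 2 (nvar 10))) (nset 11 (nvar 10)) .skip) <|
  .cond (.natLt (.add (.get 5 (nvar 10)) (.lit 1)) (.get 4 (nvar 10)))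
    (.natSet 5 (nvar 10) (.add (.get 5 (nvar 10)) (.lit 1)))
    (.natSet 5 (nvar 10) (.lit 0))

/-- The round of the row in variable `10`. -/
def rowP : Program :=
  .seq (nset 13 (nvar 10)) <| .seq (nset 14 requestE) <| .seq rankP <|
  .seq countP <| .seq weightP selectP

/-- The rounds of all rows. -/
def rowsP : Program :=
  .seq (nset 11 (.lit 0)) <| .seq (nset 10 (.lit 1)) <|
  .loop (.natLt (nvar 10) (.add (nvar 6) (.lit 1))) <|
    .seq rowP (nset 10 (.add (nvar 10) (.lit 1)))

/-- Write the cache of the selected row. -/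
def outputP : Program :=
  .seq (nset 13 (nvar 11)) <| .seq (nset 14 (.lit 0)) <|
  .loop (.natLt (nvar 14) pagesE) <|
    .seq rankP <|
    .seq (.cond (.natLt (nvar 9) sizeE) (.natSet 1 (nvar 14) (.lit 1)) (.natSet 1 (nvar 14) (.lit 0)))
      (nset 14 (.add (nvar 14) (.lit 1)))

/-- Number of rows and least weight. -/
def initSizeP : Program :=
  .seq (nset 6 (.lit 0)) <| .seq (nset 15 (.lit 1)) <|
  -- Doubling until `n * T` is reached leaves `l = Nat.clog 2 (n * T)` in variable `6` and `2 ^ l`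
  -- in variable `15`.
  .seq (.loop (.natLt (nvar 15) (.mul pagesE horizonE))
    (.seq (nset 15 (.add (nvar 15) (nvar 15))) (nset 6 (.add (nvar 6) (.lit 1))))) <|
  rset 5 (.div oneE (.ofNat (.mul (nvar 15) (nvar 15))))

/-- All random samples. -/
def initSampleP : Program :=
  .seq (nset 8 (.lit 0)) <|
  .seq (.loop (.natLt (nvar 8) pagesE)
    (.seq (.sample 0 (nvar 8)) (nset 8 (.add (nvar 8) (.lit 1))))) <|
  .seq (nset 8 (.lit 0)) <|
  -- The threshold in cell `0` never decides anything; drawing it makes cell `a` hold sample `n +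
  -- a`.
  .loop (.natLt (nvar 8) (.add (nvar 6) (.lit 1)))
    (.seq (.sample 1 (nvar 8)) (.seq (.realSet 2 (nvar 8) (rvar 5)) (nset 8 (.add (nvar 8) (.lit 1)))))

/-- Noise sizes and block lengths. -/
def initScaleP : Program :=
  .seq (nset 15 (.lit 1)) <| .seq (nset 16 (nvar 6)) <| .seq (nset 8 (.lit 0)) <|
  .seq (.loop (.natLt (nvar 8) (nvar 6))
    (.seq (.natSet 3 (.sub (nvar 6) (nvar 8)) (nvar 15)) <|
      .seq (.natSet 4 (.sub (nvar 6) (nvar 8)) (nvar 16)) <|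
      .seq (nset 15 (.add (nvar 15) (nvar 15))) <|
      .seq (nset 16 (.mul (nvar 16) (.lit 4))) (nset 8 (.add (nvar 8) (.lit 1))))) <|
  -- The last write sets the flag that prevents a second initialization.
  .seq (.natSet 3 (.lit 0) (.lit 1)) (.natSet 0 (.lit 4) (.lit 1))

/-- The paging algorithm. -/
def pagingP : Program :=
  .seq (.cond (.natLt (.get 0 (.lit 4)) (.lit 1))
    (.seq initSizeP (.seq initSampleP initScaleP)) .skip) <|
  .seq markP (.seq rowsP outputP)

/-! ### Correctness of the parts -/

section Parts

variable {n : ℕ} {ω : Coins}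

theorem card_filter_lt_succ (P : Fin n → Prop) [DecidablePred P] (i : ℕ) (hi : i < n) :
    (univ.filter fun j : Fin n => (j : ℕ) < i + 1 ∧ P j).card =
      (univ.filter fun j : Fin n => (j : ℕ) < i ∧ P j).card + if P ⟨i, hi⟩ then 1 else 0 := by
  split_ifs with h
  · rw [← card_insert_of_notMem (a := (⟨i, hi⟩ : Fin n)) (by simp)]
    congr 1
    ext j
    simp only [mem_filter, mem_univ, true_and, mem_insert, Fin.ext_iff]
    constructor
    · rintro ⟨h1, h2⟩
      by_cases hj : (j : ℕ) = i
      · exact Or.inl hj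
      · exact Or.inr ⟨by omega, h2⟩
    · rintro (h1 | ⟨h1, h2⟩)
      · obtain rfl : j = ⟨i, hi⟩ := Fin.ext h1
        exact ⟨by simp, h⟩
      · exact ⟨by omega, h2⟩
  · rw [add_zero]
    congr 1
    ext j
    simp only [mem_filter, mem_univ, true_and]
    refine ⟨fun ⟨h1, h2⟩ => ⟨?_, h2⟩, fun ⟨h1, h2⟩ => ⟨by omega, h2⟩⟩
    by_contra hj
    obtain rfl : j = ⟨i, hi⟩ := Fin.ext (show (j : ℕ) = i by omega)
    exact h h2

theorem runs_rankP {s : State} {c : Fin n → ℕ} {h : ℕ} {u : Fin n → ℝ} {p : Fin n}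
    (hn : s.nat 0 0 = n) (hc : ∀ i : Fin n, s.nat 2 (s.nat 13 0 * n + i) = c i)
    (hh : s.nat 3 (s.nat 13 0) = h) (hu : ∀ i : Fin n, s.real 0 i = u i)
    (hp : s.nat 14 0 = p) :
    Runs ω rankP s (200 * (n + 1))
      fun s' => s' = (s.setNat 9 0 (rank (score c h u) p)).setNat 12 0 n := by
  classical
  have hsc : ∀ (s' : State) (e : NExp) (i : Fin n), e.eval s' = i → s'.nat 0 0 = s.nat 0 0 →
      s'.nat 13 0 = s.nat 13 0 → (∀ j, s'.nat 2 j = s.nat 2 j) → (∀ j, s'.nat 3 j = s.nat 3 j) →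
      (∀ j, s'.real 0 j = s.real 0 j) → (scoreE e).eval s' = score c h u i := by
    intro s' e i he h0 h13 h2 h3 hr
    simp [scoreE, cellE, nvar, pagesE, RExp.eval, NExp.eval, he, h0, h13, h2, h3, hr, hn, hc, hh, hu,
      score]
  refine Runs.mono (Runs.natSet_seq (Runs.natSet_seq (Runs.loop (N := n)
    (B := 150)
    (fun i s' => s' = (s.setNat 9 0 (univ.filter fun j : Fin n => (j : ℕ) < i ∧
      Precedes (score c h u) j p).card).setNat 12 0 i) ?_ ?_ ?_ (fun _ h => h)))) ?_ ?_
  · simp [NExp.eval]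
  · rintro i - s' rfl
    simp [BExp.holds, NExp.eval, nvar, pagesE, hn]
  · rintro i hi s' rfl
    have hprec : BExp.holds ((s.setNat 9 0 (univ.filter fun j : Fin n => (j : ℕ) < i ∧
        Precedes (score c h u) j p).card).setNat 12 0 i) precedesE ↔
        Precedes (score c h u) ⟨i, hi⟩ p := by
      simp only [precedesE, BExp.holds]
      rw [hsc _ (nvar 14) p (by simp [nvar, NExp.eval, hp]) (by simp) (by simp) (by simp)
        (by simp) (by simp), hsc _ (nvar 12) ⟨i, hi⟩ (by simp [nvar, NExp.eval]) (by simp)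
        (by simp) (by simp) (by simp) (by simp)]
      simp only [nvar, NExp.eval, State.nat_setNat]
      simp only [Precedes, Fin.lt_def, hp]
      by_cases hlt : score c h u p < score c h u ⟨i, hi⟩
      · simp [hlt]
      · simp [hlt]
    refine Runs.mono (Runs.seq (R := fun s' => s' = (s.setNat 9 0 (univ.filter fun j : Fin n =>
      (j : ℕ) < i + 1 ∧ Precedes (score c h u) j p).card).setNat 12 0 i)
      (Runs.cond (fun hb => Runs.natSet ?_) (fun hb => Runs.skip ?_))
      (fun s' hs' => Runs.natSet (Q := fun s' => s' = (s.setNat 9 0 (univ.filter fun j : Fin n =>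
      (j : ℕ) < i + 1 ∧ Precedes (score c h u) j p).card).setNat 12 0 (i + 1)) ?_)) ?_ (fun _ h => h)
    · rw [hprec] at hb
      rw [card_filter_lt_succ _ i hi, if_pos hb]
      refine State.eq_of (fun a j => ?_) (fun a j => by simp) (by simp)
      simp only [State.nat_setNat, NExp.eval, nvar]
      by_cases ha : a = 9 <;> by_cases ha' : a = 12 <;> by_cases hj : j = 0 <;> simp [ha, ha', hj]
    · rw [hprec] at hb
      rw [card_filter_lt_succ _ i hi, if_neg hb, add_zero]
    · subst hs'
      refine State.eq_of (fun a j => ?_) (fun a j => by simp) (by simp)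
      simp only [State.nat_setNat, NExp.eval, nvar]
      by_cases ha : a = 9 <;> by_cases ha' : a = 12 <;> by_cases hj : j = 0 <;> simp [ha, ha', hj]
    · decide
  · simp only [NExp.cost, BExp.cost, nvar, pagesE]
    omega
  · rintro s' rfl
    have : (univ.filter fun j : Fin n => (j : ℕ) < n ∧ Precedes (score c h u) j p) =
        univ.filter fun j : Fin n => Precedes (score c h u) j p := by
      ext j; simp
    rw [this]
    rfl

end Parts

end Paging

namespace Paging

open Finset

/-! ### The memory invariant and the round of the marking algorithm. -/

section Rounds

variable {n k l : ℕ} {r : ℕ → Fin n} {ω : Coins} {t m : ℕ} {s s' : State}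

/-- The memory during round `t + 1`: the rows below `m` have been advanced already. -/
structure Ready (k l : ℕ) (r : ℕ → Fin n) (ω : Coins) (t m : ℕ) (s : State) : Prop where
  pages : s.nat 0 0 = n
  size : s.nat 0 1 = k
  flag : s.nat 0 4 = 1
  rows : s.nat 6 0 = l
  counts : ∀ a ≤ l, ∀ i : Fin n,
    s.nat 2 (a * n + i) = rowCounts k l r a (if a < m then t + 1 else t) i
  scale : ∀ a ≤ l, s.nat 3 a = rowScale l a
  length : ∀ a, 1 ≤ a → a ≤ l → s.nat 4 a = blockLength l a
  age : ∀ a, 1 ≤ a → a ≤ l → s.nat 5 a = (if a < m then t + 1 else t) % blockLength l a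
  numMarked : s.nat 7 0 = (marked k r (if 0 < m then t + 1 else t)).card
  noise : ∀ i : Fin n, s.real 0 i = noise n ω i
  threshold : ∀ a ≤ l, s.real 1 a = ω (n + a)
  weight : ∀ a, 1 ≤ a → a ≤ l →
    s.real 2 a = rowWeight k l r (Paging.noise n ω) a (if a < m then t + 1 else t)
  least : s.real 5 0 = minWeight l

theorem cell_eq_iff {a b : ℕ} {i j : Fin n} : a * n + i = b * n + j ↔ a = b ∧ i = j := by
  constructor
  · intro h
    have hn : 0 < n := i.pos
    have h1 : (a * n + i) / n = a := by
      rw [mul_comm, Nat.mul_add_div hn, Nat.div_eq_of_lt i.2, add_zero]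
    have h2 : (b * n + j) / n = b := by
      rw [mul_comm, Nat.mul_add_div hn, Nat.div_eq_of_lt j.2, add_zero]
    rw [h, h2] at h1
    subst h1
    exact ⟨rfl, Fin.ext (by omega)⟩
  · rintro ⟨rfl, rfl⟩; rfl

/-- Lists what may change when row `m` is advanced: its counts, age and weight; everything else read
by the invariant must be preserved. -/
theorem Ready.succ (h : Ready k l r ω t m s) (h0 : ∀ i, s'.nat 0 i = s.nat 0 i)
    (h3 : ∀ i, s'.nat 3 i = s.nat 3 i) (h4 : ∀ i, s'.nat 4 i = s.nat 4 i)
    (h6 : s'.nat 6 0 = s.nat 6 0) (hr0 : ∀ i, s'.real 0 i = s.real 0 i)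
    (hr1 : ∀ i, s'.real 1 i = s.real 1 i) (hr5 : s'.real 5 0 = s.real 5 0)
    (h2 : ∀ a ≠ m, ∀ i : Fin n, s'.nat 2 (a * n + i) = s.nat 2 (a * n + i))
    (h2' : ∀ i : Fin n, s'.nat 2 (m * n + i) = rowCounts k l r m (t + 1) i)
    (h5 : ∀ a ≠ m, s'.nat 5 a = s.nat 5 a)
    (h5' : 1 ≤ m → s'.nat 5 m = (t + 1) % blockLength l m)
    (hx : ∀ a ≠ m, s'.real 2 a = s.real 2 a)
    (hx' : 1 ≤ m → s'.real 2 m = rowWeight k l r (Paging.noise n ω) m (t + 1))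
    (h7 : s'.nat 7 0 = (marked k r (t + 1)).card) : Ready k l r ω t (m + 1) s' where
  pages := by rw [h0, h.pages]
  size := by rw [h0, h.size]
  flag := by rw [h0, h.flag]
  rows := by rw [h6, h.rows]
  counts a ha i := by
    rcases eq_or_ne a m with rfl | ham
    · simp [h2']
    · simp only [h2 a ham, h.counts a ha, show a < m + 1 ↔ a < m by omega]
  scale a ha := by rw [h3, h.scale a ha]
  length a ha ha' := by rw [h4, h.length a ha ha']
  age a ha ha' := by
    rcases eq_or_ne a m with rfl | ham
    · simp [h5' ha]
    · simp only [h5 a ham, h.age a ha ha', show a < m + 1 ↔ a < m by omega]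
  numMarked := by simp [h7]
  noise i := by rw [hr0, h.noise]
  threshold a ha := by rw [hr1, h.threshold a ha]
  weight a ha ha' := by
    rcases eq_or_ne a m with rfl | ham
    · simp [hx' ha]
    · simp only [hx a ham, h.weight a ha ha', show a < m + 1 ↔ a < m by omega]
  least := by rw [hr5, h.least]

theorem Ready.round_succ (h : Ready k l r ω t (l + 1) s) : Ready k l r ω (t + 1) 0 s where
  pages := h.pages
  size := h.size
  flag := h.flag
  rows := h.rows
  counts a ha i := by rw [h.counts a ha, if_pos (by omega)]; simp
  scale := h.scale
  length := h.length
  age a ha ha' := by rw [h.age a ha ha', if_pos (by omega)]; simp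
  numMarked := by rw [h.numMarked, if_pos (by omega)]; simp
  noise := h.noise
  threshold := h.threshold
  weight a ha ha' := by rw [h.weight a ha ha', if_pos (by omega)]; simp
  least := h.least

/-- Evaluating the rank of a page in a row. -/
theorem Ready.runs_rankP (h : Ready k l r ω t m s) {a : ℕ} (ha : a ≤ l) {p : Fin n}
    (h13 : s.nat 13 0 = a) (h14 : s.nat 14 0 = p) :
    Runs ω rankP s (200 * (n + 1)) fun s' => s' = (s.setNat 9 0
      (rank (score (rowCounts k l r a (if a < m then t + 1 else t)) (rowScale l a)
        (Paging.noise n ω)) p)).setNat 12 0 n :=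
  Paging.runs_rankP h.pages (by rw [h13]; exact h.counts a ha) (by rw [h13]; exact h.scale a ha)
    h.noise h14

theorem runs_markP (h : Ready k l r ω t 0 s) (hr : s.nat 0 3 = r (t + 1)) :
    Runs ω markP s (400 * (n + 1)) fun s' => Ready k l r ω t 1 s' ∧ s'.nat 0 3 = r (t + 1) ∧
      s'.real 3 0 = levelCost k l r (Paging.noise n ω) 0 (t + 1) := by
  classical
  set R := rank (score (rowCounts k l r 0 t) (rowScale l 0) (Paging.noise n ω)) (r (t + 1)) with hR
  set s₁ := (((s.setNat 13 0 0).setNat 14 0 (r (t + 1))).setNat 9 0 R).setNat 12 0 n with hs₁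
  set s₂ := s₁.setReal 3 0 (rowCost k l r (Paging.noise n ω) 0 (t + 1)) with hs₂
  have hcases := markClass_cases k r t (r (t + 1))
  have hc0 : ∀ i : Fin n, s.nat 2 i = markClass k r t i := by
    intro i
    have := h.counts 0 (Nat.zero_le l) i
    simpa [rowCounts] using this
  have hcell : ∀ a ≠ 0, ∀ i : Fin n, n ≤ a * n + i := fun a ha i =>
    (Nat.le_mul_of_pos_left n (Nat.pos_of_ne_zero ha)).trans (Nat.le_add_right _ _)
  have hcell' : ∀ a ≠ 0, ∀ i j : Fin n, a * n + i ≠ (j : ℕ) := fun a ha i j => by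
    have := hcell a ha i
    have := j.2
    omega
  -- The three branches (page already marked, room for a mark, new phase) write only to the arrays
  -- `2`, `7` and `8`, so they leave the same obligations.
  have hfin : ∀ s', (∀ a, a ≠ 2 → a ≠ 7 → a ≠ 8 → s'.nat a = s₂.nat a) → s'.real = s₂.real →
      (∀ x, n ≤ x → s'.nat 2 x = s.nat 2 x) → (∀ i : Fin n, s'.nat 2 i = markClass k r (t + 1) i) →
      s'.nat 7 0 = (marked k r (t + 1)).card →
      Ready k l r ω t 1 s' ∧ s'.nat 0 3 = r (t + 1) ∧
        s'.real 3 0 = levelCost k l r (Paging.noise n ω) 0 (t + 1) := by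
    intro s' g1 g2 g3 g4 g5
    refine ⟨h.succ ?_ ?_ ?_ ?_ ?_ ?_ ?_ ?_ ?_ ?_ ?_ ?_ ?_ g5, ?_, ?_⟩
    · intro i; simp [g1, hs₂, hs₁]
    · intro i; simp [g1, hs₂, hs₁]
    · intro i; simp [g1, hs₂, hs₁]
    · simp [g1, hs₂, hs₁]
    · intro i; simp [g2, hs₂, hs₁]
    · intro i; simp [g2, hs₂, hs₁]
    · simp [g2, hs₂, hs₁]
    · intro a ha i; exact g3 _ (hcell a ha i)
    · intro i; simpa [rowCounts] using g4 i
    · intro i _; simp [g1, hs₂, hs₁]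
    · intro h; omega
    · intro i _; simp [g2, hs₂, hs₁]
    · intro h; omega
    · simp [g1, hs₂, hs₁, hr]
    · simp [g2, hs₂]; rfl
  have hnum := h.numMarked
  simp only [lt_irrefl, if_false] at hnum
  refine Runs.le (Runs.natSet_seq (Runs.natSet_seq (Runs.seq (B := 200 * (n + 1))
    (B' := 100 * (n + 1)) (R := fun s' => s' = s₁) ?_ fun _ hs => ?_))) ?_
  · have h' : Ready k l r ω t 0 ((s.setNat 13 0 0).setNat 14 0 (r (t + 1))) := by
      refine ⟨?_, ?_, ?_, ?_, ?_, ?_, ?_, ?_, ?_, ?_, ?_, ?_, ?_⟩ <;> simp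
      · exact h.pages
      · exact h.size
      · exact h.flag
      · exact h.rows
      · simpa using h.counts
      · exact h.scale
      · exact h.length
      · simpa using h.age
      · exact hnum
      · exact h.noise
      · exact h.threshold
      · simpa using h.weight
      · exact h.least
    have := h'.runs_rankP (Nat.zero_le l) (p := r (t + 1)) (by simp) (by simp)
    simpa [NExp.eval, requestE, hr, hs₁, hR] using this
  · subst hs
    refine Runs.le (Runs.seq (B := 20) (B' := 80 * (n + 1)) (R := fun s' => s' = s₂) ?_
      fun _ hs => ?_) (by omega)
    · have hmem : r (t + 1) ∈ rowCache k l r (Paging.noise n ω) 0 t ↔ R < k := mem_top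
      refine Runs.le (Runs.cond (fun hb => Runs.realSet ?_) (fun hb => Runs.realSet ?_))
        (by decide)
      · have : R < k := by
          simpa [BExp.holds, NExp.eval, nvar, sizeE, hs₁, h.size] using hb
        simp [hs₂, rowCost, hmem, this, RExp.eval, NExp.eval]
      · have : ¬ R < k := by
          simpa [BExp.holds, NExp.eval, nvar, sizeE, hs₁, h.size] using hb
        simp [hs₂, rowCost, hmem, this, RExp.eval, NExp.eval]
    · subst hs
      have hreq : requestE.eval s₂ = r (t + 1) := by
        simp [requestE, NExp.eval, hs₂, hs₁, hr]
      have hcond : BExp.holds s₂ (.natLt (.get 2 requestE) (.lit 4)) ↔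
          r (t + 1) ∉ marked k r t := by
        simp only [BExp.holds, NExp.eval, hreq]
        rw [mem_marked]
        simp [hs₂, hs₁, hc0]
        omega
      have hcond' : BExp.holds s₂ (.natLt (nvar 7) sizeE) ↔ (marked k r t).card < k := by
        simp [BExp.holds, NExp.eval, nvar, sizeE, hs₂, hs₁, hnum, h.size]
      refine Runs.le (Runs.cond (B := 60 * (n + 1)) (B' := 1) (fun hb => ?_)
        (fun hb => Runs.skip ?_)) ?_
      · rw [hcond] at hb
        have hb4 : ¬ markClass k r t (r (t + 1)) = 4 := by rwa [mem_marked] at hb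
        refine Runs.le (Runs.cond (B := 30) (B' := 50 * (n + 1)) (fun hb' =>
          Runs.le (Runs.natSet_seq (Runs.natSet (hfin _ ?_ ?_ ?_ ?_ ?_))) (by decide))
          (fun hb' => Runs.le (Runs.natSet_seq (B := 45 * (n + 1)) ?_) ?_)) ?_
        · intro a ha ha' ha''
          funext j
          simp [ha, ha']
        · simp
        · intro x hx
          have : x ≠ r (t + 1) := by have := (r (t + 1)).2; omega
          simp only [State.nat_setNat, hreq, this]
          simp [hs₂, hs₁]
        · rw [hcond'] at hb'
          intro i
          have hb'' : (univ.filter fun j => markClass k r t j = 4).card < k := hb'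
          simp only [State.nat_setNat, hreq, markClass, markStep, hb4, if_false, hb'', if_true]
          rcases eq_or_ne i (r (t + 1)) with rfl | hi
          · simp [NExp.eval]
          · have : (i : ℕ) ≠ r (t + 1) := fun e => hi (Fin.ext e)
            simp [hi, this, hs₂, hs₁, hc0]
        · rw [hcond'] at hb'
          rw [marked_succ_of_lt hb hb', card_insert_of_notMem hb, ← hnum]
          simp [NExp.eval, nvar, hs₂, hs₁]
        · rw [hcond'] at hb'
          refine Runs.le (Runs.seq (B' := 20) (Runs.loop (N := n) (B := 15) (fun i s' =>
            (∀ a, a ≠ 2 → a ≠ 8 → s'.nat a = s₂.nat a) ∧ s'.real = s₂.real ∧ s'.nat 8 0 = i ∧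
              ∀ x, s'.nat 2 x = if x < i then s.nat 2 x - 2 else s.nat 2 x) ?_ ?_ ?_
                (Q := fun s' =>
            (∀ a, a ≠ 2 → a ≠ 8 → s'.nat a = s₂.nat a) ∧ s'.real = s₂.real ∧
              ∀ x, s'.nat 2 x = if x < n then s.nat 2 x - 2 else s.nat 2 x) ?_)
              (fun s₃ hs₃ => Runs.le (Runs.natSet_seq (Runs.natSet (hfin _ ?_ ?_ ?_ ?_ ?_)))
                (by decide))) ?_
          · refine ⟨fun a ha ha' => ?_, by simp, by simp [NExp.eval], fun x => ?_⟩
            · funext j; simp [ha']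
            · simp [hs₂, hs₁]
          · rintro i - s' ⟨g1, g2, g3, g4⟩
            simp [BExp.holds, NExp.eval, nvar, pagesE, g1, g3, hs₂, hs₁, h.pages]
          · rintro i hi s' ⟨g1, g2, g3, g4⟩
            refine Runs.le (Runs.natSet_seq (Runs.natSet ?_)) (by decide)
            refine ⟨fun a ha ha' => ?_, ?_, ?_, fun x => ?_⟩
            · funext j; simp [ha, ha', g1]
            · simp [g2]
            · simp [NExp.eval, nvar, g3]
            · simp only [State.nat_setNat, NExp.eval, nvar, g3, g4]
              rcases lt_trichotomy x i with hx | hx | hx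
              · simp [hx, hx.ne, show x < i + 1 by omega]
              · simp [hx]
              · simp [hx.ne', show ¬ x < i by omega, show ¬ x < i + 1 by omega]
          · rintro s' ⟨g1, g2, g3, g4⟩
            exact ⟨g1, g2, g4⟩
          · intro a ha ha' ha''
            obtain ⟨g1, g2, g4⟩ := hs₃
            funext j
            simp [ha, ha', ha'', g1]
          · simp [hs₃.2.1]
          · intro x hx
            obtain ⟨g1, g2, g4⟩ := hs₃
            have hreq' : requestE.eval s₃ = r (t + 1) := by
              simp [requestE, NExp.eval, g1, hs₂, hs₁, hr]
            have : x ≠ r (t + 1) := by have := (r (t + 1)).2; omega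
            simp [hreq', this, g4, not_lt.2 hx]
          · intro i
            obtain ⟨g1, g2, g4⟩ := hs₃
            have hreq' : requestE.eval s₃ = r (t + 1) := by
              simp [requestE, NExp.eval, g1, hs₂, hs₁, hr]
            have hb'' : ¬ (univ.filter fun j => markClass k r t j = 4).card < k := hb'
            simp only [State.nat_setNat, hreq', markClass, markStep, hb4, if_false, hb'']
            rcases eq_or_ne i (r (t + 1)) with rfl | hi
            · simp [NExp.eval]
            · have : (i : ℕ) ≠ r (t + 1) := fun e => hi (Fin.ext e)
              simp [hi, this, g4, hc0]
          · rw [marked_succ_of_full hb hb']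
            simp [NExp.eval]
          · simp only [NExp.cost, BExp.cost, nvar, pagesE]
            omega
        · simp only [NExp.cost]
          omega
        · simp only [NExp.cost, BExp.cost, nvar, sizeE]
          omega
      · rw [hcond, not_not] at hb
        have hb4 : markClass k r t (r (t + 1)) = 4 := by rwa [mem_marked] at hb
        refine hfin _ (fun _ _ _ _ => rfl) rfl (fun x _ => by simp [hs₂, hs₁]) (fun i => ?_) ?_
        · simp [hs₂, hs₁, hc0, markClass, markStep, hb4]
        · rw [marked_succ_of_mem hb, ← hnum]
          simp [hs₂, hs₁]
      · simp only [NExp.cost, BExp.cost, requestE]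
        omega
  · simp only [NExp.cost, requestE]
    omega

end Rounds

end Paging

namespace Paging

open Finset

/-! ### The rounds of the perturbed-leader rows and the output of the selected cache. -/

section Rows

variable {n k l : ℕ} {r : ℕ → Fin n} {ω : Coins} {t m : ℕ} {s s' : State}

theorem runs_countP {i : Fin n} {R : ℕ} (hn : s.nat 0 0 = n) (hk : s.nat 0 1 = k)
    (hr : s.nat 0 3 = i) (h10 : s.nat 10 0 = m) (h9 : s.nat 9 0 = R) :
    Runs ω countP s (60 * (n + 1)) fun s' =>
      (∀ a, a ≠ 2 → a ≠ 8 → s'.nat a = s.nat a) ∧ (∀ a, a ≠ 6 → a ≠ 7 → s'.real a = s.real a) ∧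
      s'.real 6 0 = (if s.nat 5 m = 0 then (k : ℝ) + 2 else if R < k then 0 else 2) ∧
      s'.real 7 0 = (if s.nat 5 m = 0 then 5 * (k : ℝ) else 3) ∧
      ∀ a, ∀ j : Fin n, s'.nat 2 (a * n + j) = if a = m then
        (if s.nat 5 m = 0 then 0 else if j = i then s.nat 2 (m * n + i) + 1 else s.nat 2 (m * n + j))
        else s.nat 2 (a * n + j) := by
  refine Runs.le (Runs.cond (B := 50 * (n + 1)) (B' := 50) (fun hb => ?_) (fun hb => ?_)) ?_
  · have hage : s.nat 5 m = 0 := by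
      simpa [BExp.holds, NExp.eval, nvar, h10] using hb
    refine Runs.le (Runs.realSet_seq (Runs.realSet_seq (Runs.natSet_seq (Runs.loop (N := n) (B := 20)
      (fun i s' => (∀ a, a ≠ 2 → a ≠ 8 → s'.nat a = s.nat a) ∧
        (∀ a, a ≠ 6 → a ≠ 7 → s'.real a = s.real a) ∧ s'.real 6 0 = (k : ℝ) + 2 ∧
        s'.real 7 0 = 5 * (k : ℝ) ∧ s'.nat 8 0 = i ∧
        ∀ x, s'.nat 2 x = if m * n ≤ x ∧ x < m * n + i then 0 else s.nat 2 x) ?_ ?_ ?_ ?_)))) ?_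
    · refine ⟨fun a h2 h8 => ?_, fun a h6 h7 => ?_, ?_, ?_, ?_, fun x => ?_⟩
      · funext j; simp [h8]
      · funext j; simp [h6, h7]
      · simp [RExp.eval, NExp.eval, sizeE, hk]
      · simp [RExp.eval, NExp.eval, sizeE, hk]
      · simp [NExp.eval]
      · simp
    · rintro i - s' ⟨g1, g2, g3, g4, g5, g6⟩
      simp [BExp.holds, NExp.eval, nvar, pagesE, g1, g5, hn]
    · rintro i hi s' ⟨g1, g2, g3, g4, g5, g6⟩
      refine Runs.le (Runs.natSet_seq (Runs.natSet ?_)) (by decide)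
      refine ⟨fun a h2 h8 => ?_, fun a h6 h7 => ?_, ?_, ?_, ?_, fun x => ?_⟩
      · funext j; simp [h2, h8, g1]
      · simp [g2 a h6 h7]
      · simp [g3]
      · simp [g4]
      · simp [NExp.eval, nvar, g5]
      · simp only [State.nat_setNat, NExp.eval, nvar, cellE, pagesE, g1 0 (by decide) (by decide),
          g1 10 (by decide) (by decide), g5, g6, h10, hn]
        by_cases hx : x = m * n + i
        · simp [hx]
        · have : (m * n ≤ x ∧ x < m * n + (i + 1)) ↔ (m * n ≤ x ∧ x < m * n + i) := by omega
          simp [hx, this]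
    · rintro s' ⟨g1, g2, g3, g4, g5, g6⟩
      refine ⟨g1, g2, by simp [g3, hage], by simp [g4, hage], fun a j => ?_⟩
      rw [g6]
      have hcell : (m * n ≤ a * n + j ∧ a * n + j < m * n + n) ↔ a = m := by
        constructor
        · rintro ⟨h1, h2⟩
          have h3 : a * n + j = m * n + (⟨a * n + j - m * n, by omega⟩ : Fin n) := by
            simp only; omega
          exact (cell_eq_iff.1 h3).1
        · rintro rfl
          have := j.2
          omega
      simp [hcell, hage]
    · simp only [NExp.cost, RExp.cost, BExp.cost, nvar, pagesE, sizeE]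
      omega
  · have hage : ¬ s.nat 5 m = 0 := by
      simpa [BExp.holds, NExp.eval, nvar, h10] using hb
    refine Runs.le (Runs.seq (B' := 30)
      (R := fun s' => s' = s.setReal 6 0 (if R < k then 0 else 2))
      (Runs.cond (fun hb => Runs.realSet ?_) (fun hb => Runs.realSet ?_)) ?_) (by decide)
    · have : R < k := by simpa [BExp.holds, NExp.eval, nvar, sizeE, h9, hk] using hb
      simp [this, RExp.eval, NExp.eval]
    · have : ¬ R < k := by simpa [BExp.holds, NExp.eval, nvar, sizeE, h9, hk] using hb
      simp [this, RExp.eval, NExp.eval]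
    · rintro s' rfl
      refine Runs.le (Runs.realSet_seq (Runs.natSet ?_)) (by decide)
      refine ⟨fun a h2 h8 => ?_, fun a h6 h7 => ?_, ?_, ?_, fun a j => ?_⟩
      · funext j; simp [h2]
      · funext j; simp [h6, h7]
      · simp [hage]
      · simp [hage, RExp.eval, NExp.eval]
      · simp only [State.nat_setNat, State.nat_setReal, NExp.eval, nvar, cellE, pagesE, requestE,
          h10, hn, hr, true_and, cell_eq_iff, hage, if_false]
        by_cases ha : a = m
        · subst ha
          by_cases hj : j = i <;> simp [hj]
        · simp [ha]
  · simp only [NExp.cost, BExp.cost, nvar]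
    omega

theorem runs_weightP {h : ℕ} {p q G x ε g : ℝ} (hk : s.nat 0 1 = k) (h10 : s.nat 10 0 = m)
    (hh : s.nat 3 m = h) (hp : s.real 3 0 = p) (hq : s.real 6 0 = q) (hG : s.real 7 0 = G)
    (hx : s.real 2 m = x) (hε : s.real 5 0 = ε) (hg : g = p - q - 1 / (10 * h) * G) :
    Runs ω weightP s 200 fun s' => s'.nat = s.nat ∧
      (∀ a, a ≠ 2 → a ≠ 3 → a ≠ 8 → a ≠ 9 → s'.real a = s.real a) ∧
      (∀ b ≠ m, s'.real 2 b = s.real 2 b) ∧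
      s'.real 2 m = weightStep (1 / (10 * k * h)) ε x g ∧
      s'.real 3 0 = p - weightStep (1 / (10 * k * h)) ε x g * g := by
  set y := x / (1 - 1 / (10 * k * h) * g) with hy
  set s₁ := (s.setReal 8 0 g).setReal 9 0 y with hs₁
  have e1 : (RExp.sub (.sub (rvar 3) (rvar 6)) (.mul (.div oneE
      (.ofNat (.mul (.lit 10) (.get 3 (nvar 10))))) (rvar 7))).eval s = g := by
    simp [RExp.eval, NExp.eval, rvar, nvar, oneE, hp, hq, hG, h10, hh, hg]
  have e2 : (RExp.div (.get 2 (nvar 10)) (.sub oneE (.mul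
      (.div oneE (.ofNat (.mul (.mul (.lit 10) sizeE) (.get 3 (nvar 10))))) (rvar 8)))).eval
        (s.setReal 8 0 g) = y := by
    simp [RExp.eval, NExp.eval, rvar, nvar, oneE, sizeE, hk, h10, hh, hx, hy]
  refine Runs.le (Runs.realSet_seq (Runs.realSet_seq (B := 70) ?_)) (by decide)
  rw [show (NExp.lit 0).eval s = 0 from rfl, e1,
    show (NExp.lit 0).eval (s.setReal 8 0 g) = 0 from rfl, e2, ← hs₁]
  refine Runs.le (Runs.seq (B' := 40)
    (R := fun s' => s' = s₁.setReal 2 m (weightStep (1 / (10 * k * h)) ε x g))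
    (Runs.cond (fun hb => Runs.realSet ?_) (fun hb => Runs.cond (fun hb' => Runs.realSet ?_)
      (fun hb' => Runs.realSet ?_))) ?_) (by decide)
  · have h1 : y < ε := by simpa [BExp.holds, RExp.eval, NExp.eval, rvar, hs₁, hε] using hb
    have : weightStep (1 / (10 * k * h)) ε x g = ε := if_pos h1
    rw [this]
    simp [RExp.eval, NExp.eval, rvar, nvar, hs₁, hε, h10]
  · have h1 : ¬ y < ε := by simpa [BExp.holds, RExp.eval, NExp.eval, rvar, hs₁, hε] using hb
    have h2 : 1 < y := by simpa [BExp.holds, RExp.eval, NExp.eval, rvar, oneE, hs₁] using hb'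
    have : weightStep (1 / (10 * k * h)) ε x g = 1 := by
      unfold weightStep; rw [if_neg h1, if_pos h2]
    rw [this]
    simp [RExp.eval, NExp.eval, nvar, oneE, hs₁, h10]
  · have h1 : ¬ y < ε := by simpa [BExp.holds, RExp.eval, NExp.eval, rvar, hs₁, hε] using hb
    have h2 : ¬ 1 < y := by simpa [BExp.holds, RExp.eval, NExp.eval, rvar, oneE, hs₁] using hb'
    have : weightStep (1 / (10 * k * h)) ε x g = y := by
      unfold weightStep; rw [if_neg h1, if_neg h2]
    rw [this]
    simp [RExp.eval, NExp.eval, rvar, nvar, hs₁, h10]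
  · rintro s' rfl
    refine Runs.le (Runs.realSet ?_) (by decide)
    refine ⟨by simp [hs₁], fun a h2 h3 h8 h9 => ?_, fun b hb => ?_, ?_, ?_⟩
    · funext j; simp [hs₁, h2, h3, h8, h9]
    · simp [hs₁, hb]
    · simp [hs₁]
    · simp [RExp.eval, NExp.eval, rvar, nvar, hs₁, h10, hp]

open Classical in
theorem runs_selectP (h10 : s.nat 10 0 = m) :
    Runs ω selectP s 40 fun s' => s'.real = s.real ∧
      (∀ a, a ≠ 5 → a ≠ 11 → s'.nat a = s.nat a) ∧
      s'.nat 11 0 = (if s.real 1 m < s.real 2 m then m else s.nat 11 0) ∧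
      (∀ b ≠ m, s'.nat 5 b = s.nat 5 b) ∧
      s'.nat 5 m = if s.nat 5 m + 1 < s.nat 4 m then s.nat 5 m + 1 else 0 := by
  set s₁ := s.setNat 11 0 (if s.real 1 m < s.real 2 m then m else s.nat 11 0) with hs₁
  refine Runs.le (Runs.seq (B' := 25) (R := fun s' => s' = s₁)
    (Runs.cond (fun hb => Runs.natSet ?_) (fun hb => Runs.skip ?_)) ?_) (by decide)
  · have : s.real 1 m < s.real 2 m := by
      simpa [BExp.holds, RExp.eval, NExp.eval, nvar, h10] using hb
    simp [hs₁, this, NExp.eval, nvar, h10]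
  · have : ¬ s.real 1 m < s.real 2 m := by
      simpa [BExp.holds, RExp.eval, NExp.eval, nvar, h10] using hb
    refine State.eq_of (fun a j => ?_) (fun a j => by simp [hs₁]) (by simp [hs₁])
    by_cases ha : a = 11 <;> by_cases hj : j = 0 <;> simp [hs₁, ha, hj, this]
  · rintro s' rfl
    have hcond : BExp.holds s₁ (.natLt (.add (.get 5 (nvar 10)) (.lit 1)) (.get 4 (nvar 10))) ↔
        s.nat 5 m + 1 < s.nat 4 m := by
      simp [BExp.holds, NExp.eval, nvar, hs₁, h10]
    refine Runs.le (Runs.cond (fun hb => Runs.natSet ?_) (fun hb => Runs.natSet ?_)) (by decide)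
    · rw [hcond] at hb
      refine ⟨by simp [hs₁], fun a h5 h11 => ?_, by simp [hs₁], fun b hb => ?_, ?_⟩
      · funext j; simp [hs₁, h5, h11]
      · simp [hs₁, NExp.eval, nvar, h10, hb]
      · simp [hs₁, NExp.eval, nvar, h10, hb]
    · rw [hcond] at hb
      refine ⟨by simp [hs₁], fun a h5 h11 => ?_, by simp [hs₁], fun b hb => ?_, ?_⟩
      · funext j; simp [hs₁, h5, h11]
      · simp [hs₁, NExp.eval, nvar, h10, hb]
      · simp [hs₁, NExp.eval, nvar, h10, hb]

/-- Justifies the age counter, which replaces the computation of remainders. -/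
theorem succ_mod_eq {len : ℕ} (hlen : 0 < len) (t : ℕ) :
    (t + 1) % len = if t % len + 1 < len then t % len + 1 else 0 := by
  have h1 := Nat.div_add_mod t len
  have h2 := Nat.mod_lt t hlen
  split_ifs with h
  · conv_lhs => rw [← h1, add_assoc]
    rw [Nat.mul_comm]
    exact Nat.mul_add_mod_of_lt h
  · have h3 : t + 1 = len * (t / len + 1) := by rw [mul_add]; omega
    rw [h3, Nat.mul_mod_right]

/-- The request cell, the output array and the scratch variables are absent from the invariant, so
writing to them is harmless. -/
theorem Ready.frame (h : Ready k l r ω t m s) (h0 : ∀ i ≠ 3, s'.nat 0 i = s.nat 0 i)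
    (h2 : s'.nat 2 = s.nat 2) (h3 : s'.nat 3 = s.nat 3) (h4 : s'.nat 4 = s.nat 4)
    (h5 : s'.nat 5 = s.nat 5) (h6 : s'.nat 6 = s.nat 6) (h7 : s'.nat 7 = s.nat 7)
    (hr0 : s'.real 0 = s.real 0) (hr1 : s'.real 1 = s.real 1) (hr2 : s'.real 2 = s.real 2)
    (hr5 : s'.real 5 = s.real 5) : Ready k l r ω t m s' where
  pages := by rw [h0 _ (by decide), h.pages]
  size := by rw [h0 _ (by decide), h.size]
  flag := by rw [h0 _ (by decide), h.flag]
  rows := by rw [h6, h.rows]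
  counts := by rw [h2]; exact h.counts
  scale := by rw [h3]; exact h.scale
  length := by rw [h4]; exact h.length
  age := by rw [h5]; exact h.age
  numMarked := by rw [h7]; exact h.numMarked
  noise := by rw [hr0]; exact h.noise
  threshold := by rw [hr1]; exact h.threshold
  weight := by rw [hr2]; exact h.weight
  least := by rw [hr5]; exact h.least

/-- The memory during the processing of the rows. -/
structure Processing (k l : ℕ) (r : ℕ → Fin n) (ω : Coins) (t m : ℕ) (s : State) : Prop
    extends Ready k l r ω t (m + 1) s where
  request : s.nat 0 3 = r (t + 1)
  cost : s.real 3 0 = levelCost k l r (Paging.noise n ω) m (t + 1)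
  choice : s.nat 11 0 = selected k l r ω m (t + 1)

theorem runs_rowP (h : Processing k l r ω t m s) (hm : m + 1 ≤ l) (h10 : s.nat 10 0 = m + 1) :
    Runs ω rowP s (500 * (n + 1)) fun s' => Processing k l r ω t (m + 1) s' ∧
      s'.nat 10 0 = m + 1 := by
  classical
  have hR := h.toReady
  set c := rowCounts k l r (m + 1) t with hc
  set R := rank (score c (rowScale l (m + 1)) (Paging.noise n ω)) (r (t + 1)) with hRk
  set s₁ := (((s.setNat 13 0 (m + 1)).setNat 14 0 (r (t + 1))).setNat 9 0 R).setNat 12 0 n with hs₁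
  have hagem : s.nat 5 (m + 1) = t % blockLength l (m + 1) := by
    simpa using hR.age (m + 1) (by omega) hm
  have hmem : r (t + 1) ∈ rowCache k l r (Paging.noise n ω) (m + 1) t ↔ R < k := mem_top
  have hlen : 0 < blockLength l (m + 1) := by
    have : 0 < l := by omega
    unfold blockLength; positivity
  refine Runs.le (Runs.natSet_seq (Runs.natSet_seq (Runs.seq (B := 200 * (n + 1))
    (B' := 60 * (n + 1) + 240) (R := fun s' => s' = s₁) ?_ fun _ hs => ?_))) ?_
  · have h' : Ready k l r ω t (m + 1) ((s.setNat 13 0 (m + 1)).setNat 14 0 (r (t + 1))) := by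
      refine hR.frame ?_ ?_ ?_ ?_ ?_ ?_ ?_ ?_ ?_ ?_ ?_ <;> intros <;> try funext j
      all_goals simp
    have := h'.runs_rankP hm (p := r (t + 1)) (by simp) (by simp)
    simpa [NExp.eval, requestE, nvar, h10, h.request, hs₁, hRk, hc] using this
  · subst hs
    refine Runs.seq (B' := 240) (runs_countP (m := m + 1) (R := R) (i := r (t + 1)) (k := k)
      (n := n) (by simp [hs₁, hR.pages]) (by simp [hs₁, hR.size]) (by simp [hs₁, h.request])
      (by simp [hs₁, h10]) (by simp [hs₁])) ?_
    rintro s₂ ⟨a1, a2, a3, a4, a5⟩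
    have hage₁ : s₁.nat 5 (m + 1) = t % blockLength l (m + 1) := by simp [hs₁, hagem]
    have hq : s₂.real 6 0 = rowCost k l r (Paging.noise n ω) (m + 1) (t + 1) := by
      rw [a3, hage₁]
      simp [rowCost, hmem]
    have hG : s₂.real 7 0 = costBound k l (m + 1) (t + 1) := by
      rw [a4, hage₁]
      simp [costBound]
    refine Runs.le (Runs.seq (B' := 40) (runs_weightP (ω := ω) (s := s₂) (m := m + 1) (k := k) (h := rowScale l (m + 1))
      (p := levelCost k l r (Paging.noise n ω) m (t + 1))
      (x := rowWeight k l r (Paging.noise n ω) (m + 1) t) (ε := minWeight l)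
      (g := gain (levelCost k l r (Paging.noise n ω) m)
        (rowCost k l r (Paging.noise n ω) (m + 1)) (costBound k l (m + 1)) (moveRate l (m + 1))
          (t + 1))
      (by simp [a1, hs₁, hR.size]) (by simp [a1, hs₁, h10])
      (by simp [a1, hs₁, hR.scale (m + 1) hm]) (by simp [a2, hs₁, h.cost]) hq hG
      (by
        have := hR.weight (m + 1) (by omega) hm
        simpa [a2, hs₁] using this)
      (by simp [a2, hs₁, hR.least]) rfl) ?_) (by decide)
    rintro s₃ ⟨b1, b2, b3, b4, b5⟩
    refine Runs.mono (runs_selectP (s := s₃) (m := m + 1) (by simp [b1, a1, hs₁, h10])) le_rfl ?_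
    rintro s₄ ⟨c1, c2, c3, c4, c5⟩
    have hw : s₃.real 2 (m + 1) = rowWeight k l r (Paging.noise n ω) (m + 1) (t + 1) := b4
    have hrows : ∀ a, a ≠ 5 → a ≠ 11 → a ≠ 2 → a ≠ 8 → s₄.nat a = s₁.nat a := by
      intro a h1 h2 h3 h4
      rw [c2 a h1 h2, b1, a1 a h3 h4]
    refine ⟨⟨hR.succ ?_ ?_ ?_ ?_ ?_ ?_ ?_ ?_ ?_ ?_ ?_ ?_ ?_ ?_, ?_, ?_, ?_⟩, ?_⟩
    · intro i; simp [hrows, hs₁]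
    · intro i; simp [hrows, hs₁]
    · intro i; simp [hrows, hs₁]
    · simp [hrows, hs₁]
    · intro i; simp [c1, b2, a2, hs₁]
    · intro i; simp [c1, b2, a2, hs₁]
    · simp [c1, b2, a2, hs₁]
    · intro a ha i
      rw [c2 2 (by decide) (by decide), b1, a5, if_neg ha]
      simp [hs₁]
    · intro i
      have hcell : ∀ j : Fin n, s.nat 2 ((m + 1) * n + j) = counts (blockLength l (m + 1)) r t j := by
        intro j
        have := hR.counts (m + 1) hm j
        simpa [rowCounts] using this
      rw [c2 2 (by decide) (by decide), b1, a5, if_pos rfl, hage₁]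
      simp only [rowCounts, Nat.succ_ne_zero, if_false, counts]
      split_ifs with g1 g2
      · rfl
      · subst g2; simp [hs₁, hcell]
      · simp [hs₁, hcell, Function.update_of_ne g2]
    · intro a ha
      rw [c4 a ha, b1, a1 5 (by decide) (by decide)]
      simp [hs₁]
    · intro _
      rw [c5, succ_mod_eq hlen, b1, a1 5 (by decide) (by decide), a1 4 (by decide) (by decide), hage₁]
      have : s₁.nat 4 (m + 1) = blockLength l (m + 1) := by
        simp [hs₁, hR.length (m + 1) (by omega) hm]
      rw [this]
    · intro a ha
      rw [c1, b3 a ha, a2 2 (by decide) (by decide)]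
      simp [hs₁]
    · intro _
      rw [c1, hw]
    · have := hR.numMarked
      simpa [hrows, hs₁] using this
    · simp [hrows, hs₁, h.request]
    · rw [c1, b5]
      rfl
    · rw [c3, hw, b1, b2 1 (by decide) (by decide) (by decide) (by decide),
        a2 1 (by decide) (by decide), a1 11 (by decide) (by decide), selected]
      simp [hs₁, hR.threshold (m + 1) hm, h.choice]
    · simp [hrows, hs₁, h10]
  · simp only [NExp.cost, requestE, nvar]
    have := (r (t + 1)).pos
    omega

theorem runs_rowsP (h : Ready k l r ω t 1 s) (hr : s.nat 0 3 = r (t + 1))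
    (hcost : s.real 3 0 = levelCost k l r (Paging.noise n ω) 0 (t + 1)) :
    Runs ω rowsP s (l * (520 * (n + 1)) + 40) fun s' => Ready k l r ω (t + 1) 0 s' ∧
      s'.nat 11 0 = selected k l r ω l (t + 1) := by
  refine Runs.le (Runs.natSet_seq (Runs.natSet_seq (Runs.loop (N := l) (B := 500 * (n + 1) + 10)
    (fun i s' => Processing k l r ω t i s' ∧ s'.nat 10 0 = i + 1) ?_ ?_ ?_ ?_))) ?_
  · refine ⟨⟨h.frame ?_ ?_ ?_ ?_ ?_ ?_ ?_ ?_ ?_ ?_ ?_, ?_, ?_, ?_⟩, ?_⟩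
    all_goals intros
    any_goals funext j
    all_goals simp [NExp.eval, hr, hcost, selected]
  · rintro i - s' ⟨g1, g2⟩
    simp [BExp.holds, NExp.eval, nvar, g2, g1.rows]
  · rintro i hi s' ⟨g1, g2⟩
    refine Runs.le (Runs.seq (B' := 10) (runs_rowP g1 (by omega) g2) ?_) (by omega)
    rintro s'' ⟨g3, g4⟩
    refine Runs.le (Runs.natSet ?_) (by decide)
    refine ⟨⟨g3.toReady.frame ?_ ?_ ?_ ?_ ?_ ?_ ?_ ?_ ?_ ?_ ?_, ?_, ?_, ?_⟩, ?_⟩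
    all_goals intros
    any_goals funext j
    all_goals simp [NExp.eval, nvar, g3.request, g3.cost, g3.choice, g4]
  · rintro s' ⟨g1, g2⟩
    exact ⟨g1.toReady.round_succ, g1.choice⟩
  · simp only [NExp.cost, BExp.cost, nvar]
    have : l * (1 + 1 + (1 + 1 + 1 + 1) + 1 + (500 * (n + 1) + 10) + 1) ≤ l * (520 * (n + 1)) :=
      Nat.mul_le_mul_left _ (by omega)
    omega

theorem selected_le (m t : ℕ) : selected k l r ω m t ≤ m := by
  induction m with
  | zero => simp [selected]
  | succ m ih =>
    rw [selected]
    split_ifs <;> omega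

theorem runs_outputP (h : Ready k l r ω t 0 s) (h11 : s.nat 11 0 = selected k l r ω l t) :
    Runs ω outputP s (n * (260 * (n + 1)) + 40) fun s' => Ready k l r ω t 0 s' ∧
      s'.cache n = levelCache k l r ω l t := by
  set a := selected k l r ω l t with ha
  have hal : a ≤ l := selected_le _ _
  refine Runs.le (Runs.natSet_seq (Runs.natSet_seq (Runs.loop (N := n) (B := 250 * (n + 1))
    (fun i s' => Ready k l r ω t 0 s' ∧ s'.nat 13 0 = a ∧ s'.nat 14 0 = i ∧
      ∀ j : Fin n, (j : ℕ) < i → (s'.nat 1 j ≠ 0 ↔ j ∈ levelCache k l r ω l t)) ?_ ?_ ?_ ?_))) ?_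
  · refine ⟨h.frame ?_ ?_ ?_ ?_ ?_ ?_ ?_ ?_ ?_ ?_ ?_, ?_, ?_, ?_⟩
    all_goals intros
    any_goals funext j
    all_goals simp_all [NExp.eval, nvar]
  · rintro i - s' ⟨g1, g2, g3, g4⟩
    simp [BExp.holds, NExp.eval, nvar, pagesE, g3, g1.pages]
  · rintro i hi s' ⟨g1, g2, g3, g4⟩
    have hrank := g1.runs_rankP hal (p := ⟨i, hi⟩) g2 g3
    simp only [Nat.not_lt_zero, if_false] at hrank
    set R := rank (score (rowCounts k l r a t) (rowScale l a) (Paging.noise n ω)) ⟨i, hi⟩ with hR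
    have hmem : (⟨i, hi⟩ : Fin n) ∈ levelCache k l r ω l t ↔ R < k := mem_top
    set s₁ := (s'.setNat 9 0 R).setNat 12 0 n with hs₁
    refine Runs.le (Runs.seq (B' := 30) hrank ?_) (by omega)
    rintro _ rfl
    refine Runs.le (Runs.seq (B' := 10)
      (R := fun s'' => s'' = s₁.setNat 1 i (if R < k then 1 else 0))
      (Runs.cond (fun hb => Runs.natSet ?_) (fun hb => Runs.natSet ?_)) ?_) (by decide)
    · have : R < k := by simpa [BExp.holds, NExp.eval, nvar, sizeE, hs₁, g1.size] using hb
      simp [this, NExp.eval, nvar, hs₁, g3]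
    · have : ¬ R < k := by simpa [BExp.holds, NExp.eval, nvar, sizeE, hs₁, g1.size] using hb
      simp [this, NExp.eval, nvar, hs₁, g3]
    · rintro _ rfl
      refine Runs.le (Runs.natSet ?_) (by decide)
      refine ⟨g1.frame ?_ ?_ ?_ ?_ ?_ ?_ ?_ ?_ ?_ ?_ ?_, ?_, ?_, ?_⟩
      · intro j _; simp [hs₁]
      any_goals funext j
      any_goals simp [hs₁, NExp.eval, nvar, g2, g3]
      intro j hj
      by_cases hji : (j : ℕ) = i
      · obtain rfl : j = ⟨i, hi⟩ := Fin.ext hji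
        simp [hmem]
      · simp only [hji, if_false]
        exact g4 j (by omega)
  · rintro s' ⟨g1, g2, g3, g4⟩
    refine ⟨g1, ?_⟩
    ext j
    simpa [State.cache] using g4 j j.2
  · simp only [NExp.cost, BExp.cost, nvar, pagesE]
    have : n * (1 + 1 + (1 + 1) + 1 + 250 * (n + 1) + 1) ≤ n * (260 * (n + 1)) :=
      Nat.mul_le_mul_left _ (by omega)
    omega

end Rows

end Paging

namespace Paging

open Finset

/-! ### Initialization and the correctness of one full round. -/

section Initialization

variable {n k l T : ℕ} {r : ℕ → Fin n} {ω : Coins} {t : ℕ} {s : State}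

theorem two_pow_lt_iff_lt_clog {N i : ℕ} : 2 ^ i < N ↔ i < Nat.clog 2 N := by
  rw [← not_le, ← not_le, Nat.clog_le_iff_le_pow (by norm_num)]

theorem runs_initSizeP (hn : s.nat 0 0 = n) (hT : s.nat 0 2 = T) (hl : l = Nat.clog 2 (n * T)) :
    Runs ω initSizeP s (40 * (l + 1)) fun s' =>
      s' = ((s.setNat 6 0 l).setNat 15 0 (2 ^ l)).setReal 5 0 (minWeight l) := by
  refine Runs.le (Runs.natSet_seq (Runs.natSet_seq (Runs.seq (B' := 12)
    (R := fun s' => s' = (s.setNat 6 0 l).setNat 15 0 (2 ^ l)) (Runs.loop (N := l) (B := 15)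
    (fun i s' => s' = (s.setNat 6 0 i).setNat 15 0 (2 ^ i)) ?_ ?_ ?_ (fun _ h => h)) ?_))) ?_
  · simp [NExp.eval]
  · rintro i - _ rfl
    simp [BExp.holds, NExp.eval, nvar, pagesE, horizonE, hn, hT, hl, two_pow_lt_iff_lt_clog]
  · rintro i hi _ rfl
    refine Runs.le (Runs.natSet_seq (Runs.natSet ?_)) (by decide)
    refine State.eq_of (fun a j => ?_) (fun a j => by simp) (by simp)
    simp only [State.nat_setNat, NExp.eval, nvar]
    by_cases ha : a = 6 <;> by_cases ha' : a = 15 <;> by_cases hj : j = 0 <;>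
      simp [ha, ha', hj, pow_succ, mul_two]
  · rintro _ rfl
    refine Runs.le (Runs.realSet ?_) (by decide)
    simp [RExp.eval, NExp.eval, nvar, oneE, minWeight]
  · simp only [NExp.cost, BExp.cost, nvar, pagesE, horizonE]
    omega

theorem runs_initSampleP {e : ℝ} (hn : s.nat 0 0 = n) (hl : s.nat 6 0 = l) (he : s.real 5 0 = e)
    (hd : s.drawn = 0) :
    Runs ω initSampleP s (30 * (n + l + 2)) fun s' => (∀ a ≠ 8, s'.nat a = s.nat a) ∧
      (∀ i < n, s'.real 0 i = ω i) ∧ (∀ a ≤ l, s'.real 1 a = ω (n + a)) ∧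
      (∀ a ≤ l, s'.real 2 a = e) ∧ s'.real 5 0 = e := by
  refine Runs.le (Runs.natSet_seq (Runs.seq (B := n * 20 + 10) (B' := (l + 1) * 25 + 15)
    (R := fun s' => (∀ a ≠ 8, s'.nat a = s.nat a) ∧ (∀ i < n, s'.real 0 i = ω i) ∧
      s'.real 5 0 = e ∧ s'.drawn = n)
    (Runs.le (Runs.loop (N := n) (B := 12) (fun i s' => (∀ a ≠ 8, s'.nat a = s.nat a) ∧
      (∀ j < i, s'.real 0 j = ω j) ∧ s'.real 5 0 = e ∧ s'.drawn = i ∧ s'.nat 8 0 = i)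
      ?_ ?_ ?_ ?_) ?_) ?_)) ?_
  · refine ⟨fun a h8 => ?_, by simp, by simp [he], by simp [hd], by simp [NExp.eval]⟩
    funext j; simp [h8]
  · rintro i - s' ⟨g1, g2, g3, g4, g5⟩
    simp [BExp.holds, NExp.eval, nvar, pagesE, g1, g5, hn]
  · rintro i hi s' ⟨g1, g2, g3, g4, g5⟩
    refine Runs.le (Runs.sample_seq (Runs.natSet ?_)) (by decide)
    refine ⟨fun a h8 => ?_, fun j hj => ?_, ?_, ?_, ?_⟩
    · funext j; simp [h8, g1]
    · simp only [State.real_setNat, State.real_setReal, NExp.eval, nvar, g5, g4, true_and]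
      split_ifs with h
      · rw [h]
      · exact g2 j (by omega)
    · simp [g3]
    · simp [g4]
    · simp [NExp.eval, nvar, g5]
  · rintro s' ⟨g1, g2, g3, g4, g5⟩
    exact ⟨g1, g2, g3, g4⟩
  · simp only [BExp.cost, NExp.cost, nvar, pagesE]
    omega
  · rintro s₁ ⟨f1, f2, f3, f4⟩
    refine Runs.le (Runs.natSet_seq (Runs.loop (N := l + 1) (B := 16) (fun i s' =>
      (∀ a ≠ 8, s'.nat a = s.nat a) ∧ (∀ j < n, s'.real 0 j = ω j) ∧
      (∀ j < i, s'.real 1 j = ω (n + j)) ∧ (∀ j < i, s'.real 2 j = e) ∧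
      s'.real 5 0 = e ∧ s'.drawn = n + i ∧ s'.nat 8 0 = i) ?_ ?_ ?_ ?_)) ?_
    · refine ⟨fun a h8 => ?_, by simpa using f2, by simp, by simp, by simp [f3], by simp [f4],
        by simp [NExp.eval]⟩
      funext j; simp [h8, f1]
    · rintro i - s' ⟨g1, g2, g3, g4, g5, g6, g7⟩
      simp [BExp.holds, NExp.eval, nvar, g1, g7, hl]
    · rintro i hi s' ⟨g1, g2, g3, g4, g5, g6, g7⟩
      refine Runs.le (Runs.sample_seq (Runs.realSet_seq (Runs.natSet ?_))) (by decide)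
      refine ⟨fun a h8 => ?_, fun j hj => ?_, fun j hj => ?_, fun j hj => ?_, ?_, ?_, ?_⟩
      · funext j; simp [h8, g1]
      · simp [g2 j hj]
      · simp only [State.real_setNat, State.real_setReal, NExp.eval, nvar, g6, g7]
        by_cases h : j = i
        · simp [h]
        · simp [h, g3 j (by omega)]
      · simp only [State.real_setNat, State.real_setReal, NExp.eval, nvar, g7, RExp.eval, rvar,
          State.nat_setReal]
        by_cases h : j = i
        · simp [h, g5]
        · simp [h, g4 j (by omega)]
      · simp [g5]
      · simp [g6, add_assoc]
      · simp [NExp.eval, nvar, g7]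
    · rintro s' ⟨g1, g2, g3, g4, g5, g6, g7⟩
      exact ⟨g1, g2, fun a ha => g3 a (by omega), fun a ha => g4 a (by omega), g5⟩
    · simp only [BExp.cost, NExp.cost, nvar]
      omega
  · simp only [NExp.cost]
    omega

theorem runs_initScaleP (hl : s.nat 6 0 = l) :
    Runs ω initScaleP s (50 * (l + 1)) fun s' => s'.real = s.real ∧
      (∀ a, a ≠ 0 → a ≠ 3 → a ≠ 4 → a ≠ 8 → a ≠ 15 → a ≠ 16 → s'.nat a = s.nat a) ∧
      (∀ i ≠ 4, s'.nat 0 i = s.nat 0 i) ∧ s'.nat 0 4 = 1 ∧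
      (∀ m ≤ l, s'.nat 3 m = rowScale l m) ∧
      (∀ m, 1 ≤ m → m ≤ l → s'.nat 4 m = blockLength l m) := by
  refine Runs.le (Runs.natSet_seq (Runs.natSet_seq (Runs.natSet_seq (Runs.seq (B' := 6)
    (R := fun s' => s'.real = s.real ∧
      (∀ a, a ≠ 3 → a ≠ 4 → a ≠ 8 → a ≠ 15 → a ≠ 16 → s'.nat a = s.nat a) ∧
      ∀ m, 1 ≤ m → m ≤ l → s'.nat 3 m = 2 ^ (l - m) ∧ s'.nat 4 m = l * 4 ^ (l - m))
    (Runs.loop (N := l) (B := 35) (fun i s' => s'.real = s.real ∧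
      (∀ a, a ≠ 3 → a ≠ 4 → a ≠ 8 → a ≠ 15 → a ≠ 16 → s'.nat a = s.nat a) ∧
      (∀ m, l - i < m → m ≤ l → s'.nat 3 m = 2 ^ (l - m) ∧ s'.nat 4 m = l * 4 ^ (l - m)) ∧
      s'.nat 15 0 = 2 ^ i ∧ s'.nat 16 0 = l * 4 ^ i ∧ s'.nat 8 0 = i) ?_ ?_ ?_ ?_) ?_)))) ?_
  · refine ⟨by simp, fun a h3 h4 h8 h15 h16 => ?_, fun m h1 h2 => by omega, ?_, ?_, ?_⟩
    · funext j; simp [h8, h15, h16]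
    all_goals simp [NExp.eval, nvar, hl]
  · rintro i - s' ⟨g1, g2, g3, g4, g5, g6⟩
    simp [BExp.holds, NExp.eval, nvar, g2, g6, hl]
  · rintro i hi s' ⟨g1, g2, g3, g4, g5, g6⟩
    have h6 : s'.nat 6 0 = l := by simp [g2, hl]
    refine Runs.le (Runs.natSet_seq (Runs.natSet_seq (Runs.natSet_seq (Runs.natSet_seq
      (Runs.natSet ?_))))) (by decide)
    refine ⟨by simp [g1], fun a h3 h4 h8 h15 h16 => ?_, fun m h1 h2 => ?_, ?_, ?_, ?_⟩
    · funext j; simp [h3, h4, h8, h15, h16, g2]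
    · by_cases hm : m = l - i
      · have hi' : l - m = i := by omega
        rw [hi']
        simp [NExp.eval, nvar, h6, g4, g5, g6, hm]
      · have := g3 m (by omega) h2
        simpa [NExp.eval, nvar, h6, g4, g5, g6, hm] using this
    · simp [NExp.eval, nvar, g4, pow_succ, mul_two]
    · simp [NExp.eval, nvar, g5, pow_succ, mul_assoc]
    · simp [NExp.eval, nvar, g6]
  · rintro s' ⟨g1, g2, g3, g4, g5, g6⟩
    exact ⟨g1, g2, fun m h1 h2 => g3 m (by omega) h2⟩
  · rintro s₁ ⟨g1, g2, g3⟩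
    refine Runs.le (Runs.natSet_seq (Runs.natSet ?_)) (by decide)
    refine ⟨by simp [g1], fun a h0 h3 h4 h8 h15 h16 => ?_, fun i hi => ?_, ?_, fun m hm => ?_,
      fun m h1 h2 => ?_⟩
    · funext j; simp [h0, h3, g2 a h3 h4 h8 h15 h16]
    · simp [NExp.eval, hi, g2]
    · simp [NExp.eval]
    · by_cases h0 : m = 0
      · simp [NExp.eval, rowScale, h0]
      · simp [NExp.eval, rowScale, h0, g3 m (by omega) hm]
    · simp [blockLength, g3 m h1 h2]
  · simp only [NExp.cost, BExp.cost, nvar]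
    omega

theorem rowCounts_zero (a : ℕ) (i : Fin n) : rowCounts k l r a 0 i = 0 := by
  unfold rowCounts
  split_ifs <;> rfl

/-- The memory at the beginning of a round, before the request is written. -/
def Between (k l T : ℕ) (r : ℕ → Fin n) (ω : Coins) (t : ℕ) (s : State) : Prop :=
  if t = 0 then s = initialState n k T else Ready k l r ω t 0 s

theorem runs_initP (hl : l = Nat.clog 2 (n * T)) {i : Fin n} :
    Runs ω (.seq initSizeP (.seq initSampleP initScaleP)) ((initialState n k T).withRequest i)
      (200 * (n + l + 1)) fun s' => Ready k l r ω 0 0 s' ∧ s'.nat 0 3 = i := by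
  refine Runs.le (Runs.seq (B' := 150 * (n + l + 1)) (runs_initSizeP (n := n) (T := T) (l := l)
    (by simp [State.withRequest, initialState]) (by simp [State.withRequest, initialState]) hl) ?_)
    (by omega)
  rintro _ rfl
  refine Runs.le (Runs.seq (B' := 50 * (l + 1)) (runs_initSampleP (n := n) (l := l) (e := minWeight l)
    (by simp [State.withRequest, initialState]) (by simp) (by simp)
    (by simp [State.withRequest, initialState])) ?_) (by omega)
  rintro s₁ ⟨f1, f2, f3, f4, f5⟩
  refine Runs.mono (runs_initScaleP (l := l) (by simp [f1])) le_rfl ?_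
  rintro s₂ ⟨g1, g2, g3, g4, g5, g6⟩
  refine ⟨⟨?_, ?_, g4, ?_, fun a ha i => ?_, g5, g6, fun a h1 h2 => ?_, ?_, fun i => ?_,
    fun a ha => ?_, fun a h1 h2 => ?_, ?_⟩, ?_⟩
  · simp [g3, f1, State.withRequest, initialState]
  · simp [g3, f1, State.withRequest, initialState]
  · simp [g2, f1]
  · simp [g2, f1, State.withRequest, initialState, rowCounts_zero]
  · simp [g2, f1, State.withRequest, initialState]
  · simp [g2, f1, State.withRequest, initialState, marked, markClass]
  · rw [g1, f2 i i.2]; rfl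
  · rw [g1, f3 a ha]
  · rw [g1, f4 a h2]; rfl
  · rw [g1, f5]
  · simp [g3, f1, State.withRequest]

theorem runs_pagingP (hl : l = Nat.clog 2 (n * T)) (h : Between k l T r ω t s) :
    Runs ω pagingP (s.withRequest (r (t + 1))) (1000 * ((n + 1) * (n + l + 1))) fun s' =>
      Between k l T r ω (t + 1) s' ∧ s'.cache n = levelCache k l r ω l (t + 1) := by
  refine Runs.le (Runs.seq (B' := 400 * (n + 1) + (l * (520 * (n + 1)) + 40 +
    (n * (260 * (n + 1)) + 40))) (R := fun s' => Ready k l r ω t 0 s' ∧ s'.nat 0 3 = r (t + 1))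
    (Runs.cond (B := 200 * (n + l + 1)) (B' := 1) (fun hb => ?_) (fun hb => Runs.skip ?_)) ?_) ?_
  · by_cases ht : t = 0
    · subst ht
      rw [show s = initialState n k T by simpa [Between] using h]
      exact runs_initP hl
    · rw [Between, if_neg ht] at h
      simp [BExp.holds, NExp.eval, State.withRequest, h.flag] at hb
  · by_cases ht : t = 0
    · rw [show s = initialState n k T by simpa [Between, ht] using h] at hb
      simp [BExp.holds, NExp.eval, State.withRequest, initialState] at hb
    · rw [Between, if_neg ht] at h
      refine ⟨h.frame ?_ ?_ ?_ ?_ ?_ ?_ ?_ ?_ ?_ ?_ ?_, by simp [State.withRequest]⟩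
      · intro i hi; simp [State.withRequest, hi]
      any_goals funext j
      all_goals simp [State.withRequest]
  · rintro s₁ ⟨h1, h2⟩
    refine Runs.seq (runs_markP h1 h2) ?_
    rintro s₂ ⟨h3, h4, h5⟩
    refine Runs.seq (runs_rowsP h3 h4 h5) ?_
    rintro s₃ ⟨h6, h7⟩
    refine Runs.mono (runs_outputP h6 h7) le_rfl ?_
    rintro s₄ ⟨h8, h9⟩
    exact ⟨by rwa [Between, if_neg (Nat.succ_ne_zero t)], h9⟩
  · simp only [BExp.cost, NExp.cost]
    rw [max_eq_left (by omega)]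
    ring_nf
    nlinarith [Nat.zero_le (n * l), Nat.zero_le (n ^ 2)]

end Initialization

end Paging

namespace Paging

open Finset MeasureTheory

/-! ### Assembling the bounds on runtime, competitive ratio and regret. -/

section Conclusion

variable {n k l T : ℕ} {r : ℕ → Fin n}

theorem le_two_pow_clog (hn : 1 ≤ n) : T ≤ 2 ^ Nat.clog 2 (n * T) :=
  (Nat.le_mul_of_pos_left T hn).trans (Nat.le_pow_clog (by norm_num) _)

theorem clog_sub_one_mul_log_two_le {N : ℕ} (hN : 2 ≤ N) :
    ((Nat.clog 2 N : ℝ) - 1) * Real.log 2 ≤ Real.log N := by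
  have h1 : 1 ≤ Nat.clog 2 N := Nat.clog_pos (by norm_num) hN
  have h2 : (2 : ℝ) ^ (Nat.clog 2 N - 1) ≤ N := by
    exact_mod_cast (Nat.pow_pred_clog_lt_self (by norm_num : 1 < 2) hN).le
  have h3 := Real.log_le_log (by positivity) h2
  rw [Real.log_pow, Nat.cast_sub h1] at h3
  simpa using h3

theorem clog_le_four_mul_log {N : ℕ} (hN : 2 ≤ N) : (Nat.clog 2 N : ℝ) ≤ 4 * Real.log N := by
  have h1 := clog_sub_one_mul_log_two_le hN
  have h2 : Real.log 2 ≤ Real.log N := Real.log_le_log (by norm_num) (by exact_mod_cast hN)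
  have h3 := Real.log_two_gt_d9
  nlinarith

/-- With `X = n + log T`, the inequality `log n ≤ n - 1` gives `log (n * T) ≤ X` and hence `Nat.clog
2 (n * T) ≤ 3 * X`, so the step count is at most `1000 * (2 * X) * (5 * X)`; this is where `10000`
comes from. -/
theorem steps_le (hn : 1 ≤ n) (hT : 1 ≤ T) {d : ℕ} (hd : 10000 ≤ d) :
    ((1000 * ((n + 1) * (n + Nat.clog 2 (n * T) + 1)) : ℕ) : ℝ) ≤
      (d : ℝ) * ((n : ℝ) + Real.log T) ^ d := by
  have hn1 : (1 : ℝ) ≤ n := by exact_mod_cast hn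
  have hT1 : (1 : ℝ) ≤ T := by exact_mod_cast hT
  have hlogT := Real.log_nonneg hT1
  set X := (n : ℝ) + Real.log T with hX
  have hX1 : 1 ≤ X := by linarith
  have hl : (Nat.clog 2 (n * T) : ℝ) ≤ 3 * X := by
    by_cases h : 2 ≤ n * T
    · have h1 := clog_sub_one_mul_log_two_le h
      have h2 : Real.log ((n * T : ℕ) : ℝ) ≤ X := by
        rw [Nat.cast_mul, Real.log_mul (by positivity) (by positivity)]
        have := Real.log_le_sub_one_of_pos (show (0 : ℝ) < n by positivity)
        linarith
      have h3 := Real.log_two_gt_d9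
      nlinarith
    · rw [Nat.clog_of_right_le_one (by omega)]
      simp only [Nat.cast_zero]
      linarith
  have h1 : ((n : ℝ) + 1) * (n + Nat.clog 2 (n * T) + 1) ≤ (2 * X) * (5 * X) :=
    mul_le_mul (by linarith) (by linarith) (by positivity) (by linarith)
  have h2 : X ^ 2 ≤ X ^ d := pow_le_pow_right₀ hX1 (by omega)
  have h3 : (10000 : ℝ) * X ^ 2 ≤ d * X ^ d :=
    mul_le_mul (by exact_mod_cast hd) h2 (by positivity) (by positivity)
  push_cast
  linarith

theorem selects_levelCache (hk : 1 ≤ k) (hkn : k ≤ n) (hT : 1 ≤ T) {d : ℕ} (hd : 10000 ≤ d)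
    (ω : Coins) :
    Selects pagingP n k T r ω ((d : ℝ) * ((n : ℝ) + Real.log T) ^ d)
      (levelCache k (Nat.clog 2 (n * T)) r ω (Nat.clog 2 (n * T))) := by
  classical
  set l := Nat.clog 2 (n * T) with hl
  -- One successor memory per admissible memory; iterating `next` yields the whole run.
  choose! τ next hexec hτ hgood using fun (t : ℕ) (s : State) (h : Between k l T r ω t s) =>
    runs_pagingP (s := s) hl h
  let S : ℕ → State := fun t => Nat.rec (initialState n k T) next t
  have hS : ∀ t, Between k l T r ω t (S t) := by
    intro t
    induction t with
    | zero => simp [Between, S]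
    | succ t ih => exact (hgood t _ ih).1
  refine ⟨S, rfl, fun t ht => ?_⟩
  obtain ⟨t, rfl⟩ : ∃ t', t = t' + 1 := ⟨t - 1, by have := (mem_Icc.1 ht).1; omega⟩
  refine ⟨⟨τ t (S t), ?_, hexec t _ (hS t)⟩, (hgood t _ (hS t)).2.symm, card_levelCache hkn _ _ _⟩
  exact (Nat.cast_le.2 (hτ t _ (hS t))).trans (steps_le (hk.trans hkn) hT hd)

theorem sum_roundCost_eq_intervalCost {C C' : ℕ → Finset (Fin n)} (hT : 1 ≤ T)
    (h₀ : C' 0 = C 1) (h : ∀ t, 1 ≤ t → C' t = C t) :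
    ∑ t ∈ Ioc 0 T, roundCost (r t) (C' t) (C' (t - 1)) = intervalCost r C 1 T := by
  have e1 : Ioc 0 T = Icc 1 T := by ext; simp [Nat.succ_le_iff]
  have e2 : Icc 1 T = insert 1 (Icc 2 T) := by ext; simp; omega
  unfold roundCost intervalCost
  rw [sum_add_distrib, e1]
  congr 1
  · exact sum_congr rfl fun t ht => by rw [h t (mem_Icc.1 ht).1]
  · rw [e2, sum_insert (by simp)]
    simp only [h 1 le_rfl, Nat.sub_self, h₀]
    rw [show moveCost (C 1) (C 1) = 0 by simp [moveCost], zero_add]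
    refine sum_congr rfl fun t ht => ?_
    have := (mem_Icc.1 ht).1
    rw [h t (by omega), h (t - 1) (by omega)]

theorem competitive_levelCache (hk : 1 ≤ k) (hkn : k ≤ n) (hT : 1 ≤ T) (hb : T ≤ 2 ^ l)
    {C : ℕ → Finset (Fin n)} (hC : ∀ t ∈ Icc 1 T, (C t).card = k) :
    ∫ ω, intervalCost r (levelCache k l r ω l) 1 T ∂coinMeasure ≤
      2 * (harmonic k : ℝ) * intervalCost r C 1 T + (harmonic k * k + 15 * k) := by
  -- Letting the offline strategy start in `C 1` makes its first move free, in agreement with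
  -- `intervalCost`.
  set C' : ℕ → Finset (Fin n) := fun t => if t = 0 then C 1 else C t with hC'
  have h1 := marking_competitive (r := r) hk hkn l (C := C') (T := T) (fun t ht => by
    by_cases h0 : t = 0
    · simp [hC', h0, hC 1 (mem_Icc.2 ⟨le_rfl, hT⟩)]
    · simp [hC', h0, hC t (mem_Icc.2 ⟨by omega, ht⟩)])
  rw [sum_roundCost_eq_intervalCost (C := C) hT (by simp [hC'])
    fun t ht => by simp [hC', show t ≠ 0 by omega]] at h1
  have e1 : Icc 1 T = Ioc 0 T := by ext; simp [Nat.succ_le_iff]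
  have h2 := integral_intervalCost_le (r := r) (l := l) hk hkn (b := T) le_rfl
  rw [e1] at h2
  have hrow : Tame fun ω : Coins => ∑ t ∈ Ioc 0 T, rowCost k l r (noise n ω) 0 t :=
    Tame.sum fun t _ => tame_rowCost 0 t
  have h3 : ∫ ω, ∑ t ∈ Ioc 0 T, levelCost k l r (noise n ω) l t ∂coinMeasure ≤
      ∫ ω, (∑ t ∈ Ioc 0 T, rowCost k l r (noise n ω) 0 t + 15 * k) ∂coinMeasure :=
    integral_mono (Tame.sum fun t _ => tame_levelCost hk l t).integrable
      (hrow.add (Tame.const _)).integrable fun ω => sum_levelCost_le_marking hk hb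
  rw [integral_add hrow.integrable (integrable_const _),
    integral_finsetSum _ fun t _ => (tame_rowCost 0 t).integrable, integral_const] at h3
  simp only [probReal_univ, one_smul] at h3
  linarith

theorem regret_levelCache (hk : 1 ≤ k) (hkn : k ≤ n) {a b : ℕ} (ha : 1 ≤ a) (hab : a ≤ b)
    (hb : b ≤ T) {C : Finset (Fin n)} (hC : C.card = k) :
    ∫ ω, intervalCost r (levelCache k (Nat.clog 2 (n * T)) r ω (Nat.clog 2 (n * T))) a b
        ∂coinMeasure ≤
      ∑ t ∈ Icc a b, missLoss (r t) C +
        1280 * (k * √((Icc a b).card * Real.log ((n : ℝ) * T))) := by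
  set l := Nat.clog 2 (n * T) with hl
  have hT : T ≤ 2 ^ l := le_two_pow_clog (hk.trans hkn)
  -- If `n = k`, every cache contains all pages and the cost is zero; this covers `n * T = 1`, where
  -- the logarithm vanishes. Otherwise `n ≥ 2`, and `l` is positive and at most `4 * log (n * T)`.
  by_cases hn : n = k
  · have : ∀ ω, intervalCost r (levelCache k l r ω l) a b = 0 := fun ω =>
      intervalCost_eq_zero_of_univ fun t _ => by
        rw [← card_eq_iff_eq_univ, card_levelCache hkn, Fintype.card_fin, hn]
    simp only [this, integral_zero]
    exact add_nonneg (sum_nonneg fun _ _ => missLoss_nonneg _ _) (by positivity)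
  · have hnT : 2 ≤ n * T := by nlinarith [show 2 ≤ n by omega, show 1 ≤ T by omega]
    have hl1 : 1 ≤ l := Nat.clog_pos (by norm_num) hnT
    obtain ⟨a, rfl⟩ : ∃ a', a = a' + 1 := ⟨a - 1, by omega⟩
    have e1 : Icc (a + 1) b = Ioc a b := by ext; simp
    have h1 := integral_intervalCost_le (r := r) (l := l) hk hkn (b := b) ha
    have h2 := regret_interval (r := r) hk hkn hl1 hC (b - a) (a := a) (b := b) (by omega) le_rfl
      (hb.trans hT)
    rw [e1] at h1 ⊢
    refine h1.trans (h2.trans (add_le_add le_rfl ?_))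
    have h3 : (l : ℝ) ≤ 4 * Real.log ((n : ℝ) * T) := by
      have := clog_le_four_mul_log hnT
      rwa [Nat.cast_mul] at this
    have hab' : (a : ℝ) ≤ b := by exact_mod_cast (by omega : a ≤ b)
    -- The factor `4` between `l` and the logarithm doubles the constant `640`.
    have h4 : √(l * ((b : ℝ) - a)) ≤ 2 * √((Ioc a b).card * Real.log ((n : ℝ) * T)) := by
      rw [Nat.card_Ioc, Nat.cast_sub (by omega), show (2 : ℝ) = √4 by
        rw [show (4 : ℝ) = 2 ^ 2 by norm_num]; simp, ← Real.sqrt_mul (by norm_num)]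
      refine Real.sqrt_le_sqrt ?_
      nlinarith
    have h5 := mul_le_mul_of_nonneg_left h4 (Nat.cast_nonneg (α := ℝ) k)
    linarith

end Conclusion

end Paging

theorem mainTheorem8 :
    ∃ (P : Paging.Program) (d : ℕ) (K : ℝ),
      ∀ n k : ℕ, 1 ≤ k → k ≤ n → ∃ β : ℝ, 0 < β ∧
        ∀ T : ℕ, 1 ≤ T → ∀ r : ℕ → Fin n,
          ∃ A : Paging.Coins → ℕ → Finset (Fin n),
            (∀ ω : Paging.Coins,
              Paging.Selects P n k T r ω ((d : ℝ) * ((n : ℝ) + Real.log (T : ℝ)) ^ d) (A ω)) ∧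
            (∀ t ∈ Finset.Icc 1 T, ∀ C : Finset (Fin n), MeasurableSet {ω | A ω t = C}) ∧
            (∀ C : ℕ → Finset (Fin n), (∀ t ∈ Finset.Icc 1 T, (C t).card = k) →
              ∫ ω, Paging.intervalCost r (A ω) 1 T ∂Paging.coinMeasure ≤
                2 * (harmonic k : ℝ) * Paging.intervalCost r C 1 T + β) ∧
            (∀ a b : ℕ, 1 ≤ a → a ≤ b → b ≤ T →
              ∀ C : Finset (Fin n), C.card = k →
                ∫ ω, Paging.intervalCost r (A ω) a b ∂Paging.coinMeasure ≤
                  ∑ t ∈ Finset.Icc a b, Paging.missLoss (r t) C +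
                    K * ((k : ℝ) * Real.sqrt
                      (((Finset.Icc a b).card : ℝ) * Real.log ((n : ℝ) * (T : ℝ))))) := by
  -- In the additive constant, `k * H_k` pays for the first marking phase and `15 * k` for merging
  -- the rows; neither depends on `T`.
  refine ⟨Paging.pagingP, 10000, 1280, fun n k hk hkn => ⟨harmonic k * k + 15 * k, ?_,
    fun T hT r => ⟨fun ω => Paging.levelCache k (Nat.clog 2 (n * T)) r ω (Nat.clog 2 (n * T)),
      fun ω => Paging.selects_levelCache hk hkn hT le_rfl ω,
      fun t _ C => Paging.measurableSet_levelCache_eq _ t C,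
      fun C hC => Paging.competitive_levelCache hk hkn hT
        (Paging.le_two_pow_clog (hk.trans hkn)) hC,
      fun a b ha hab hb C hC => Paging.regret_levelCache hk hkn ha hab hb hC⟩⟩⟩
  have h1 : (0 : ℝ) < k := by exact_mod_cast hk
  have h2 : (0 : ℝ) < harmonic k := by exact_mod_cast harmonic_pos (by omega)
  positivity
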